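/- Fix $r_0>0$. Let $\mathcal C$ be the class of couples $(V,B)$ where $V:\mathbb R^2\to\mathbb R$ is radial, compactly supported and piecewise continuous (as a function of $r=|x|$: finitely many discontinuities, finite one-sided limits), and $B=dA$ is a radial, compactly supported, smooth magnetic field, identified with $b=\partial_1A_2-\partial_2A_1$, of a smooth magnetic potential $A:\mathbb R^2\to\mathbb R^2$ satisfying the gauge condition $A(x)=-\int_0^1 sB(sx)\,x\,ds$, where $B=\begin{pmatrix}0&b\\-b&0\end{pmatrix}$. Let $(V,B),(\tilde V,\tilde B)\in\mathcal C$ and let $R>0$ be such that $V,B,\tilde V,\tilde B$ all vanish outside the ball of radius $R$ centred at the origin. Put $\gamma(r)=\int_0^r b(\tau)\,\tau\,d\tau$ (so that $2\pi\gamma(R)$ is the flux of $B$) and, for $\nu\in\mathbb C$, $\nu_R=\nu-\gamma(R)$ and $$q_\nu(r)=-\frac{2\nu(\gamma(r)-\gamma(R))}{r^2}+\frac{\gamma(r)^2-\gamma(R)^2}{r^2}+V(r).$$ Let $F^{\pm}(\cdot,\nu)$ be the Jost solutions, i.e. the solutions on $[r_0,\infty)$ of $$-u''+\Big(\frac{\nu_R^2-\frac14}{r^2}+q_\nu(r)\Big)u=u,\qquad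 F^\pm(r,\nu)\sim e^{\pm ir}\quad (r\to+\infty),$$ let $\alpha(\nu)=iF^-(r_0,\nu)$ and $\beta(\nu)=-iF^+(r_0,\nu)$ be the Jost functions, and let $$\sigma(\nu)=e^{i\pi(\nu+\frac12)}\frac{\alpha(\nu)}{\beta(\nu)}$$ be the Regge interpolation function. Let $\delta:\mathbb R\to\mathbb R$ be a phase shift function, i.e. a continuous function with $\sigma(\nu)=e^{2i\delta(\nu)}$ for all $\nu\in\mathbb R$, and write $\delta_l=\delta(l)$. Let $\tilde\gamma$ and $\tilde\delta$ be the corresponding objects for $(\tilde V,\tilde B)$. Let $\mathcal L\subset\{1,2,3,\dots\}$ satisfy the Müntz condition $\sum_{l\in\mathcal L}\frac1l=+\infty$. If $\delta_l=\tilde\delta_l$ for all $l\in\mathcal L$, then $\gamma(R)=\tilde\gamma(R)$, i.e. the magnetic fluxes of $B$ and $\tilde B$ coincide. -/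

import Mathlib

open scoped ContDiff Matrix

noncomputable section

namespace MagneticScattering

/-- The Euclidean plane. -/
abbrev Plane : Type := EuclideanSpace ℝ (Fin 2)

/-- The component `b = ∂₁A₂ - ∂₂A₁` of the magnetic field `B = dA`. -/
def curl (A : Plane → Plane) (x : Plane) : ℝ :=
  (fderiv ℝ A x !₂[1, 0]) 1 - (fderiv ℝ A x !₂[0, 1]) 0

/-- The antisymmetric matrix of the 2-form `B` with component `b`. -/
def fieldMatrix (b : Plane → ℝ) (x : Plane) : Matrix (Fin 2) (Fin 2) ℝ :=
  !![0, b x; -b x, 0]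

/-- The class of magnetic potentials: `A` is smooth on the plane and satisfies the transversal
gauge condition `A(x) = - ∫₀¹ s B(s x) x ds`, where `B = dA`. -/
structure IsGaugePotential (A : Plane → Plane) : Prop where
  smooth : ContDiff ℝ ∞ A
  gauge : ∀ x : Plane, A x = -∫ s in (0 : ℝ)..1,
    s • (WithLp.toLp 2 (fieldMatrix (curl A) (s • x) *ᵥ WithLp.ofLp x) : Plane)

/-- A function on the plane is radial if its value depends on `|x|` only. -/
def IsRadial (f : Plane → ℝ) : Prop := ∀ x y : Plane, ‖x‖ = ‖y‖ → f x = f y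

/-- The profile `r ↦ f(r)` of a radial function (evaluated along the first axis). -/
def profile (f : Plane → ℝ) (r : ℝ) : ℝ := f !₂[r, 0]

/-- Piecewise continuity on the line: continuity off a finite set, at each point of which
both one-sided limits exist and are finite. -/
def IsPiecewiseContinuous (f : ℝ → ℝ) : Prop :=
  ∃ S : Set ℝ, S.Finite ∧ (∀ r ∉ S, ContinuousAt f r) ∧
    ∀ r ∈ S, (∃ a : ℝ, Filter.Tendsto f (nhdsWithin r (Set.Iio r)) (nhds a)) ∧
      ∃ c : ℝ, Filter.Tendsto f (nhdsWithin r (Set.Ioi r)) (nhds c)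

/-- The class `𝒞` of couples `(V, B)`; the 2-form `B` is given by its component `b`. -/
structure IsClassC (V b : Plane → ℝ) : Prop where
  exists_potential : ∃ A : Plane → Plane, IsGaugePotential A ∧ b = curl A
  radial_V : IsRadial V
  radial_b : IsRadial b
  compact_V : HasCompactSupport V
  compact_b : HasCompactSupport b
  piecewise_V : IsPiecewiseContinuous (profile V)
  smooth_b : ContDiff ℝ ∞ b

/-- `γ(r) = ∫₀ʳ b(τ) τ dτ`, for a radial `b`. -/
def gammaFun (b : Plane → ℝ) (r : ℝ) : ℝ := ∫ τ in (0 : ℝ)..r, profile b τ * τ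

/-- The potential
`q_ν(r) = -2ν(γ(r) - γ(R))/r² + (γ(r)² - γ(R)²)/r² + V(r)`. -/
def qPot (V b : Plane → ℝ) (R : ℝ) (ν : ℂ) (r : ℝ) : ℂ :=
  -(2 * ν * ((gammaFun b r : ℂ) - gammaFun b R)) / (r : ℂ) ^ 2
    + ((gammaFun b r : ℂ) ^ 2 - (gammaFun b R : ℂ) ^ 2) / (r : ℂ) ^ 2 + (profile V r : ℂ)

/-- The full radial potential `(ν_R² - 1/4)/r² + q_ν(r)`, with `ν_R = ν - γ(R)`. -/
def radialPot (V b : Plane → ℝ) (R : ℝ) (ν : ℂ) (r : ℝ) : ℂ :=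
  ((ν - gammaFun b R) ^ 2 - 1 / 4) / (r : ℂ) ^ 2 + qPot V b R ν r

/-- `u` solves `-u'' + Q u = u` on `[r₀, ∞)`. As `Q` may have jumps, the equation is read in the
usual (Carathéodory) sense: `u` is differentiable with derivative `w`, and `w` is the integral
of `(Q - 1) u`. -/
def IsRadialSolution (Q : ℝ → ℂ) (r₀ : ℝ) (u : ℝ → ℂ) : Prop :=
  ∃ w : ℝ → ℂ, (∀ r, r₀ ≤ r → HasDerivWithinAt u (w r) (Set.Ici r₀) r) ∧
    ∀ r, r₀ ≤ r →
      IntervalIntegrable (fun s => (Q s - 1) * u s) MeasureTheory.volume r₀ r ∧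
        w r = w r₀ + ∫ s in r₀..r, (Q s - 1) * u s

/-- `u` is the Jost solution `F^±(·, ν)`, with `ε = 1` for `+` and `ε = -1` for `-`:
it solves the stationary equation at energy `1` on `[r₀, ∞)`, and `u(r) ∼ e^{ε i r}`
as `r → ∞`. -/
def IsJostSolution (V b : Plane → ℝ) (r₀ R : ℝ) (ε ν : ℂ) (u : ℝ → ℂ) : Prop :=
  IsRadialSolution (radialPot V b R ν) r₀ u ∧
    Asymptotics.IsEquivalent Filter.atTop u
      (fun r : ℝ => Complex.exp (ε * Complex.I * (r : ℂ)))

/-- The Jost solution (`IsJostSolution` determines it on `[r₀, ∞)`). -/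
def jostSolution (V b : Plane → ℝ) (r₀ R : ℝ) (ε ν : ℂ) : ℝ → ℂ :=
  Classical.epsilon (IsJostSolution V b r₀ R ε ν)

/-- The Jost function `α(ν) = i F⁻(r₀, ν)`; together with `β` it gives the solution
`Φ = α F⁺ + β F⁻` that vanishes at `r₀`. -/
def jostAlpha (V b : Plane → ℝ) (r₀ R : ℝ) (ν : ℂ) : ℂ :=
  Complex.I * jostSolution V b r₀ R (-1) ν r₀

/-- The Jost function `β(ν) = -i F⁺(r₀, ν)`. -/
def jostBeta (V b : Plane → ℝ) (r₀ R : ℝ) (ν : ℂ) : ℂ :=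
  -Complex.I * jostSolution V b r₀ R 1 ν r₀

/-- The Regge interpolation function `σ(ν) = e^{iπ(ν + 1/2)} α(ν)/β(ν)`. -/
def regge (V b : Plane → ℝ) (r₀ R : ℝ) (ν : ℂ) : ℂ :=
  Complex.exp (Complex.I * Real.pi * (ν + 1 / 2)) *
    (jostAlpha V b r₀ R ν / jostBeta V b r₀ R ν)

/-- `δ` is a generalized phase shift function: a continuous function on the real line with
`σ(ν) = e^{2iδ(ν)}`. (It is unique up to an additive constant in `πℤ`.) -/
def IsPhaseShift (V b : Plane → ℝ) (r₀ R : ℝ) (δ : ℝ → ℝ) : Prop :=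
  Continuous δ ∧
    ∀ ν : ℝ, regge V b r₀ R (ν : ℂ) = Complex.exp (2 * Complex.I * (δ ν : ℂ))

end MagneticScattering

end

open MagneticScattering

/-! Put p = (ν - γ(r) - 1/2)/r and v = u' + p u. The radial equation becomes the system u' = -p u +
v, v' = p v + (V - 1 - b) u, whose coupling does not involve ν. Beyond the supports it is the Bessel
equation of order ν - γ(R). Hence F^±(r₀, ν) are Wronskians, at a matching radius still called R, of
the free Jost pairs with the pair (φ, ψ) that starts from (0, 1) at r₀ (`RadialField.jost_apply`); φ
and ψ at R are entire in ν.

For large real ν, ψ dominates φ, and the free outgoing solution has phase exp(iπm/2), m = ν - γ(R) -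
1/2, up to a small relative error (`freeJost_wronskian_eq`). So σ(l) tends to exp(iπγ(R))
(`RadialField.tendsto_regge`). A Müntz set is infinite, so the two values of γ(R) differ by an even
integer.

Suppose the difference is 2k with k > 0. At a common large l the two free Bessel orders differ by
2k, and the three-term recurrence carries one free pair to the other. Let w be the sequence
generated from (φ, ψ) by that recurrence. Equality of the Regge functions at l becomes φ' w_{2k+1} -
ψ' w_{2k} = 0 (`RadialField.ladder_wronskian_eq_zero`). The left side is entire in ν and, for Re ν ≥
0, at most a polynomial in |ν| times exp(c Re ν), so zeros on a Müntz set force it to vanish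
identically (`eq_zero_of_muntz_zeros`).

High on the imaginary axis, ν = iy, this is impossible
(`RadialField.exists_ladder_wronskian_ne_zero`). There φ' is O(1/y), the amplitude ψ' - 2(iy -
γ'(R))φ'/R stays away from zero, and |w_j| is nondecreasing. The last recurrence step has exactly
the coefficient 2(iy - γ'(R))/R, so the vanishing would equate a quantity bounded below by a
multiple of |w_{2k}| with a strictly smaller one. -/

/-! ### Uniqueness for holomorphic functions on a half-plane under a Müntz condition. -/

section Muntz

open Complex Filter Topology Set

/-- Division of a bounded holomorphic function on the right half-plane by the Blaschke factor of a
zero on the positive real axis. -/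
theorem exists_blaschke_quotient {f : ℂ → ℂ} {M l : ℝ} (hl : 0 < l)
    (hf : DifferentiableOn ℂ f {z | -1 < z.re}) (hM : ∀ z : ℂ, 0 ≤ z.re → ‖f z‖ ≤ M)
    (h0 : f l = 0) :
    ∃ h : ℂ → ℂ, DifferentiableOn ℂ h {z | -1 < z.re} ∧ (∀ z : ℂ, 0 ≤ z.re → ‖h z‖ ≤ M) ∧
      ∀ z : ℂ, f z * (z + l) = (z - l) * h z := by
  have hopen : IsOpen {z : ℂ | -1 < z.re} := isOpen_lt continuous_const continuous_re
  have hl_mem : {z : ℂ | -1 < z.re} ∈ 𝓝 (l : ℂ) := hopen.mem_nhds (by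
    simp only [mem_ofPred_eq, ofReal_re]; linarith)
  set h : ℂ → ℂ := fun z => (z + l) * dslope f l z with hh
  have hd : DifferentiableOn ℂ h {z | -1 < z.re} := by
    have : DifferentiableOn ℂ (dslope f l) {z | -1 < z.re} :=
      (Complex.differentiableOn_dslope hl_mem).2 hf
    exact (differentiableOn_id.add_const _).mul this
  have hmul : ∀ z : ℂ, f z * (z + l) = (z - l) * h z := by
    intro z
    have : (z - l) * dslope f l z = f z - f l := by
      simpa [smul_eq_mul] using sub_smul_dslope f (l : ℂ) z
    rw [hh]
    simp only
    rw [mul_left_comm, this, h0, sub_zero, mul_comm]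
  have hclosed : IsClosed {z : ℂ | 0 ≤ z.re} := isClosed_le continuous_const continuous_re
  have hsub : {z : ℂ | 0 ≤ z.re} ⊆ {z : ℂ | -1 < z.re} := fun z hz => by
    simp only [mem_ofPred_eq] at hz ⊢; linarith
  have hM0 : 0 ≤ M := (norm_nonneg _).trans (hM 0 (by simp))
  -- For |z| ≥ 3l one has |z + l| ≤ 2|z - l|; what remains of the half-plane is compact. This crude
  -- bound only serves as the growth hypothesis of Phragmén–Lindelöf.
  have hfar : ∀ z : ℂ, 0 ≤ z.re → 3 * l ≤ ‖z‖ → ‖h z‖ ≤ 2 * M := by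
    intro z hz hzl
    have h1 : ‖z‖ - l ≤ ‖z - l‖ := by
      have := norm_sub_norm_le z (l : ℂ)
      simpa [abs_of_pos hl] using this
    have h2 : ‖z + l‖ ≤ ‖z‖ + l := by
      have := norm_add_le z (l : ℂ)
      simpa [abs_of_pos hl] using this
    have h3 : ‖z - l‖ * ‖h z‖ ≤ M * (2 * (‖z‖ - l)) := by
      rw [← norm_mul, ← hmul, norm_mul]
      exact mul_le_mul (hM z hz) (by linarith) (norm_nonneg _) hM0
    have h4 : 0 < ‖z‖ - l := by linarith
    have h5 : (‖z‖ - l) * ‖h z‖ ≤ (‖z‖ - l) * (2 * M) := by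
      calc (‖z‖ - l) * ‖h z‖ ≤ ‖z - l‖ * ‖h z‖ := by gcongr
        _ ≤ _ := h3
        _ = _ := by ring
    exact le_of_mul_le_mul_left h5 h4
  obtain ⟨C, hC⟩ : ∃ C, ∀ z ∈ Metric.closedBall (0 : ℂ) (3 * l) ∩ {z : ℂ | 0 ≤ z.re}, ‖h z‖ ≤ C :=
    ((isCompact_closedBall _ _).inter_right hclosed).exists_bound_of_continuousOn
      (hd.continuousOn.mono (inter_subset_right.trans hsub))
  have hbdd : ∀ z : ℂ, 0 ≤ z.re → ‖h z‖ ≤ max C (2 * M) := by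
    intro z hz
    rcases le_total (3 * l) ‖z‖ with hzl | hzl
    · exact (hfar z hz hzl).trans (le_max_right _ _)
    · exact (hC z ⟨by simpa using hzl, hz⟩).trans (le_max_left _ _)
  refine ⟨h, hd, fun z hz => ?_, hmul⟩
  have hsub' : {z : ℂ | 0 < z.re} ⊆ {z : ℂ | 0 ≤ z.re} := fun z hz => by
    simp only [mem_ofPred_eq] at hz ⊢; linarith
  have hcl : closure {z : ℂ | 0 < z.re} ⊆ {z : ℂ | -1 < z.re} :=
    (closure_minimal hsub' hclosed).trans hsub
  refine PhragmenLindelof.right_half_plane_of_bounded_on_real (f := h)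
    (DifferentiableOn.diffContOnCl (hd.mono hcl)) ⟨1, by norm_num, 0, ?_⟩ ?_ ?_ hz
  · refine Asymptotics.IsBigO.of_bound (max C (2 * M)) ?_
    refine eventually_inf_principal.2 (Eventually.of_forall fun w hw => ?_)
    simpa using hbdd w (le_of_lt hw)
  · refine ⟨max C (2 * M), eventually_map.2 ((eventually_ge_atTop 0).mono fun x hx => ?_)⟩
    exact hbdd x (by simpa using hx)
  -- On the imaginary axis |z - l| = |z + l|, so |h| = |f| there and the sharp constant M is
  -- recovered.
  · intro x
    have hre : ((x : ℂ) * I).re = 0 := by simp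
    have hne : ‖(x : ℂ) * I - l‖ = ‖(x : ℂ) * I + l‖ := by
      simp [Complex.norm_def, Complex.normSq_apply]
    have hpos : 0 < ‖(x : ℂ) * I + l‖ := by
      refine norm_pos_iff.2 fun h => ?_
      have := congrArg Complex.re h
      simp at this
      exact hl.ne' this
    have := congrArg norm (hmul (x * I))
    rw [norm_mul, norm_mul, hne, mul_comm] at this
    rw [← mul_left_cancel₀ hpos.ne' this]
    exact hM _ hre.ge

/-- Each zero can be divided out without losing the bound M, so the Blaschke factors accumulate at
x. The function is quantified inside the induction because the quotient takes its place. -/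
theorem norm_le_mul_prod_blaschke {M x : ℝ} (hx : 0 < x) (S : Finset ℕ) (hS : ∀ l ∈ S, 0 < l) :
    ∀ f : ℂ → ℂ, DifferentiableOn ℂ f {z | -1 < z.re} → (∀ z : ℂ, 0 ≤ z.re → ‖f z‖ ≤ M) →
      (∀ l ∈ S, f (l : ℂ) = 0) → ‖f x‖ ≤ M * ∏ l ∈ S, |x - l| / (x + l) := by
  induction S using Finset.induction_on with
  | empty => intro f _ hM _; simpa using hM x (by simpa using hx.le)
  | insert a S ha ih =>
    intro f hf hM h0
    have hapos : (0 : ℝ) < a := by exact_mod_cast hS a (Finset.mem_insert_self _ _)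
    obtain ⟨h, hd, hb, hmul⟩ := exists_blaschke_quotient hapos hf hM
      (by simpa using h0 a (Finset.mem_insert_self _ _))
    have hh0 : ∀ l ∈ S, h (l : ℂ) = 0 := by
      intro l hl
      have h1 := hmul l
      rw [h0 l (Finset.mem_insert_of_mem hl), zero_mul] at h1
      have h2 : ((l : ℂ) - ((a : ℝ) : ℂ)) ≠ 0 := by
        rw [sub_ne_zero]
        intro h
        have : l = a := by exact_mod_cast h
        exact ha (this ▸ hl)
      exact (mul_eq_zero.1 h1.symm).resolve_left h2
    have h1 := ih (fun l hl => hS l (Finset.mem_insert_of_mem hl)) h hd hb hh0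
    have h2 := congrArg norm (hmul x)
    rw [norm_mul, norm_mul, ← ofReal_add, ← ofReal_sub, norm_real, norm_real, Real.norm_eq_abs,
      Real.norm_eq_abs, abs_of_pos (add_pos hx hapos)] at h2
    rw [Finset.prod_insert ha, mul_left_comm]
    have h3 : ‖f x‖ = |x - a| / (x + a) * ‖h x‖ := by
      rw [div_mul_eq_mul_div, eq_div_iff (add_pos hx hapos).ne', h2]
    rw [h3]
    gcongr

/-- Uniqueness under a Müntz condition: a function of exponential type in the right half-plane,
of polynomial growth on the imaginary axis, that vanishes on a set of positive integers with
divergent sum of reciprocals, is zero. -/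
theorem eq_zero_of_muntz_zeros {f : ℂ → ℂ} (hf : Differentiable ℂ f) {N : ℕ} {C c : ℝ}
    (hb : ∀ z : ℂ, 0 ≤ z.re → ‖f z‖ ≤ C * (1 + ‖z‖) ^ N * Real.exp (c * z.re))
    (L : Set ℕ) (hLpos : ∀ l ∈ L, 0 < l) (hL : ¬ Summable (fun l : L => 1 / ((l : ℕ) : ℝ)))
    (hz : ∀ l ∈ L, f (l : ℂ) = 0) : ∀ z, f z = 0 := by
  have hne : ∀ z : ℂ, -1 < z.re → (1 + z) ≠ 0 := fun z hz h => by
    have := congrArg Complex.re h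
    simp at this
    linarith
  have hC : 0 ≤ C := by
    have := (norm_nonneg _).trans (hb 0 (by simp))
    simpa using this
  -- The exponential and the power remove the allowed growth, so F is bounded for Re z ≥ 0; the
  -- possible pole at -1 lies outside the domain.
  set F : ℂ → ℂ := fun z => f z * exp (-c * z) / (1 + z) ^ N with hF
  have hFd : DifferentiableOn ℂ F {z | -1 < z.re} := by
    refine DifferentiableOn.div ?_ ?_ fun z hz => pow_ne_zero _ (hne z hz)
    · exact (hf.mul (by fun_prop)).differentiableOn
    · fun_prop
  have hFb : ∀ z : ℂ, 0 ≤ z.re → ‖F z‖ ≤ C * 2 ^ N := by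
    intro z hz
    have h1 : 1 + ‖z‖ ≤ 2 * ‖1 + z‖ := by
      have h2 : 1 ≤ ‖1 + z‖ := by
        refine le_trans ?_ (Complex.re_le_norm _)
        simpa using hz
      have h3 : ‖z‖ ≤ ‖1 + z‖ := by
        rw [Complex.norm_def, Complex.norm_def]
        refine Real.sqrt_le_sqrt ?_
        simp only [Complex.normSq_apply, add_re, one_re, add_im, one_im, zero_add]
        nlinarith
      linarith
    have h4 : 0 < ‖1 + z‖ := norm_pos_iff.2 (hne z (by linarith))
    rw [hF]
    simp only [norm_div, norm_mul, norm_pow, norm_exp]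
    rw [div_le_iff₀ (by positivity)]
    have h5 : (-(c : ℂ) * z).re = -(c * z.re) := by simp
    rw [h5]
    calc ‖f z‖ * Real.exp (-(c * z.re))
        ≤ (C * (1 + ‖z‖) ^ N * Real.exp (c * z.re)) * Real.exp (-(c * z.re)) := by
          gcongr; exact hb z hz
      _ = C * (1 + ‖z‖) ^ N := by
          rw [mul_assoc, ← Real.exp_add, add_neg_cancel, Real.exp_zero, mul_one]
      _ ≤ C * (2 * ‖1 + z‖) ^ N := by gcongr
      _ = _ := by rw [mul_pow, mul_assoc]
  have hF0 : ∀ l ∈ L, F (l : ℂ) = 0 := fun l hl => by simp [hF, hz l hl]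
  have key : ∀ x : ℝ, 0 < x → x ≤ 1 → F x = 0 := by
    intro x hx hx1
    by_contra hne0
    have hpos : 0 < ‖F x‖ := norm_pos_iff.2 hne0
    have hM : 0 < C * 2 ^ N := hpos.trans_le (hFb x (by simpa using hx.le))
    refine hL (summable_of_sum_le (c := Real.log (C * 2 ^ N / ‖F x‖) / x)
      (fun l => by positivity) fun u => ?_)
    set S : Finset ℕ := u.map (Function.Embedding.subtype _) with hSdef
    have hSL : ∀ l ∈ S, l ∈ L := by
      intro l hl
      rw [hSdef, Finset.mem_map] at hl
      obtain ⟨y, -, rfl⟩ := hl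
      exact y.2
    have hsum : ∑ l ∈ u, 1 / ((l : ℕ) : ℝ) = ∑ l ∈ S, 1 / (l : ℝ) := by
      rw [hSdef, Finset.sum_map]; rfl
    rw [hsum]
    have h1 := norm_le_mul_prod_blaschke hx S (fun l hl => hLpos l (hSL l hl)) F hFd hFb
      (fun l hl => hF0 l (hSL l hl))
    -- Since 0 < x ≤ 1 ≤ l, each factor is at most 1 - x/l ≤ exp(-x/l). A nonzero F(x) would
    -- therefore bound all partial sums of 1/l.
    have h2 : ∏ l ∈ S, |x - l| / (x + l) ≤ Real.exp (-(x * ∑ l ∈ S, 1 / (l : ℝ))) := by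
      rw [Finset.mul_sum, ← Finset.sum_neg_distrib, Real.exp_sum]
      refine Finset.prod_le_prod (fun l _ => by positivity) fun l hl => ?_
      have hl1 : (1 : ℝ) ≤ l := by exact_mod_cast hLpos l (hSL l hl)
      have h3 : |x - l| / (x + l) ≤ 1 - x * (1 / l) := by
        rw [abs_of_nonpos (by linarith), div_le_iff₀ (by positivity)]
        field_simp
        nlinarith
      exact h3.trans (by linarith [Real.add_one_le_exp (-(x * (1 / (l : ℝ))))])
    have h3 : ‖F x‖ ≤ C * 2 ^ N * Real.exp (-(x * ∑ l ∈ S, 1 / (l : ℝ))) :=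
      h1.trans (by gcongr)
    rw [le_div_iff₀ hx, Real.le_log_iff_exp_le (by positivity), le_div_iff₀ hpos]
    calc Real.exp ((∑ l ∈ S, 1 / (l : ℝ)) * x) * ‖F x‖
        ≤ Real.exp ((∑ l ∈ S, 1 / (l : ℝ)) * x) *
          (C * 2 ^ N * Real.exp (-(x * ∑ l ∈ S, 1 / (l : ℝ)))) := by gcongr
      _ = C * 2 ^ N * (Real.exp ((∑ l ∈ S, 1 / (l : ℝ)) * x) *
          Real.exp (-(x * ∑ l ∈ S, 1 / (l : ℝ)))) := by ring
      _ = C * 2 ^ N := by rw [← Real.exp_add, mul_comm x, add_neg_cancel, Real.exp_zero, mul_one]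
  have hf0 : ∀ x : ℝ, 0 < x → x ≤ 1 → f x = 0 := by
    intro x hx hx1
    have h1 := key x hx hx1
    rw [hF] at h1
    simp only [div_eq_zero_iff, mul_eq_zero, exp_ne_zero, or_false] at h1
    exact h1.resolve_right (pow_ne_zero _ (hne x (by simp; linarith)))
  have han : AnalyticOnNhd ℂ f univ := hf.differentiableOn.analyticOnNhd isOpen_univ
  have hfreq : ∃ᶠ z in 𝓝[≠] (0 : ℂ), f z = 0 := by
    have ht : Tendsto (fun n : ℕ => (((1 : ℝ) / ((n : ℝ) + 1) : ℝ) : ℂ)) atTop (𝓝[≠] (0 : ℂ)) := by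
      refine tendsto_nhdsWithin_iff.2 ⟨?_, Eventually.of_forall fun n => ?_⟩
      · exact (continuous_ofReal.tendsto' (0 : ℝ) 0 ofReal_zero).comp
          tendsto_one_div_add_atTop_nhds_zero_nat
      · have : (0 : ℝ) < 1 / ((n : ℝ) + 1) := by positivity
        simpa using (by exact_mod_cast this.ne' : (((1 : ℝ) / ((n : ℝ) + 1) : ℝ) : ℂ) ≠ 0)
    refine ht.frequently (Eventually.frequently (Eventually.of_forall fun n => hf0 _ ?_ ?_))
    · positivity
    · rw [div_le_one (by positivity)]; linarith [(Nat.cast_nonneg n : (0 : ℝ) ≤ n)]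
  intro z
  exact han.eqOn_zero_of_preconnected_of_frequently_eq_zero isPreconnected_univ (mem_univ 0) hfreq
    (mem_univ z)

end Muntz

/-! ### Laplace moments and their contiguity relations. -/

section FreeJost

open Complex Filter Topology Set MeasureTheory

/-- The Laplace type integral `∫₀^∞ e^{-s} s^m (r + i s / 2)^k ds`. -/
noncomputable def laplaceMoment (m k r : ℝ) : ℂ :=
  ∫ s in Ioi (0 : ℝ), ((Real.exp (-s) * s ^ m : ℝ) : ℂ) * ((r : ℂ) + (s / 2 : ℝ) * I) ^ (k : ℂ)

theorem integrableOn_exp_neg_mul_rpow_mul_add {m k : ℝ} (hm : 0 ≤ m) (hk : 0 ≤ k) (A : ℝ) :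
    IntegrableOn (fun s : ℝ => Real.exp (-s) * s ^ m * (2 ^ k * (A ^ k + s ^ k))) (Ioi 0) := by
  have h1 : IntegrableOn (fun s : ℝ => Real.exp (-s) * s ^ m) (Ioi 0) := by
    simpa using Real.GammaIntegral_convergent (s := m + 1) (by linarith)
  have h2 : IntegrableOn (fun s : ℝ => Real.exp (-s) * s ^ (m + k)) (Ioi 0) := by
    simpa using Real.GammaIntegral_convergent (s := m + k + 1) (by linarith)
  refine IntegrableOn.congr_fun (Integrable.add (h1.mul_const (2 ^ k * A ^ k))
    (h2.mul_const (2 ^ k))) (fun s hs => ?_) measurableSet_Ioi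
  simp only [Pi.add_apply]
  rw [Real.rpow_add hs]
  ring

theorem norm_ofReal_add_mul_I_le {r s : ℝ} (hr : 0 ≤ r) (hs : 0 ≤ s) :
    ‖(r : ℂ) + (s / 2 : ℝ) * I‖ ≤ r + s := by
  refine (norm_add_le _ _).trans ?_
  rw [norm_mul, norm_real, norm_real, norm_I, Real.norm_of_nonneg hr,
    Real.norm_of_nonneg (by positivity)]
  linarith

theorem add_rpow_le_two_rpow_mul {A s k : ℝ} (hA : 0 ≤ A) (hs : 0 ≤ s) (hk : 0 ≤ k) :
    (A + s) ^ k ≤ 2 ^ k * (A ^ k + s ^ k) := by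
  have h1 : A + s ≤ 2 * max A s := by
    linarith [le_max_left A s, le_max_right A s]
  calc (A + s) ^ k ≤ (2 * max A s) ^ k := Real.rpow_le_rpow (by positivity) h1 hk
    _ = 2 ^ k * (max A s) ^ k := Real.mul_rpow (by norm_num) (by positivity)
    _ ≤ _ := by
      gcongr
      rcases max_choice A s with h | h <;> rw [h]
      · linarith [Real.rpow_nonneg hs k]
      · linarith [Real.rpow_nonneg hA k]

theorem norm_laplaceMoment_integrand_le {m k r s A : ℝ} (hk : 0 ≤ k) (hr : 0 ≤ r) (hrA : r ≤ A)
    (hs : 0 ≤ s) :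
    ‖((Real.exp (-s) * s ^ m : ℝ) : ℂ) * ((r : ℂ) + (s / 2 : ℝ) * I) ^ (k : ℂ)‖ ≤
      Real.exp (-s) * s ^ m * (2 ^ k * (A ^ k + s ^ k)) := by
  rw [norm_mul, norm_real, Real.norm_of_nonneg (by positivity), norm_cpow_real]
  gcongr
  calc ‖(r : ℂ) + (s / 2 : ℝ) * I‖ ^ k ≤ (A + s) ^ k := by
        gcongr
        exact (norm_ofReal_add_mul_I_le hr hs).trans (by linarith)
    _ ≤ _ := add_rpow_le_two_rpow_mul (hr.trans hrA) hs hk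

theorem ofReal_add_mul_I_mem_slitPlane {r s : ℝ} (hr : 0 < r) :
    (r : ℂ) + (s / 2 : ℝ) * I ∈ slitPlane := by
  left; simpa using hr

theorem continuousOn_laplaceMoment_integrand {m k r : ℝ} (hr : 0 < r) :
    ContinuousOn (fun s : ℝ => ((Real.exp (-s) * s ^ m : ℝ) : ℂ) *
      ((r : ℂ) + (s / 2 : ℝ) * I) ^ (k : ℂ)) (Ioi 0) := by
  refine ContinuousOn.mul ?_ ?_
  · refine continuous_ofReal.comp_continuousOn (ContinuousOn.mul (by fun_prop) ?_)
    exact fun s hs => (Real.continuousAt_rpow_const _ _ (Or.inl (ne_of_gt hs))).continuousWithinAt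
  · intro s _
    refine ContinuousAt.continuousWithinAt ?_
    exact ContinuousAt.cpow (by fun_prop) continuousAt_const (ofReal_add_mul_I_mem_slitPlane hr)

theorem integrableOn_laplaceMoment {m k r : ℝ} (hm : 0 ≤ m) (hk : 0 ≤ k) (hr : 0 < r) :
    IntegrableOn (fun s : ℝ => ((Real.exp (-s) * s ^ m : ℝ) : ℂ) *
      ((r : ℂ) + (s / 2 : ℝ) * I) ^ (k : ℂ)) (Ioi 0) := by
  refine (integrableOn_exp_neg_mul_rpow_mul_add hm hk r).mono'
    ((continuousOn_laplaceMoment_integrand hr).aestronglyMeasurable measurableSet_Ioi) ?_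
  refine (ae_restrict_iff' measurableSet_Ioi).2 (Eventually.of_forall fun s hs => ?_)
  exact norm_laplaceMoment_integrand_le hk hr.le le_rfl (le_of_lt hs)

theorem HasDerivAt.cpow_const_of_real {f : ℝ → ℂ} {f' c : ℂ} {x : ℝ} (hf : HasDerivAt f f' x)
    (h0 : f x ∈ slitPlane) : HasDerivAt (fun x => f x ^ c) (c * f x ^ (c - 1) * f') x := by
  have := ((hasDerivAt_id (f x)).cpow_const (c := c) h0).scomp x hf
  refine this.congr_deriv ?_
  simp only [id_eq, smul_eq_mul]
  ring

/-- Differentiation under the integral over the neighbourhood (r/2, 2r); k ≥ 1 keeps the new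
exponent nonnegative, so a Gamma-type integrand dominates. -/
theorem hasDerivAt_laplaceMoment {m k r : ℝ} (hm : 0 ≤ m) (hk : 1 ≤ k) (hr : 0 < r) :
    HasDerivAt (laplaceMoment m k) (k * laplaceMoment m (k - 1) r) r := by
  have hk0 : 0 ≤ k := by linarith
  have hk1 : 0 ≤ k - 1 := by linarith
  have hmem : Ioo (r / 2) (2 * r) ∈ 𝓝 r := Ioo_mem_nhds (by linarith) (by linarith)
  have hpos : ∀ x ∈ Ioo (r / 2) (2 * r), 0 < x := fun x hx => by
    have := hx.1; linarith
  have := (hasDerivAt_integral_of_dominated_loc_of_deriv_le (μ := volume.restrict (Ioi (0 : ℝ)))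
    (F := fun (x : ℝ) (s : ℝ) => ((Real.exp (-s) * s ^ m : ℝ) : ℂ) *
      ((x : ℂ) + (s / 2 : ℝ) * I) ^ (k : ℂ))
    (F' := fun (x : ℝ) (s : ℝ) => (k : ℂ) * (((Real.exp (-s) * s ^ m : ℝ) : ℂ) *
      ((x : ℂ) + (s / 2 : ℝ) * I) ^ ((k - 1 : ℝ) : ℂ)))
    (bound := fun s => k * (Real.exp (-s) * s ^ m * (2 ^ (k - 1) * ((2 * r) ^ (k - 1) +
      s ^ (k - 1)))))
    (x₀ := r) hmem ?_ (integrableOn_laplaceMoment hm hk0 hr) ?_ ?_ ?_ ?_).2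
  · rw [integral_const_mul] at this
    exact this
  · filter_upwards [hmem] with x hx
    exact (continuousOn_laplaceMoment_integrand (hpos x hx)).aestronglyMeasurable measurableSet_Ioi
  · exact ((continuousOn_laplaceMoment_integrand hr).aestronglyMeasurable
      measurableSet_Ioi).const_mul _
  · refine (ae_restrict_iff' measurableSet_Ioi).2 (Eventually.of_forall fun s hs x hx => ?_)
    rw [norm_mul, norm_real, Real.norm_of_nonneg hk0]
    gcongr
    exact norm_laplaceMoment_integrand_le hk1 (hpos x hx).le hx.2.le (le_of_lt hs)
  · exact (integrableOn_exp_neg_mul_rpow_mul_add hm hk1 _).const_mul _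
  · refine (ae_restrict_iff' measurableSet_Ioi).2 (Eventually.of_forall fun s hs x hx => ?_)
    have h1 : HasDerivAt (fun x : ℝ => (x : ℂ) + (s / 2 : ℝ) * I) 1 x :=
      (HasDerivAt.ofReal_comp (hasDerivAt_id x)).add_const _ |>.congr_deriv (by simp)
    have h2 := ((h1.cpow_const_of_real (c := (k : ℂ)) (ofReal_add_mul_I_mem_slitPlane (hpos x hx))).const_mul
      ((Real.exp (-s) * s ^ m : ℝ) : ℂ))
    refine h2.congr_deriv ?_
    push_cast
    ring

/-- One factor r + is/2 is split off the power and distributed. -/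
theorem laplaceMoment_eq_mul_add {m k r : ℝ} (hm : 0 ≤ m) (hk : 1 ≤ k) (hr : 0 < r) :
    laplaceMoment m k r =
      r * laplaceMoment m (k - 1) r + I / 2 * laplaceMoment (m + 1) (k - 1) r := by
  unfold laplaceMoment
  rw [← integral_const_mul, ← integral_const_mul, ← integral_add]
  · refine setIntegral_congr_fun measurableSet_Ioi fun s hs => ?_
    have hq := slitPlane_ne_zero (ofReal_add_mul_I_mem_slitPlane (s := s) hr)
    have h1 : ((r : ℂ) + (s / 2 : ℝ) * I) ^ (k : ℂ) =
        ((r : ℂ) + (s / 2 : ℝ) * I) ^ ((k - 1 : ℝ) : ℂ) * ((r : ℂ) + (s / 2 : ℝ) * I) := by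
      rw [ofReal_sub, ofReal_one, cpow_sub _ _ hq, cpow_one, div_mul_cancel₀ _ hq]
    rw [h1, Real.rpow_add_one (ne_of_gt hs)]
    push_cast
    ring
  · exact (integrableOn_laplaceMoment hm (by linarith) hr).const_mul _
  · exact (integrableOn_laplaceMoment (by linarith) (by linarith) hr).const_mul _

/-- The total derivative of the integrand has integral zero: s^m kills the boundary term at 0 and
exp(-s) the one at infinity. -/
theorem laplaceMoment_eq_integration_by_parts {m k r : ℝ} (hm : 1 ≤ m) (hk : 1 ≤ k) (hr : 0 < r) :
    laplaceMoment m k r =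
      m * laplaceMoment (m - 1) k r + I * k / 2 * laplaceMoment m (k - 1) r := by
  have hm0 : 0 ≤ m := by linarith
  have hm1 : 0 ≤ m - 1 := by linarith
  have hk0 : 0 ≤ k := by linarith
  have hk1 : 0 ≤ k - 1 := by linarith
  have i1 := integrableOn_laplaceMoment hm0 hk0 hr
  have i2 := (integrableOn_laplaceMoment hm1 hk0 hr).const_mul (m : ℂ)
  have i3 := (integrableOn_laplaceMoment hm0 hk1 hr).const_mul (I * k / 2)
  have key := integral_Ioi_of_hasDerivAt_of_tendsto (a := (0 : ℝ)) (m := (0 : ℂ))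
    (f := fun s : ℝ => ((Real.exp (-s) * s ^ m : ℝ) : ℂ) *
      ((r : ℂ) + (s / 2 : ℝ) * I) ^ (k : ℂ))
    (f' := fun s : ℝ => (m : ℂ) * (((Real.exp (-s) * s ^ (m - 1) : ℝ) : ℂ) *
      ((r : ℂ) + (s / 2 : ℝ) * I) ^ (k : ℂ)) + I * k / 2 * (((Real.exp (-s) * s ^ m : ℝ) : ℂ) *
      ((r : ℂ) + (s / 2 : ℝ) * I) ^ ((k - 1 : ℝ) : ℂ)) - ((Real.exp (-s) * s ^ m : ℝ) : ℂ) *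
      ((r : ℂ) + (s / 2 : ℝ) * I) ^ (k : ℂ)) ?_ ?_ ((i2.add i3).sub i1) ?_
  · have e1 := integral_sub (i2.add i3) i1
    have e2 := integral_add i2 i3
    simp only [Pi.add_apply] at e1
    rw [e1, e2, integral_const_mul, integral_const_mul] at key
    have h0 : (0 : ℝ) ^ m = 0 := Real.zero_rpow (by linarith)
    rw [h0, mul_zero, ofReal_zero, zero_mul, sub_zero] at key
    exact (sub_eq_zero.1 key).symm
  · refine ContinuousAt.continuousWithinAt (ContinuousAt.mul ?_ ?_)
    · refine continuous_ofReal.continuousAt.comp (ContinuousAt.mul (by fun_prop) ?_)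
      exact Real.continuousAt_rpow_const _ _ (Or.inr (by linarith))
    · exact ContinuousAt.cpow (by fun_prop) continuousAt_const (ofReal_add_mul_I_mem_slitPlane hr)
  · intro s hs
    have h1 : HasDerivAt (fun s : ℝ => Real.exp (-s) * s ^ m)
        (-(Real.exp (-s)) * s ^ m + Real.exp (-s) * (m * s ^ (m - 1))) s := by
      refine HasDerivAt.mul ?_ (Real.hasDerivAt_rpow_const (Or.inl (ne_of_gt hs)))
      simpa using (hasDerivAt_neg s).exp
    have h2 : HasDerivAt (fun s : ℝ => (r : ℂ) + (s / 2 : ℝ) * I) (I / 2) s := by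
      have := (((hasDerivAt_id s).div_const 2).ofReal_comp.mul_const I).const_add (r : ℂ)
      refine this.congr_deriv ?_
      push_cast
      ring
    have h3 := h1.ofReal_comp.mul
      (h2.cpow_const_of_real (c := (k : ℂ)) (ofReal_add_mul_I_mem_slitPlane hr))
    refine h3.congr_deriv ?_
    push_cast
    ring
  · have hlim : Tendsto (fun s : ℝ => Real.exp (-s) * s ^ m * (2 ^ k * (r ^ k + s ^ k))) atTop
        (𝓝 0) := by
      have t1 := tendsto_rpow_mul_exp_neg_mul_atTop_nhds_zero m 1 one_pos
      have t2 := tendsto_rpow_mul_exp_neg_mul_atTop_nhds_zero (m + k) 1 one_pos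
      have t3 := (t1.const_mul (2 ^ k * r ^ k)).add (t2.const_mul (2 ^ k))
      rw [mul_zero, mul_zero, add_zero] at t3
      refine t3.congr' ?_
      filter_upwards [eventually_gt_atTop 0] with s hs
      rw [Real.rpow_add hs, neg_one_mul]
      ring
    refine squeeze_zero_norm' ?_ hlim
    filter_upwards [eventually_ge_atTop 0] with s hs
    exact norm_laplaceMoment_integrand_le hk0 hr.le le_rfl hs

end FreeJost

/-! ### The free Jost solution: ladder relations and behaviour at infinity. -/

section FreeJost

open Complex Filter Topology Set MeasureTheory

/-- The outgoing free Jost solution of `-u'' + (m (m + 1) / r²) u = u`. -/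
noncomputable def freeJost (m r : ℝ) : ℂ :=
  exp (I * r) * ((r ^ (-m) / Real.Gamma (m + 1) : ℝ) : ℂ) * laplaceMoment m m r

theorem rpow_neg_sub_one_div_Gamma {m r : ℝ} (hm : 0 < m) (hr : 0 < r) :
    r ^ (-(m - 1)) / Real.Gamma (m - 1 + 1) = r ^ (-m) / Real.Gamma (m + 1) * (m * r) := by
  have h2 : r ^ (-(m - 1)) = r ^ (-m) * r := by
    rw [← Real.rpow_add_one hr.ne']; congr 1; ring
  have h3 : Real.Gamma m ≠ 0 := (Real.Gamma_pos_of_pos hm).ne'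
  rw [Real.Gamma_add_one hm.ne', sub_add_cancel, h2]
  field_simp

theorem freeJost_sub_one {m r : ℝ} (hm : 0 < m) (hr : 0 < r) :
    freeJost (m - 1) r = exp (I * r) * ((r ^ (-m) / Real.Gamma (m + 1) : ℝ) : ℂ) *
      (m * r * laplaceMoment (m - 1) (m - 1) r) := by
  rw [freeJost, rpow_neg_sub_one_div_Gamma hm hr]
  push_cast
  ring

theorem ofReal_mul_cpow {r : ℝ} (hr : 0 < r) {x : ℂ} (hx : x ≠ 0) (c : ℂ) :
    ((r : ℂ) * x) ^ c = (r : ℂ) ^ c * x ^ c := by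
  have hr' : (r : ℂ) ≠ 0 := by exact_mod_cast hr.ne'
  rw [cpow_def_of_ne_zero (mul_ne_zero hr' hx), cpow_def_of_ne_zero hr', cpow_def_of_ne_zero hx,
    log_ofReal_mul hr hx, ← exp_add, add_mul, ofReal_log hr.le]

theorem hasDerivAt_exp_mul_rpow (m : ℝ) {r : ℝ} (hr : 0 < r) :
    HasDerivAt (fun r : ℝ => exp (I * r) * ((r ^ (-m) / Real.Gamma (m + 1) : ℝ) : ℂ))
      ((I - m / r) * (exp (I * r) * ((r ^ (-m) / Real.Gamma (m + 1) : ℝ) : ℂ))) r := by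
  have h1 : HasDerivAt (fun r : ℝ => exp (I * r)) (exp (I * r) * I) r := by
    have : HasDerivAt (fun r : ℝ => I * (r : ℂ)) (I * 1) r :=
      (HasDerivAt.ofReal_comp (hasDerivAt_id r)).const_mul I |>.congr_deriv (by simp)
    simpa using this.cexp
  have h2 : HasDerivAt (fun r : ℝ => r ^ (-m) / Real.Gamma (m + 1))
      (-m * r ^ (-m - 1) / Real.Gamma (m + 1)) r :=
    (Real.hasDerivAt_rpow_const (Or.inl hr.ne')).div_const _
  refine (h1.mul h2.ofReal_comp).congr_deriv ?_
  have hr' : (r : ℂ) ≠ 0 := by exact_mod_cast hr.ne'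
  rw [Real.rpow_sub_one hr.ne']
  push_cast
  field_simp
  ring

/-- The two contiguity relations collapse all moments produced by the derivative into the single one
defining order m - 1. Together with the companion raising relation, this makes (`freeJost m`, i
`freeJost (m - 1)`) a solution of the free first-order system. -/
theorem hasDerivAt_freeJost {m r : ℝ} (hm : 1 ≤ m) (hr : 0 < r) :
    HasDerivAt (freeJost m) (-(m / r) * freeJost m r + I * freeJost (m - 1) r) r := by
  have hm0 : 0 ≤ m := by linarith
  have hm1 : 0 ≤ m - 1 := by linarith
  refine ((hasDerivAt_exp_mul_rpow m hr).mul (hasDerivAt_laplaceMoment hm0 hm hr)).congr_deriv ?_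
  rw [freeJost_sub_one (by linarith) hr, freeJost]
  have e1 := laplaceMoment_eq_integration_by_parts hm hm hr
  have e2 := laplaceMoment_eq_mul_add hm1 hm hr
  rw [sub_add_cancel] at e2
  have hr' : (r : ℂ) ≠ 0 := by exact_mod_cast hr.ne'
  have e3 : m * laplaceMoment m (m - 1) r + I * laplaceMoment m m r =
      I * (m * r * laplaceMoment (m - 1) (m - 1) r) := by
    rw [e1, e2]
    linear_combination (m * laplaceMoment m (m - 1) r) * I_mul_I
  linear_combination (exp (I * r) * ((r ^ (-m) / Real.Gamma (m + 1) : ℝ) : ℂ)) * e3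

theorem hasDerivAt_freeJost_sub_one {m r : ℝ} (hm : 2 ≤ m) (hr : 0 < r) :
    HasDerivAt (freeJost (m - 1)) (m / r * freeJost (m - 1) r + I * freeJost m r) r := by
  have hm1 : 1 ≤ m - 1 := by linarith
  refine (((hasDerivAt_exp_mul_rpow (m - 1) hr).mul
    (hasDerivAt_laplaceMoment (by linarith) hm1 hr))).congr_deriv ?_
  have hf : freeJost (m - 1) r = exp (I * r) *
    ((r ^ (-(m - 1)) / Real.Gamma (m - 1 + 1) : ℝ) : ℂ) * laplaceMoment (m - 1) (m - 1) r := rfl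
  have e1 := laplaceMoment_eq_integration_by_parts (m := m) (k := m) (by linarith)
    (by linarith) hr
  have e2 := laplaceMoment_eq_mul_add (m := m - 1) (k := m) (by linarith) (by linarith) hr
  have e3 := laplaceMoment_eq_integration_by_parts (m := m) (k := m - 1) (by linarith) hm1 hr
  have e4 := laplaceMoment_eq_mul_add (m := m - 1) (k := m - 1) (by linarith) hm1 hr
  rw [sub_add_cancel] at e2 e4
  have hr' : (r : ℂ) ≠ 0 := by exact_mod_cast hr.ne'
  have hmc : (m : ℂ) ≠ 0 := by
    have : m ≠ 0 := by linarith
    exact_mod_cast this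
  set E := exp (I * r) * ((r ^ (-m) / Real.Gamma (m + 1) : ℝ) : ℂ) with hE
  have h0 : exp (I * r) * ((r ^ (-(m - 1)) / Real.Gamma (m - 1 + 1) : ℝ) : ℂ) = E * (m * r) := by
    rw [rpow_neg_sub_one_div_Gamma (by linarith) hr, hE]
    push_cast
    ring
  have hfm : freeJost m r = E * laplaceMoment m m r := rfl
  rw [hf, hfm, h0]
  have e5 : m * r * ((I - (m - 1) / r) * laplaceMoment (m - 1) (m - 1) r +
      (m - 1) * laplaceMoment (m - 1) (m - 1 - 1) r) =
      m / r * (m * r * laplaceMoment (m - 1) (m - 1) r) + I * laplaceMoment m m r := by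
    rw [e1, e2]
    push_cast at e3
    have hr1 : (r : ℂ) * (r : ℂ)⁻¹ = 1 := mul_inv_cancel₀ hr'
    simp only [div_eq_mul_inv] at *
    linear_combination (m * (m - 1)) * (-e4) + m * e3 - m * laplaceMoment m (m - 1) r * I_mul_I -
      (m * (m - 1) + m ^ 2) * laplaceMoment (m - 1) (m - 1) r * hr1
  push_cast
  linear_combination E * e5

/-- After scaling, r^(-m) (r + is/2)^m = (1 + is/(2r))^m tends to 1, dominated for r ≥ 1; the
limiting integral is Γ(m + 1), which the normalization cancels. -/
theorem tendsto_freeJost {m : ℝ} (hm : 0 ≤ m) :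
    Tendsto (fun r : ℝ => freeJost m r - exp (I * r)) atTop (𝓝 0) := by
  have hG : 0 < Real.Gamma (m + 1) := Real.Gamma_pos_of_pos (by linarith)
  have hlim : Tendsto (fun r : ℝ => ((r ^ (-m) : ℝ) : ℂ) * laplaceMoment m m r) atTop
      (𝓝 (∫ s in Ioi (0 : ℝ), ((Real.exp (-s) * s ^ m : ℝ) : ℂ))) := by
    have hdct : Tendsto (fun r : ℝ => ∫ s in Ioi (0 : ℝ), ((Real.exp (-s) * s ^ m : ℝ) : ℂ) *
        (((1 : ℝ) : ℂ) + ((s / r) / 2 : ℝ) * I) ^ (m : ℂ)) atTop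
        (𝓝 (∫ s in Ioi (0 : ℝ), ((Real.exp (-s) * s ^ m : ℝ) : ℂ))) := by
      refine tendsto_integral_filter_of_dominated_convergence
        (fun s => Real.exp (-s) * s ^ m * (2 ^ m * (1 ^ m + s ^ m))) ?_ ?_
        (integrableOn_exp_neg_mul_rpow_mul_add hm hm 1) ?_
      · refine Eventually.of_forall fun r => ContinuousOn.aestronglyMeasurable ?_ measurableSet_Ioi
        refine ContinuousOn.mul ?_ ?_
        · refine continuous_ofReal.comp_continuousOn (ContinuousOn.mul (by fun_prop) ?_)
          exact fun s hs =>
            (Real.continuousAt_rpow_const _ _ (Or.inl (ne_of_gt hs))).continuousWithinAt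
        · intro s _
          have hc : ContinuousAt (fun s : ℝ => ((1 : ℝ) : ℂ) + ((s / r) / 2 : ℝ) * I) s := by
            fun_prop
          exact (hc.cpow continuousAt_const
            (ofReal_add_mul_I_mem_slitPlane one_pos)).continuousWithinAt
      · filter_upwards [eventually_ge_atTop 1] with r hr
        refine (ae_restrict_iff' measurableSet_Ioi).2 (Eventually.of_forall fun s hs => ?_)
        have hs0 : (0 : ℝ) < s := hs
        have hle : s / r ≤ s := div_le_self hs0.le hr
        rw [norm_mul, norm_real, Real.norm_of_nonneg (by positivity), norm_cpow_real]
        gcongr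
        calc ‖((1 : ℝ) : ℂ) + ((s / r) / 2 : ℝ) * I‖ ^ m ≤ (1 + s) ^ m := by
              gcongr
              exact (norm_ofReal_add_mul_I_le zero_le_one (by positivity)).trans (by linarith)
          _ ≤ _ := add_rpow_le_two_rpow_mul zero_le_one hs0.le hm
      · refine (ae_restrict_iff' measurableSet_Ioi).2 (Eventually.of_forall fun s hs => ?_)
        have h1 : Tendsto (fun r : ℝ => ((1 : ℝ) : ℂ) + ((s / r) / 2 : ℝ) * I) atTop (𝓝 1) := by
          have h2 : Tendsto (fun r : ℝ => s / r / 2) atTop (𝓝 0) := by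
            simpa using (tendsto_const_nhds (x := s)).div_atTop tendsto_id |>.div_const 2
          have h3 := ((continuous_ofReal.tendsto' (0 : ℝ) 0 ofReal_zero).comp h2).mul_const I
          simpa using h3.const_add 1
        have h4 := (continuousAt_cpow_const (b := (m : ℂ)) (by simp : (1 : ℂ) ∈ slitPlane)).tendsto.comp h1
        have h5 := h4.const_mul ((Real.exp (-s) * s ^ m : ℝ) : ℂ)
        simpa [Function.comp_def] using h5
    refine hdct.congr' ?_
    filter_upwards [eventually_gt_atTop 0] with r hr
    rw [laplaceMoment, ← integral_const_mul]
    refine setIntegral_congr_fun measurableSet_Ioi fun s hs => ?_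
    have hs0 : (0 : ℝ) < s := hs
    have hq : (r : ℂ) + (s / 2 : ℝ) * I = (r : ℂ) * (((1 : ℝ) : ℂ) + ((s / r) / 2 : ℝ) * I) := by
      have hr' : (r : ℂ) ≠ 0 := by exact_mod_cast hr.ne'
      push_cast
      field_simp
    have hne := slitPlane_ne_zero (ofReal_add_mul_I_mem_slitPlane (s := s / r) one_pos)
    rw [hq, ofReal_mul_cpow hr hne, mul_left_comm, ← mul_assoc ((r ^ (-m) : ℝ) : ℂ),
      ← ofReal_cpow hr.le, ← ofReal_mul, ← Real.rpow_add hr, neg_add_cancel, Real.rpow_zero,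
      ofReal_one, one_mul]
  have h1 : (∫ s in Ioi (0 : ℝ), ((Real.exp (-s) * s ^ m : ℝ) : ℂ)) = Real.Gamma (m + 1) := by
    rw [Real.Gamma_eq_integral (by linarith), add_sub_cancel_right]
    exact integral_ofReal
  rw [h1] at hlim
  have h2 : Tendsto (fun r : ℝ => ((r ^ (-m) : ℝ) : ℂ) * laplaceMoment m m r /
      Real.Gamma (m + 1) - 1) atTop (𝓝 0) := by
    have := (hlim.div_const (Real.Gamma (m + 1) : ℂ)).sub_const 1
    rwa [div_self (by exact_mod_cast hG.ne'), sub_self] at this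
  refine squeeze_zero_norm (fun r => ?_) (tendsto_norm_zero.comp h2)
  have h3 : freeJost m r - exp (I * r) = exp (I * r) * (((r ^ (-m) : ℝ) : ℂ) *
      laplaceMoment m m r / Real.Gamma (m + 1) - 1) := by
    rw [freeJost]; push_cast; ring
  rw [h3, norm_mul, norm_exp]
  simp

end FreeJost

/-! ### Phase of the free Jost solution for large order, by a contour shift. -/

section FreeJostPhase

open Complex Filter Topology Set MeasureTheory

/-- The integrand `e^{-z} (z² + R²)^m` of the Poisson type representation. -/
noncomputable def poissonIntegrand (m R : ℝ) (z : ℂ) : ℂ :=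
  exp (-z) * (z ^ 2 + (R : ℂ) ^ 2) ^ (m : ℂ)

/-- The dominant part `∫₀^∞ e^{-x} (x² + R²)^m dx` of the free Jost solution. -/
noncomputable def poissonMoment (m R : ℝ) : ℝ :=
  ∫ x in Ioi (0 : ℝ), Real.exp (-x) * (x ^ 2 + R ^ 2) ^ m

theorem re_sq_add_sq (R : ℝ) (z : ℂ) :
    (z ^ 2 + (R : ℂ) ^ 2).re = z.re ^ 2 - z.im ^ 2 + R ^ 2 ∧
      (z ^ 2 + (R : ℂ) ^ 2).im = 2 * z.re * z.im := by
  constructor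
  · simp [pow_two]
  · simp [pow_two]
    ring

theorem norm_sq_add_sq_le {R : ℝ} {z : ℂ} (hR : 0 ≤ R) (h0 : 0 ≤ z.re) (h1 : -R ≤ z.im)
    (h2 : z.im ≤ 0) : ‖z ^ 2 + (R : ℂ) ^ 2‖ ≤ 4 * (R + z.re) ^ 2 := by
  have h3 : ‖z‖ ≤ z.re + R := by
    refine (Complex.norm_le_abs_re_add_abs_im z).trans ?_
    rw [abs_of_nonneg h0, abs_of_nonpos h2]
    linarith
  calc ‖z ^ 2 + (R : ℂ) ^ 2‖ ≤ ‖z‖ ^ 2 + R ^ 2 := by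
        refine (norm_add_le _ _).trans ?_
        rw [norm_pow, norm_pow, norm_real, Real.norm_of_nonneg hR]
    _ ≤ (z.re + R) ^ 2 + R ^ 2 := by gcongr
    _ ≤ _ := by nlinarith

theorem norm_poissonIntegrand_le {m R : ℝ} {z : ℂ} (hm : 0 ≤ m) (hR : 0 ≤ R) (h0 : 0 ≤ z.re)
    (h1 : -R ≤ z.im) (h2 : z.im ≤ 0) :
    ‖poissonIntegrand m R z‖ ≤
      4 ^ m * (Real.exp (-z.re) * z.re ^ (0 : ℝ) *
        (2 ^ (2 * m) * (R ^ (2 * m) + z.re ^ (2 * m)))) := by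
  rw [poissonIntegrand, norm_mul, norm_exp, norm_cpow_real, neg_re, Real.rpow_zero, mul_one]
  calc Real.exp (-z.re) * ‖z ^ 2 + (R : ℂ) ^ 2‖ ^ m
      ≤ Real.exp (-z.re) * (4 * (R + z.re) ^ 2) ^ m := by
        gcongr; exact norm_sq_add_sq_le hR h0 h1 h2
    _ = 4 ^ m * (Real.exp (-z.re) * (R + z.re) ^ (2 * m)) := by
        rw [Real.mul_rpow (by norm_num) (by positivity), ← Real.rpow_natCast,
          ← Real.rpow_mul (by positivity)]
        push_cast
        ring
    _ ≤ _ := by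
        gcongr
        exact add_rpow_le_two_rpow_mul hR h0 (by linarith)

/-- In this half-strip Re(z² + R²) = x² - y² + R² ≥ 0, so the branch cut is not crossed; at the
corner -iR, where the base vanishes, m > 0 gives continuity. -/
theorem continuousOn_poissonIntegrand {m R : ℝ} (hm : 0 < m) (hR : 0 ≤ R) :
    ContinuousOn (poissonIntegrand m R) {z | 0 ≤ z.re ∧ -R ≤ z.im ∧ z.im ≤ 0} := by
  rintro z ⟨h0, h1, h2⟩
  refine ContinuousAt.continuousWithinAt ?_
  refine ContinuousAt.mul (by fun_prop) ?_
  have h3 := continuousAt_cpow_const_of_re_pos (z := z ^ 2 + (R : ℂ) ^ 2) (w := (m : ℂ))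
    (Or.inl (by rw [(re_sq_add_sq R z).1]; nlinarith)) (by simpa using hm)
  exact ContinuousAt.comp (f := fun z : ℂ => z ^ 2 + (R : ℂ) ^ 2) h3 (by fun_prop)

theorem integrableOn_poissonIntegrand {m R y : ℝ} (hm : 0 < m) (hR : 0 ≤ R) (h1 : -R ≤ y)
    (h2 : y ≤ 0) : IntegrableOn (fun x : ℝ => poissonIntegrand m R (x + y * I)) (Ioi 0) := by
  have hI := (integrableOn_exp_neg_mul_rpow_mul_add le_rfl
    (by positivity : 0 ≤ 2 * m) R).const_mul (4 ^ m)
  refine hI.mono' (ContinuousOn.aestronglyMeasurable ?_ measurableSet_Ioi) ?_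
  · refine (continuousOn_poissonIntegrand hm hR).comp (by fun_prop) fun x hx => ?_
    have hx0 : (0 : ℝ) < x := hx
    simp [hx0.le, h1, h2]
  · refine (ae_restrict_iff' measurableSet_Ioi).2 (Eventually.of_forall fun x hx => ?_)
    have hx0 : (0 : ℝ) < x := hx
    have := norm_poissonIntegrand_le (z := x + y * I) hm.le hR (by simpa using hx0.le)
      (by simpa using h1) (by simpa using h2)
    simpa using this

/-- Cauchy's theorem on [0, T] × [-R, 0]: the right edge decays as T grows, and the left edge
survives as the correction. -/
theorem integral_poissonIntegrand_shift {m R : ℝ} (hm : 0 < m) (hR : 0 < R) :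
    ∫ x in Ioi (0 : ℝ), poissonIntegrand m R (x + (-R : ℝ) * I) =
      (∫ x in Ioi (0 : ℝ), poissonIntegrand m R (x + (0 : ℝ) * I)) +
        I * ∫ y in (-R)..0, poissonIntegrand m R ((0 : ℝ) + y * I) := by
  have i1 := integrableOn_poissonIntegrand (y := -R) hm hR.le le_rfl (by linarith)
  have i2 := integrableOn_poissonIntegrand (y := 0) hm hR.le (by linarith) le_rfl
  have t1 := intervalIntegral_tendsto_integral_Ioi 0 i1 tendsto_id
  have t2 := intervalIntegral_tendsto_integral_Ioi 0 i2 tendsto_id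
  have t3 : Tendsto (fun T : ℝ => ∫ y in (-R)..0, poissonIntegrand m R ((T : ℝ) + y * I)) atTop
      (𝓝 0) := by
    have hlim : Tendsto (fun T : ℝ => 4 ^ m * (Real.exp (-T) * T ^ (0 : ℝ) *
        (2 ^ (2 * m) * (R ^ (2 * m) + T ^ (2 * m)))) * |0 - (-R)|) atTop (𝓝 0) := by
      have t1 := tendsto_rpow_mul_exp_neg_mul_atTop_nhds_zero 0 1 one_pos
      have t2 := tendsto_rpow_mul_exp_neg_mul_atTop_nhds_zero (2 * m) 1 one_pos
      have t3 := ((t1.const_mul (4 ^ m * (2 ^ (2 * m) * R ^ (2 * m)))).add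
        (t2.const_mul (4 ^ m * 2 ^ (2 * m)))).mul_const |0 - (-R)|
      rw [mul_zero, mul_zero, add_zero, zero_mul] at t3
      refine t3.congr fun T => ?_
      rw [Real.rpow_zero, neg_one_mul]
      ring
    refine squeeze_zero_norm' ?_ hlim
    filter_upwards [eventually_ge_atTop 0] with T hT
    refine intervalIntegral.norm_integral_le_of_norm_le_const fun y hy => ?_
    rw [uIoc_of_le (by linarith)] at hy
    have := norm_poissonIntegrand_le (z := T + y * I) hm.le hR.le (by simpa using hT)
      (by simpa using hy.1.le) (by simpa using hy.2)
    simpa using this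
  have hrect : ∀ T : ℝ, 0 ≤ T →
      (∫ x in (0 : ℝ)..T, poissonIntegrand m R (x + (-R : ℝ) * I)) =
        (∫ x in (0 : ℝ)..T, poissonIntegrand m R (x + (0 : ℝ) * I)) -
        I * (∫ y in (-R)..0, poissonIntegrand m R ((T : ℝ) + y * I)) +
        I * ∫ y in (-R)..0, poissonIntegrand m R ((0 : ℝ) + y * I) := by
    intro T hT
    have := integral_boundary_rect_eq_zero_of_continuousOn_of_differentiableOn
      (poissonIntegrand m R) (⟨0, -R⟩ : ℂ) (⟨T, 0⟩ : ℂ) ?_ ?_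
    · simp only [smul_eq_mul] at this
      linear_combination this
    · refine (continuousOn_poissonIntegrand hm hR.le).mono ?_
      rintro z ⟨hz1, hz2⟩
      simp only [mem_preimage, uIcc_of_le hT, uIcc_of_le (by linarith : -R ≤ 0)] at hz1 hz2
      exact ⟨hz1.1, hz2.1, hz2.2⟩
    · rintro z ⟨hz1, hz2⟩
      simp only [mem_preimage, min_eq_left hT, max_eq_right hT,
        min_eq_left (by linarith : -R ≤ 0), max_eq_right (by linarith : -R ≤ 0)] at hz1 hz2
      refine DifferentiableAt.differentiableWithinAt ?_
      refine DifferentiableAt.mul (by fun_prop) ?_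
      refine DifferentiableAt.cpow (by fun_prop) (by fun_prop) (Or.inl ?_)
      rw [(re_sq_add_sq R z).1]
      nlinarith [hz1.1, hz1.2, hz2.1, hz2.2, sq_nonneg z.re]
  have t4 := (t2.sub (t3.const_mul I)).add_const
    (I * ∫ y in (-R)..0, poissonIntegrand m R ((0 : ℝ) + y * I))
  have t5 := tendsto_nhds_unique (t1.congr' ?_) t4
  · rw [t5]; ring
  · filter_upwards [eventually_ge_atTop 0] with T hT using hrect T hT

/-- At z = s - iR one has z² + R² = s · (-2i) · (R + is/2). The arguments -π/2 and one in (-π/2,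
π/2) add up inside (-π, π], so the powers multiply with no branch correction. -/
theorem poissonIntegrand_sub_mul_I {m R s : ℝ} (hR : 0 < R) (hs : 0 < s) :
    poissonIntegrand m R (s + (-R : ℝ) * I) = exp (I * R) * (-2 * I) ^ (m : ℂ) *
      (((Real.exp (-s) * s ^ m : ℝ) : ℂ) * ((R : ℂ) + (s / 2 : ℝ) * I) ^ (m : ℂ)) := by
  have hq := slitPlane_ne_zero (ofReal_add_mul_I_mem_slitPlane (s := s) hR)
  have h1 : ((s : ℂ) + (-R : ℝ) * I) ^ 2 + (R : ℂ) ^ 2 =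
      (s : ℂ) * ((-2 * I) * ((R : ℂ) + (s / 2 : ℝ) * I)) := by
    push_cast
    linear_combination ((R : ℂ) ^ 2 + (s : ℂ) ^ 2) * I_sq
  have h2I : (-2 * I : ℂ) ≠ 0 := by simp
  have harg : arg (-2 * I) = -(Real.pi / 2) := by
    have := arg_real_mul (-I) (r := 2) (by norm_num)
    rw [arg_neg_I] at this
    rw [← this]
    congr 1
    push_cast
    ring
  have hargq : |arg ((R : ℂ) + (s / 2 : ℝ) * I)| < Real.pi / 2 := by
    rw [abs_arg_lt_pi_div_two_iff]
    left; simpa using hR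
  have hlog : log ((-2 * I) * ((R : ℂ) + (s / 2 : ℝ) * I)) =
      log (-2 * I) + log ((R : ℂ) + (s / 2 : ℝ) * I) := by
    refine log_mul_eq_add_log_iff h2I hq |>.2 ?_
    rw [harg]
    rw [abs_lt] at hargq
    constructor <;> linarith [Real.pi_pos]
  have h3 : ((-2 * I) * ((R : ℂ) + (s / 2 : ℝ) * I)) ^ (m : ℂ) =
      (-2 * I) ^ (m : ℂ) * ((R : ℂ) + (s / 2 : ℝ) * I) ^ (m : ℂ) := by
    rw [cpow_def_of_ne_zero (mul_ne_zero h2I hq), cpow_def_of_ne_zero h2I,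
      cpow_def_of_ne_zero hq, hlog, ← exp_add, add_mul]
  have h4 : exp (-((s : ℂ) + (-R : ℝ) * I)) = exp (I * R) * ((Real.exp (-s) : ℝ) : ℂ) := by
    rw [ofReal_exp, ← exp_add]
    congr 1
    push_cast
    ring
  rw [poissonIntegrand, h1, ofReal_mul_cpow hs (mul_ne_zero h2I hq), h3, h4, ofReal_mul,
    ofReal_cpow hs.le]
  ring

theorem integrableOn_poissonMoment {m R : ℝ} (hm : 0 ≤ m) (hR : 0 < R) :
    IntegrableOn (fun x : ℝ => Real.exp (-x) * (x ^ 2 + R ^ 2) ^ m) (Ioi 0) := by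
  have hI := (integrableOn_exp_neg_mul_rpow_mul_add le_rfl
    (by positivity : 0 ≤ 2 * m) R)
  have hc : Continuous fun x : ℝ => Real.exp (-x) * (x ^ 2 + R ^ 2) ^ m := by
    refine Continuous.mul (by fun_prop) (Continuous.rpow_const (by fun_prop) fun x => Or.inl ?_)
    positivity
  refine hI.mono' hc.aestronglyMeasurable ?_
  refine (ae_restrict_iff' measurableSet_Ioi).2 (Eventually.of_forall fun x hx => ?_)
  have hx0 : (0 : ℝ) < x := hx
  rw [Real.norm_of_nonneg (by positivity), Real.rpow_zero, mul_one]
  gcongr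
  calc (x ^ 2 + R ^ 2) ^ m ≤ ((R + x) ^ 2) ^ m := by gcongr; nlinarith
    _ = (R + x) ^ (2 * m) := by
      rw [← Real.rpow_natCast, ← Real.rpow_mul (by positivity)]; norm_num
    _ ≤ _ := add_rpow_le_two_rpow_mul hR.le hx0.le (by linarith)

/-- The free Jost solution at `R` is, up to an explicit factor, a positive quantity plus a small
error. -/
theorem exists_laplaceMoment_eq {m R : ℝ} (hm : 0 < m) (hR : 0 < R) :
    ∃ E : ℂ, ‖E‖ ≤ (R ^ 2) ^ m * R ∧
      exp (I * R) * (-2 * I) ^ (m : ℂ) * laplaceMoment m m R = poissonMoment m R + E := by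
  refine ⟨I * ∫ y in (-R)..0, poissonIntegrand m R ((0 : ℝ) + y * I), ?_, ?_⟩
  · rw [norm_mul, norm_I, one_mul]
    have : ‖∫ y in (-R)..0, poissonIntegrand m R ((0 : ℝ) + y * I)‖ ≤ (R ^ 2) ^ m * |0 - (-R)| := by
      refine intervalIntegral.norm_integral_le_of_norm_le_const fun y hy => ?_
      rw [uIoc_of_le (by linarith)] at hy
      have h1 : (((0 : ℝ) : ℂ) + y * I) ^ 2 + (R : ℂ) ^ 2 = ((R ^ 2 - y ^ 2 : ℝ) : ℂ) := by
        push_cast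
        linear_combination (y : ℂ) ^ 2 * I_sq
      have h2 : 0 ≤ R ^ 2 - y ^ 2 := by nlinarith [hy.1, hy.2]
      rw [poissonIntegrand, h1, norm_mul, norm_exp, norm_cpow_real, norm_real,
        Real.norm_of_nonneg h2]
      have h3 : (-(((0 : ℝ) : ℂ) + y * I)).re = 0 := by simp
      rw [h3, Real.exp_zero, one_mul]
      gcongr
      nlinarith
    simpa [abs_of_pos hR] using this
  · have h1 := integral_poissonIntegrand_shift hm hR
    have h2 : ∫ x in Ioi (0 : ℝ), poissonIntegrand m R (x + (-R : ℝ) * I) =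
        exp (I * R) * (-2 * I) ^ (m : ℂ) * laplaceMoment m m R := by
      rw [laplaceMoment, ← integral_const_mul]
      exact setIntegral_congr_fun measurableSet_Ioi fun s hs => poissonIntegrand_sub_mul_I hR hs
    have h3 : ∫ x in Ioi (0 : ℝ), poissonIntegrand m R (x + (0 : ℝ) * I) = poissonMoment m R := by
      rw [poissonMoment, ← integral_complex_ofReal]
      refine setIntegral_congr_fun measurableSet_Ioi fun x hx => ?_
      have h4 : ((x : ℂ) + (0 : ℝ) * I) ^ 2 + (R : ℂ) ^ 2 = ((x ^ 2 + R ^ 2 : ℝ) : ℂ) := by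
        push_cast; ring
      change poissonIntegrand m R (x + (0 : ℝ) * I) = _
      rw [poissonIntegrand, h4, ← ofReal_cpow (by positivity)]
      push_cast
      simp
    rw [← h2, h1, h3]

/-- On [R, R + 1] the base is at least 2R². The resulting factor 2^m is what makes the contour
error, at most (R²)^m R, relatively negligible. -/
theorem le_poissonMoment {m R : ℝ} (hm : 0 ≤ m) (hR : 0 < R) :
    Real.exp (-(R + 1)) * (2 * R ^ 2) ^ m ≤ poissonMoment m R := by
  have h1 : ∫ x in Ioc R (R + 1), Real.exp (-(R + 1)) * (2 * R ^ 2) ^ m ≤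
      ∫ x in Ioc R (R + 1), Real.exp (-x) * (x ^ 2 + R ^ 2) ^ m := by
    refine setIntegral_mono_on (integrableOn_const (by simp)) ((integrableOn_poissonMoment hm hR).mono_set ?_)
      measurableSet_Ioc fun x hx => ?_
    · exact fun x hx => hR.trans hx.1
    · gcongr
      · linarith [hx.2]
      · nlinarith [hx.1]
  have h2 : ∫ x in Ioc R (R + 1), Real.exp (-x) * (x ^ 2 + R ^ 2) ^ m ≤ poissonMoment m R := by
    refine setIntegral_mono_set (integrableOn_poissonMoment hm hR) ?_ ?_
    · exact Eventually.of_forall fun x => by positivity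
    · exact Eventually.of_forall fun x hx => hR.trans hx.1
  simpa using h1.trans h2

/-- Writing P_k for the moments, two integrations by parts give P_m = (R²)^m + 2m P_{m-1} +
4m(m-1)(P_{m-1} - R² P_{m-2}), and every term is nonnegative. They are done at once through the
primitive exp(-x) [(x² + R²)^m + 2m x (x² + R²)^(m-1)]. -/
theorem mul_poissonMoment_sub_one_le {m R : ℝ} (hm : 2 ≤ m) (hR : 0 < R) :
    2 * m * poissonMoment (m - 1) R ≤ poissonMoment m R := by
  have i0 := integrableOn_poissonMoment (m := m) (by linarith) hR
  have i1 := integrableOn_poissonMoment (m := m - 1) (by linarith) hR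
  have i2 := integrableOn_poissonMoment (m := m - 2) (by linarith) hR
  have hpos : ∀ x : ℝ, 0 < x ^ 2 + R ^ 2 := fun x => by positivity
  have hd : ∀ (k x : ℝ), HasDerivAt (fun x : ℝ => (x ^ 2 + R ^ 2) ^ k)
      (2 * x * k * (x ^ 2 + R ^ 2) ^ (k - 1)) x := by
    intro k x
    have h1 : HasDerivAt (fun x : ℝ => x ^ 2 + R ^ 2) (2 * x) x := by
      simpa using (hasDerivAt_pow 2 x).add_const (R ^ 2)
    exact h1.rpow_const (Or.inl (hpos x).ne')
  have i3 := Integrable.sub (i1.const_mul (2 * m + 4 * m * (m - 1)))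
    (i2.const_mul (4 * m * (m - 1) * R ^ 2))
  have key := integral_Ioi_of_hasDerivAt_of_tendsto' (a := (0 : ℝ)) (m := (0 : ℝ))
    (f := fun x : ℝ => Real.exp (-x) * (x ^ 2 + R ^ 2) ^ m +
      2 * m * (x * (Real.exp (-x) * (x ^ 2 + R ^ 2) ^ (m - 1))))
    (f' := fun x : ℝ => ((2 * m + 4 * m * (m - 1)) * (Real.exp (-x) * (x ^ 2 + R ^ 2) ^ (m - 1)) -
      4 * m * (m - 1) * R ^ 2 * (Real.exp (-x) * (x ^ 2 + R ^ 2) ^ (m - 2))) -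
      Real.exp (-x) * (x ^ 2 + R ^ 2) ^ m) ?_
    (Integrable.sub i3 i0) ?_
  · have e1 := integral_sub ((i1.const_mul (2 * m + 4 * m * (m - 1))).sub
      (i2.const_mul (4 * m * (m - 1) * R ^ 2))) i0
    have e2 := integral_sub (i1.const_mul (2 * m + 4 * m * (m - 1)))
      (i2.const_mul (4 * m * (m - 1) * R ^ 2))
    simp only [Pi.sub_apply] at e1
    rw [e1, e2, integral_const_mul, integral_const_mul] at key
    change (2 * m + 4 * m * (m - 1)) * poissonMoment (m - 1) R -
      4 * m * (m - 1) * R ^ 2 * poissonMoment (m - 2) R - poissonMoment m R = _ at key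
    have h1 : R ^ 2 * poissonMoment (m - 2) R ≤ poissonMoment (m - 1) R := by
      rw [poissonMoment, ← integral_const_mul]
      refine integral_mono (i2.const_mul _) i1 fun x => ?_
      have h2 : (x ^ 2 + R ^ 2) ^ (m - 1) = (x ^ 2 + R ^ 2) ^ (m - 2) * (x ^ 2 + R ^ 2) := by
        rw [← Real.rpow_add_one (hpos x).ne']; congr 1; ring
      simp only
      rw [h2]
      have h3 : 0 ≤ Real.exp (-x) * (x ^ 2 + R ^ 2) ^ (m - 2) := by positivity
      nlinarith [mul_nonneg h3 (sq_nonneg x)]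
    have h2 : 0 ≤ (R ^ 2) ^ m := by positivity
    simp only [neg_zero, Real.exp_zero, zero_mul, mul_zero, add_zero, one_mul, zero_sub, ne_eq,
      OfNat.ofNat_ne_zero, not_false_eq_true, zero_pow, zero_add] at key
    have h3 : 0 ≤ 4 * m * (m - 1) := by nlinarith
    nlinarith [mul_le_mul_of_nonneg_left h1 h3]
  · intro x _
    have he : HasDerivAt (fun x : ℝ => Real.exp (-x)) (-Real.exp (-x)) x := by
      simpa using (hasDerivAt_neg x).exp
    have h1 := (he.mul (hd m x)).add (((hasDerivAt_id x).mul (he.mul (hd (m - 1) x))).const_mul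
      (2 * m))
    refine h1.congr_deriv ?_
    have h2 : (x ^ 2 + R ^ 2) ^ (m - 1) = (x ^ 2 + R ^ 2) ^ (m - 2) * (x ^ 2 + R ^ 2) := by
      rw [← Real.rpow_add_one (hpos x).ne']; congr 1; ring
    have h3 : m - 1 - 1 = m - 2 := by ring
    simp only [id_eq, h3, Pi.mul_apply]
    rw [h2]
    ring
  · have hG : ∀ k l : ℝ, 0 ≤ k → 0 ≤ l → Tendsto (fun x : ℝ => x ^ l * (Real.exp (-x) *
        (x ^ 2 + R ^ 2) ^ k)) atTop (𝓝 0) := by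
      intro k l hk hl
      have t1 := tendsto_rpow_mul_exp_neg_mul_atTop_nhds_zero l 1 one_pos
      have t2 := tendsto_rpow_mul_exp_neg_mul_atTop_nhds_zero (l + 2 * k) 1 one_pos
      have t3 := (t1.const_mul (2 ^ k * (R ^ 2) ^ k)).add (t2.const_mul (2 ^ k))
      rw [mul_zero, mul_zero, add_zero] at t3
      refine squeeze_zero' ?_ ?_ t3
      · filter_upwards [eventually_ge_atTop 0] with x hx
        positivity
      · filter_upwards [eventually_gt_atTop 0] with x hx
        have h1 := add_rpow_le_two_rpow_mul (A := R ^ 2) (s := x ^ 2) (by positivity)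
          (by positivity) hk
        have h2 : (x ^ 2) ^ k = x ^ (2 * k) := by
          rw [← Real.rpow_natCast, ← Real.rpow_mul hx.le]; norm_num
        rw [neg_one_mul, Real.rpow_add hx, ← h2, add_comm (x ^ 2)]
        calc x ^ l * (Real.exp (-x) * (R ^ 2 + x ^ 2) ^ k)
            ≤ x ^ l * (Real.exp (-x) * (2 ^ k * ((R ^ 2) ^ k + (x ^ 2) ^ k))) := by gcongr
          _ = _ := by ring
    have t1 := hG m 0 (by linarith) le_rfl
    have t2 := (hG (m - 1) 1 (by linarith) zero_le_one).const_mul (2 * m)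
    simpa using t1.add t2

/-- The Wronskian of the free Jost solution with Cauchy data `(u, v)` at `R`, where `u` is small
compared with `v`: its phase is that of `i^m v`, up to a small error. -/
theorem freeJost_wronskian_eq {m R ε : ℝ} (hm : 2 ≤ m) (hR : 0 < R) (hε : 0 ≤ ε) :
    ∃ κ : ℝ, 0 < κ ∧ ∀ u v : ℂ, ‖u‖ ≤ ε * ‖v‖ → ∃ η : ℂ, ‖η‖ ≤ R * Real.exp (R + 1) * 2 ^ (-m) +
        R * (1 + R * Real.exp (R + 1) * 2 ^ (1 - m)) * ε ∧
      freeJost m R * v - I * freeJost (m - 1) R * u =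
        κ * exp (I * (Real.pi * m / 2)) * (v * (1 + η)) := by
  have hP : ∀ k : ℝ, 1 ≤ k → 0 < poissonMoment k R := fun k hk =>
    lt_of_lt_of_le (by positivity) (le_poissonMoment (by linarith) hR)
  have hEP : ∀ k : ℝ, 1 ≤ k →
      (R ^ 2) ^ k * R ≤ R * Real.exp (R + 1) * 2 ^ (-k) * poissonMoment k R := by
    intro k hk
    have h1 := le_poissonMoment (m := k) (by linarith) hR
    calc (R ^ 2) ^ k * R = R * Real.exp (R + 1) * 2 ^ (-k) *
          (Real.exp (-(R + 1)) * (2 * R ^ 2) ^ k) := by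
          rw [Real.mul_rpow (by norm_num) (by positivity), Real.rpow_neg (by norm_num),
            Real.exp_neg]
          have h2 : (2 : ℝ) ^ k ≠ 0 := by positivity
          have h3 := (Real.exp_pos (R + 1)).ne'
          field_simp
      _ ≤ _ := by gcongr
  obtain ⟨E, hE, hEeq⟩ := exists_laplaceMoment_eq (m := m) (by linarith) hR
  obtain ⟨E', hE', hEeq'⟩ := exists_laplaceMoment_eq (m := m - 1) (by linarith) hR
  have hPm := hP m (by linarith)
  have hPm' := hP (m - 1) (by linarith)
  have hrec := mul_poissonMoment_sub_one_le hm hR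
  set P := poissonMoment m R
  set P' := poissonMoment (m - 1) R
  have hG : 0 < Real.Gamma (m + 1) := Real.Gamma_pos_of_pos (by linarith)
  have h2I : (-2 * I : ℂ) ≠ 0 := by simp
  have harg : arg (-2 * I) = -(Real.pi / 2) := by
    have := arg_real_mul (-I) (r := 2) (by norm_num)
    rw [arg_neg_I] at this
    rw [← this]
    congr 1
    push_cast
    ring
  -- The whole phase of the free solution comes from this power of -2i.
  have hinv : ((-2 * I) ^ (m : ℂ))⁻¹ = ((2 : ℝ) ^ (-m) : ℝ) * exp (I * (Real.pi * m / 2)) := by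
    have hlog : log (-2 * I) = (Real.log 2 : ℝ) + (-(Real.pi / 2) : ℝ) * I := by
      rw [Complex.log, harg]
      simp
    rw [← cpow_neg, cpow_def_of_ne_zero h2I, hlog, Real.rpow_def_of_pos (by norm_num), ofReal_exp,
      ← exp_add]
    congr 1
    push_cast
    ring
  have h2Im : (-2 * I) ^ (m : ℂ) ≠ 0 := (cpow_ne_zero_iff_of_exponent_ne_zero (by
    have : m ≠ 0 := by linarith
    exact_mod_cast this)).2 h2I
  have hsub : (-2 * I) ^ (((m - 1 : ℝ)) : ℂ) * (-2 * I) = (-2 * I) ^ (m : ℂ) := by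
    rw [ofReal_sub, ofReal_one, cpow_sub _ _ h2I, cpow_one, div_mul_cancel₀ _ h2I]
  set A : ℝ := R ^ (-m) / Real.Gamma (m + 1) with hA
  have hApos : 0 < A := by positivity
  have hf : freeJost m R = A * ((-2 * I) ^ (m : ℂ))⁻¹ * (P + E) := by
    rw [freeJost, ← hEeq, ← hA]
    field_simp
  have hf' : freeJost (m - 1) R = A * ((-2 * I) ^ (m : ℂ))⁻¹ *
      (m * R * (-2 * I) * (P' + E')) := by
    rw [freeJost_sub_one (by linarith) hR, ← hEeq', ← hsub, ← hA]
    have : (-2 * I) ^ (((m - 1 : ℝ)) : ℂ) ≠ 0 := left_ne_zero_of_mul (hsub.symm ▸ h2Im)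
    field_simp
  have hmain : ∀ u v : ℂ, freeJost m R * v - I * freeJost (m - 1) R * u =
      A * ((-2 * I) ^ (m : ℂ))⁻¹ * ((P + E) * v - 2 * m * R * (P' + E') * u) := by
    intro u v
    rw [hf, hf']
    linear_combination (2 * A * ((-2 * I) ^ (m : ℂ))⁻¹ * (m * R * (P' + E')) * u) * I_mul_I
  have hPc : (P : ℂ) ≠ 0 := by exact_mod_cast hPm.ne'
  have hm0 : (0 : ℝ) ≤ m := by linarith
  -- κ gathers the positive factors. In η, the term E/P is exponentially small in m, and the u-term
  -- is of size ε because 2m P' ≤ P absorbs the factor m.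
  refine ⟨A * 2 ^ (-m) * P, by positivity, fun u v huv =>
    ⟨(E - 2 * m * R * (P' + E') * (u / v)) / P, ?_, ?_⟩⟩
  · have huv' : ‖u / v‖ ≤ ε := by
      rw [norm_div]
      exact div_le_of_le_mul₀ (norm_nonneg _) hε huv
    rw [norm_div, norm_real, Real.norm_of_nonneg hPm.le, div_le_iff₀ hPm]
    have h1 : ‖E‖ ≤ R * Real.exp (R + 1) * 2 ^ (-m) * P := hE.trans (hEP m (by linarith))
    have h2 : ‖E'‖ ≤ R * Real.exp (R + 1) * 2 ^ (1 - m) * P' := by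
      have := hE'.trans (hEP (m - 1) (by linarith))
      rwa [neg_sub] at this
    have h3 : ‖2 * m * R * (P' + E') * (u / v)‖ ≤
        R * (1 + R * Real.exp (R + 1) * 2 ^ (1 - m)) * ε * P := by
      rw [norm_mul, norm_mul, norm_mul, norm_mul, norm_real, norm_real, Real.norm_of_nonneg hm0,
        Real.norm_of_nonneg hR.le]
      have h4 : ‖(P' : ℂ) + E'‖ ≤ (1 + R * Real.exp (R + 1) * 2 ^ (1 - m)) * P' := by
        refine (norm_add_le _ _).trans ?_
        rw [norm_real, Real.norm_of_nonneg hPm'.le]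
        linarith
      calc ‖(2 : ℂ)‖ * m * R * ‖(P' : ℂ) + E'‖ * ‖u / v‖
          ≤ 2 * m * R * ((1 + R * Real.exp (R + 1) * 2 ^ (1 - m)) * P') * ε := by
            rw [Complex.norm_ofNat]
            gcongr
        _ = R * (1 + R * Real.exp (R + 1) * 2 ^ (1 - m)) * ε * (2 * m * P') := by ring
        _ ≤ _ := by gcongr
    calc ‖E - 2 * m * R * (P' + E') * (u / v)‖ ≤ ‖E‖ + ‖2 * m * R * (P' + E') * (u / v)‖ :=
          norm_sub_le _ _
      _ ≤ _ := by linarith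
  · rw [hmain, hinv]
    rcases eq_or_ne v 0 with rfl | hv
    · have hu : u = 0 := by simpa using huv
      simp [hu]
    · push_cast
      field_simp
      ring

end FreeJostPhase

/-! ### Solutions depending holomorphically on the spectral parameter. -/

section Volterra

open Complex Filter Topology Set MeasureTheory

theorem intervalIntegrable_of_bounded {q : ℝ → ℂ} {C : ℝ} (hq : AEStronglyMeasurable q volume)
    (hC : ∀ s, ‖q s‖ ≤ C) (a b : ℝ) : IntervalIntegrable q volume a b :=
  (intervalIntegrable_const (c := C)).mono_fun' hq.restrict (Eventually.of_forall hC)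

theorem integral_exp_neg_mul_sub_le {lam a r : ℝ} (hlam : 0 < lam) :
    ∫ s in a..r, Real.exp (-(lam * (r - s))) ≤ 1 / lam := by
  have h : ∀ s ∈ uIcc a r, HasDerivAt (fun s => Real.exp (-(lam * (r - s))) / lam)
      (Real.exp (-(lam * (r - s)))) s := by
    intro s _
    have h1 : HasDerivAt (fun s => -(lam * (r - s))) lam s := by
      exact (((hasDerivAt_id s).const_sub r).const_mul lam).neg.congr_deriv (by simp)
    refine (h1.exp.div_const lam).congr_deriv ?_
    field_simp
  rw [intervalIntegral.integral_eq_sub_of_hasDerivAt h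
    (Continuous.intervalIntegrable (by fun_prop) _ _)]
  simp only [sub_self, mul_zero, neg_zero, Real.exp_zero]
  have : 0 ≤ Real.exp (-(lam * (r - a))) / lam := by positivity
  linarith

/-- The Volterra operator with exponentially weighted kernel, on bounded continuous functions. -/
theorem exists_volterra_operator {q : ℝ → ℂ} {C : ℝ} (hq : AEStronglyMeasurable q volume)
    (hC : ∀ s, ‖q s‖ ≤ C) (a : ℝ) {lam : ℝ} (hlam : 0 < lam) :
    ∃ T : BoundedContinuousFunction ℝ ℂ →L[ℂ] BoundedContinuousFunction ℝ ℂ, ‖T‖ ≤ C / lam ∧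
      ∀ f r, a ≤ r → T f r = ∫ s in a..r, (Real.exp (-(lam * (r - s))) : ℂ) * (q s * f s) := by
  have hC0 : 0 ≤ C := (norm_nonneg _).trans (hC 0)
  have hint : ∀ (f : BoundedContinuousFunction ℝ ℂ) (r b c : ℝ), IntervalIntegrable
      (fun s => (Real.exp (-(lam * (r - s))) : ℂ) * (q s * f s)) volume b c := fun f r b c =>
    ((intervalIntegrable_of_bounded hq hC b c).mul_continuousOn
      f.continuous.continuousOn).continuousOn_mul (by fun_prop)
  -- Replacing r by `max r a` extends the image by a constant to the left of a, so that one works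
  -- with bounded continuous functions on the whole line.
  set Tf : BoundedContinuousFunction ℝ ℂ → ℝ → ℂ := fun f r =>
    ∫ s in a..max r a, (Real.exp (-(lam * (max r a - s))) : ℂ) * (q s * f s) with hTf
  have hcont : ∀ f, Continuous (Tf f) := by
    intro f
    have h1 : Tf f = fun r => (Real.exp (-(lam * max r a)) : ℂ) *
        ∫ s in a..max r a, (Real.exp (-(lam * (0 - s))) : ℂ) * (q s * f s) := by
      funext r
      rw [hTf, ← intervalIntegral.integral_const_mul]
      refine intervalIntegral.integral_congr fun s _ => ?_
      rw [← mul_assoc (Real.exp _ : ℂ) (Real.exp _ : ℂ), ← ofReal_mul, ← Real.exp_add]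
      congr 4
      ring
    rw [h1]
    refine Continuous.mul (by fun_prop) ?_
    exact (intervalIntegral.continuous_primitive (hint f 0) a).comp (by fun_prop)
  have hbound : ∀ f r, ‖Tf f r‖ ≤ C / lam * ‖f‖ := by
    intro f r
    have hle : a ≤ max r a := le_max_right _ _
    calc ‖Tf f r‖ ≤ ∫ s in a..max r a, Real.exp (-(lam * (max r a - s))) * (C * ‖f‖) := by
          refine intervalIntegral.norm_integral_le_of_norm_le hle
            (Eventually.of_forall fun s _ => ?_)
            (Continuous.intervalIntegrable (by fun_prop) _ _)
          rw [norm_mul, norm_mul, norm_real, Real.norm_of_nonneg (Real.exp_nonneg _)]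
          gcongr
          · exact hC s
          · exact f.norm_coe_le_norm s
      _ = (∫ s in a..max r a, Real.exp (-(lam * (max r a - s)))) * (C * ‖f‖) :=
          intervalIntegral.integral_mul_const _ _
      _ ≤ 1 / lam * (C * ‖f‖) := by
          gcongr
          exact integral_exp_neg_mul_sub_le hlam
      _ = _ := by ring
  let B : BoundedContinuousFunction ℝ ℂ → BoundedContinuousFunction ℝ ℂ := fun f =>
    BoundedContinuousFunction.ofNormedAddCommGroup (Tf f) (hcont f) _ (hbound f)
  let Lm : BoundedContinuousFunction ℝ ℂ →ₗ[ℂ] BoundedContinuousFunction ℝ ℂ :=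
    { toFun := B
      map_add' := fun f g => by
        ext r
        change Tf (f + g) r = Tf f r + Tf g r
        rw [hTf]
        simp only
        rw [← intervalIntegral.integral_add (hint f _ _ _) (hint g _ _ _)]
        refine intervalIntegral.integral_congr fun s _ => ?_
        simp only [BoundedContinuousFunction.coe_add, Pi.add_apply]
        ring
      map_smul' := fun c f => by
        ext r
        change Tf (c • f) r = c * Tf f r
        rw [hTf]
        simp only
        rw [← intervalIntegral.integral_const_mul]
        refine intervalIntegral.integral_congr fun s _ => ?_
        simp only [BoundedContinuousFunction.coe_smul, smul_eq_mul]
        ring }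
  have hn : ∀ f, ‖Lm f‖ ≤ C / lam * ‖f‖ := fun f =>
    (BoundedContinuousFunction.norm_le (by positivity)).2 (hbound f)
  refine ⟨Lm.mkContinuous _ hn, Lm.mkContinuous_norm_le (by positivity) hn, fun f r hr => ?_⟩
  change Tf f r = _
  rw [hTf]
  simp only [max_eq_left hr]

/-- `(u, w)` solves `u' = w`, `w' = q u` in integrated form on `[a, ∞)`, with initial data
`(c₁, c₂)`. -/
structure IsIntegralSolution (q : ℝ → ℂ) (a : ℝ) (c₁ c₂ : ℂ) (u w : ℝ → ℂ) : Prop where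
  cont_u : ContinuousOn u (Ici a)
  cont_w : ContinuousOn w (Ici a)
  eq_u : ∀ r, a ≤ r → u r = c₁ + ∫ s in a..r, w s
  eq_w : ∀ r, a ≤ r → w r = c₂ + ∫ s in a..r, q s * u s

/-- Grönwall for g, the integral of |U| + |W| with U, W the differences: the integral equations give
|U| ≤ g and |W| ≤ C g. -/
theorem IsIntegralSolution.unique {q : ℝ → ℂ} {C a : ℝ} {c₁ c₂ : ℂ} {u w u' w' : ℝ → ℂ}
    (hq : AEStronglyMeasurable q volume) (hC : ∀ s, ‖q s‖ ≤ C)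
    (h : IsIntegralSolution q a c₁ c₂ u w) (h' : IsIntegralSolution q a c₁ c₂ u' w') :
    ∀ r, a ≤ r → u r = u' r ∧ w r = w' r := by
  have hC0 : 0 ≤ C := (norm_nonneg _).trans (hC 0)
  have hmax : Continuous fun s : ℝ => max s a := by fun_prop
  have hmem : ∀ s : ℝ, max s a ∈ Ici a := fun s => mem_Ici.2 (le_max_right _ _)
  have cu := ((h.cont_u.sub h'.cont_u).comp_continuous hmax hmem)
  have cw := ((h.cont_w.sub h'.cont_w).comp_continuous hmax hmem)
  set U : ℝ → ℂ := fun s => u (max s a) - u' (max s a) with hU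
  set W : ℝ → ℂ := fun s => w (max s a) - w' (max s a) with hW
  have hUr : ∀ s, a ≤ s → U s = u s - u' s := fun s hs => by simp [hU, max_eq_left hs]
  have hWr : ∀ s, a ≤ s → W s = w s - w' s := fun s hs => by simp [hW, max_eq_left hs]
  have iu : ∀ {x : ℝ → ℂ}, ContinuousOn x (Ici a) → ∀ r, a ≤ r →
      IntervalIntegrable x volume a r := fun hx r hr =>
    (hx.mono (by rw [uIcc_of_le hr]; exact Icc_subset_Ici_self)).intervalIntegrable
  have iqu : ∀ {x : ℝ → ℂ}, ContinuousOn x (Ici a) → ∀ r, a ≤ r →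
      IntervalIntegrable (fun s => q s * x s) volume a r := fun hx r hr =>
    (intervalIntegrable_of_bounded hq hC a r).mul_continuousOn
      (hx.mono (by rw [uIcc_of_le hr]; exact Icc_subset_Ici_self))
  set g : ℝ → ℝ := fun r => ∫ s in a..r, (‖U s‖ + ‖W s‖) with hg
  have hcg : Continuous fun s => ‖U s‖ + ‖W s‖ := (cu.norm).add cw.norm
  have hgd : ∀ r, HasDerivAt g (‖U r‖ + ‖W r‖) r := fun r =>
    intervalIntegral.integral_hasDerivAt_right (hcg.intervalIntegrable _ _)
      (hcg.stronglyMeasurableAtFilter _ _) hcg.continuousAt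
  have hbU : ∀ r, a ≤ r → ‖U r‖ ≤ g r := by
    intro r hr
    have h1 : U r = ∫ s in a..r, W s := by
      rw [hUr r hr, h.eq_u r hr, h'.eq_u r hr, add_sub_add_left_eq_sub,
        ← intervalIntegral.integral_sub (iu h.cont_w r hr) (iu h'.cont_w r hr)]
      refine intervalIntegral.integral_congr fun s hs => ?_
      rw [uIcc_of_le hr] at hs
      exact (hWr s hs.1).symm
    rw [h1]
    refine intervalIntegral.norm_integral_le_of_norm_le hr (Eventually.of_forall fun s _ => ?_)
      (hcg.intervalIntegrable _ _)
    linarith [norm_nonneg (U s)]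
  have hbW : ∀ r, a ≤ r → ‖W r‖ ≤ C * g r := by
    intro r hr
    have h1 : W r = ∫ s in a..r, q s * U s := by
      rw [hWr r hr, h.eq_w r hr, h'.eq_w r hr, add_sub_add_left_eq_sub,
        ← intervalIntegral.integral_sub (iqu h.cont_u r hr) (iqu h'.cont_u r hr)]
      refine intervalIntegral.integral_congr fun s hs => ?_
      rw [uIcc_of_le hr] at hs
      rw [hUr s hs.1, mul_sub]
    rw [h1, hg, ← intervalIntegral.integral_const_mul]
    refine intervalIntegral.norm_integral_le_of_norm_le hr (Eventually.of_forall fun s _ => ?_)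
      ((hcg.const_mul C).intervalIntegrable _ _)
    rw [norm_mul]
    have := mul_le_mul_of_nonneg_right (hC s) (norm_nonneg (U s))
    nlinarith [mul_nonneg hC0 (norm_nonneg (W s))]
  have hg0 : ∀ r, a ≤ r → g r = 0 := by
    intro r hr
    have := norm_le_gronwallBound_of_norm_deriv_right_le (f := g)
      (f' := fun r => ‖U r‖ + ‖W r‖) (δ := 0) (K := 1 + C) (ε := 0) (a := a) (b := r)
      (fun x _ => (hgd x).continuousAt.continuousWithinAt)
      (fun x _ => (hgd x).hasDerivWithinAt) (by simp [hg]) (fun x hx => by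
        rw [Real.norm_of_nonneg (by positivity), add_zero]
        have h1 := hbU x hx.1
        have h2 := hbW x hx.1
        have h3 : g x ≤ ‖g x‖ := Real.le_norm_self _
        nlinarith [mul_le_mul_of_nonneg_left h3 hC0]) r ⟨hr, le_rfl⟩
    rw [gronwallBound_ε0, zero_mul] at this
    exact norm_le_zero_iff.1 this
  intro r hr
  have h1 := hbU r hr
  have h2 := hbW r hr
  rw [hg0 r hr] at h1 h2
  rw [mul_zero] at h2
  constructor
  · rw [← sub_eq_zero, ← hUr r hr]; exact norm_le_zero_iff.1 h1
  · rw [← sub_eq_zero, ← hWr r hr]; exact norm_le_zero_iff.1 h2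

theorem exists_differentiableOn_inverse_one_sub {𝔄 : Type*} [NormedRing 𝔄] [NormedAlgebra ℂ 𝔄]
    [CompleteSpace 𝔄] {f : ℂ → 𝔄} {s : Set ℂ} (hf : Differentiable ℂ f) (hs : ∀ ν ∈ s, ‖f ν‖ < 1) :
    ∃ g : ℂ → 𝔄, DifferentiableOn ℂ g s ∧ ∀ ν ∈ s, (1 - f ν) * g ν = 1 := by
  have hunit : ∀ ν ∈ s, IsUnit (1 - f ν) := fun ν hν => isUnit_one_sub_of_norm_lt_one (hs ν hν)
  exact ⟨fun ν => Ring.inverse (1 - f ν), fun ν hν =>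
    (DifferentiableAt.inverse ((hf ν).const_sub 1) (hunit ν hν)).differentiableWithinAt,
    fun ν hν => Ring.mul_inverse_cancel _ (hunit ν hν)⟩

/-- The fixed point is (1 - T Q(ν))⁻¹ y, and inversion in a Banach algebra is holomorphic. -/
theorem exists_differentiableOn_fixedPoint {E : Type*} [NormedAddCommGroup E] [NormedSpace ℂ E]
    [CompleteSpace E] (T : E →L[ℂ] E) {Q : ℂ → E →L[ℂ] E} {s : Set ℂ} (hQ : Differentiable ℂ Q)
    (hs : ∀ ν ∈ s, ‖T * Q ν‖ < 1) (y : E) :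
    ∃ U : ℂ → E, DifferentiableOn ℂ U s ∧ ∀ ν ∈ s, U ν = y + T (Q ν (U ν)) := by
  obtain ⟨g, hg, hinv⟩ := exists_differentiableOn_inverse_one_sub (hQ.const_mul T) hs
  refine ⟨fun ν => g ν y, hg.clm_apply (differentiableOn_const _), fun ν hν => ?_⟩
  have h1 : g ν y - T (Q ν (g ν y)) = y :=
    congrArg (fun A : E →L[ℂ] E => A y) (hinv ν hν)
  exact sub_eq_iff_eq_add.1 h1

theorem differentiable_quadratic_smul {E : Type*} [NormedAddCommGroup E] [NormedSpace ℂ E]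
    (A B D : E) : Differentiable ℂ fun ν : ℂ => A + ν • B + ν ^ 2 • D := by
  fun_prop

/-- After multiplication by exp(-λ(r - a)) the two integrations have norms at most 1/λ and K/λ for
|ν| < ρ. With λ = 1 + K their product is a contraction, uniformly on the ball. -/
theorem exists_isIntegralSolution_of_bounded_parameter {q₀ q₁ q₂ : ℝ → ℂ} {C : ℝ}
    (h₀ : AEStronglyMeasurable q₀ volume) (h₁ : AEStronglyMeasurable q₁ volume)
    (h₂ : AEStronglyMeasurable q₂ volume) (hC₀ : ∀ s, ‖q₀ s‖ ≤ C) (hC₁ : ∀ s, ‖q₁ s‖ ≤ C)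
    (hC₂ : ∀ s, ‖q₂ s‖ ≤ C) (a : ℝ) (c₁ c₂ : ℂ) (ρ : ℝ) :
    ∃ u w : ℂ → ℝ → ℂ,
      (∀ ν ∈ Metric.ball (0 : ℂ) ρ,
        IsIntegralSolution (fun s => q₀ s + ν * q₁ s + ν ^ 2 * q₂ s) a c₁ c₂ (u ν) (w ν)) ∧
      ∀ r, a ≤ r → DifferentiableOn ℂ (fun ν => u ν r) (Metric.ball 0 ρ) ∧
        DifferentiableOn ℂ (fun ν => w ν r) (Metric.ball 0 ρ) := by
  have hC0 : 0 ≤ C := (norm_nonneg _).trans (hC₀ 0)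
  set K : ℝ := C + |ρ| * C + |ρ| ^ 2 * C with hK
  have hK0 : 0 ≤ K := by positivity
  set lam : ℝ := 1 + K with hlamdef
  have hlam : 0 < lam := by positivity
  obtain ⟨T, hT, hTeq⟩ := exists_volterra_operator (q := fun _ => 1) (C := 1)
    aestronglyMeasurable_const (by simp) a hlam
  obtain ⟨T₀, hT₀, hT₀eq⟩ := exists_volterra_operator h₀ hC₀ a hlam
  obtain ⟨T₁, hT₁, hT₁eq⟩ := exists_volterra_operator h₁ hC₁ a hlam
  obtain ⟨T₂, hT₂, hT₂eq⟩ := exists_volterra_operator h₂ hC₂ a hlam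
  set Q : ℂ → BoundedContinuousFunction ℝ ℂ →L[ℂ] BoundedContinuousFunction ℝ ℂ := fun ν =>
    T₀ + ν • T₁ + ν ^ 2 • T₂ with hQ
  have hQn : ∀ ν ∈ Metric.ball (0 : ℂ) ρ, ‖Q ν‖ ≤ K / lam := by
    intro ν hν
    have hν' : ‖ν‖ ≤ |ρ| := by
      have := mem_ball_zero_iff.1 hν
      exact this.le.trans (le_abs_self _)
    calc ‖Q ν‖ ≤ ‖T₀‖ + ‖ν • T₁‖ + ‖ν ^ 2 • T₂‖ := norm_add₃_le
      _ ≤ C / lam + |ρ| * (C / lam) + |ρ| ^ 2 * (C / lam) := by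
          rw [norm_smul, norm_smul, norm_pow]
          gcongr
      _ = K / lam := by rw [hK]; ring
  have hlt : ∀ ν ∈ Metric.ball (0 : ℂ) ρ, ‖T * Q ν‖ < 1 := by
    intro ν hν
    have h1 : K / lam < 1 := by rw [div_lt_one hlam]; linarith
    have h2 : 1 / lam ≤ 1 := by rw [div_le_one hlam]; linarith
    calc ‖T * Q ν‖ ≤ ‖T‖ * ‖Q ν‖ := norm_mul_le _ _
      _ ≤ 1 * (K / lam) := by
          gcongr
          · exact hT.trans h2
          · exact hQn ν hν
      _ < 1 := by linarith
  have hQd : Differentiable ℂ Q := differentiable_quadratic_smul T₀ T₁ T₂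
  set e : BoundedContinuousFunction ℝ ℂ := BoundedContinuousFunction.ofNormedAddCommGroup
    (fun r : ℝ => (Real.exp (-(lam * (max r a - a))) : ℂ)) (by fun_prop) 1 (fun r => by
      rw [norm_real, Real.norm_of_nonneg (Real.exp_nonneg _), Real.exp_le_one_iff]
      have : a ≤ max r a := le_max_right _ _
      nlinarith) with he
  have heq : ∀ r, a ≤ r → e r = (Real.exp (-(lam * (r - a))) : ℂ) := fun r hr => by
    change (Real.exp (-(lam * (max r a - a))) : ℂ) = _
    rw [max_eq_left hr]
  obtain ⟨U, hUd, hUeq⟩ := exists_differentiableOn_fixedPoint T hQd hlt (c₁ • e + c₂ • T e)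
  set W : ℂ → BoundedContinuousFunction ℝ ℂ := fun ν => c₂ • e + Q ν (U ν) with hW
  have hUW : ∀ ν ∈ Metric.ball (0 : ℂ) ρ, U ν = c₁ • e + T (W ν) := by
    intro ν hν
    rw [hW]
    simp only [map_add, map_smul]
    rw [← add_assoc, ← hUeq ν hν]
  have hWd : DifferentiableOn ℂ W (Metric.ball 0 ρ) :=
    (differentiableOn_const _).add (hQd.differentiableOn.clm_apply hUd)
  have hexp : ∀ r s : ℝ, (Real.exp (lam * (r - a)) : ℂ) * (Real.exp (-(lam * (r - s))) : ℂ) =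
      (Real.exp (lam * (s - a)) : ℂ) := by
    intro r s
    rw [← ofReal_mul, ← Real.exp_add]
    congr 2
    ring
  have hexp1 : ∀ r : ℝ, a ≤ r → (Real.exp (lam * (r - a)) : ℂ) * e r = 1 := by
    intro r hr
    rw [heq r hr, hexp]
    simp
  have hmulT : ∀ (S : BoundedContinuousFunction ℝ ℂ →L[ℂ] BoundedContinuousFunction ℝ ℂ)
      (p : ℝ → ℂ) (f : BoundedContinuousFunction ℝ ℂ) (r : ℝ),
      S f r = (∫ s in a..r, (Real.exp (-(lam * (r - s))) : ℂ) * (p s * f s)) →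
      (Real.exp (lam * (r - a)) : ℂ) * S f r =
        ∫ s in a..r, p s * ((Real.exp (lam * (s - a)) : ℂ) * f s) := by
    intro S p f r h
    rw [h, ← intervalIntegral.integral_const_mul]
    refine intervalIntegral.integral_congr fun s _ => ?_
    rw [← mul_assoc, hexp]
    ring
  have happly : ∀ r, Differentiable ℂ fun f : BoundedContinuousFunction ℝ ℂ => f r := fun r =>
    (BoundedContinuousFunction.evalCLM ℂ r : BoundedContinuousFunction ℝ ℂ →L[ℂ] ℂ).differentiable
  refine ⟨fun ν r => (Real.exp (lam * (r - a)) : ℂ) * U ν r,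
    fun ν r => (Real.exp (lam * (r - a)) : ℂ) * W ν r, fun ν hν => ⟨?_, ?_, ?_, ?_⟩,
    fun r _ => ⟨?_, ?_⟩⟩
  · exact Continuous.continuousOn (Continuous.mul (by fun_prop) (U ν).continuous)
  · exact Continuous.continuousOn (Continuous.mul (by fun_prop) (W ν).continuous)
  · intro r hr
    have h1 := congrArg (fun f : BoundedContinuousFunction ℝ ℂ => f r) (hUW ν hν)
    simp only [BoundedContinuousFunction.coe_add, BoundedContinuousFunction.coe_smul, Pi.add_apply,
      smul_eq_mul] at h1
    simp only
    rw [h1, mul_add, mul_left_comm, hexp1 r hr, hmulT T _ _ r (hTeq _ r hr)]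
    simp
  · intro r hr
    have h1 : W ν r = c₂ * e r + (T₀ (U ν) r + ν * T₁ (U ν) r + ν ^ 2 * T₂ (U ν) r) := rfl
    have iq : ∀ {p : ℝ → ℂ}, AEStronglyMeasurable p volume → (∀ s, ‖p s‖ ≤ C) →
        IntervalIntegrable (fun s => p s * ((Real.exp (lam * (s - a)) : ℂ) * U ν s)) volume a r :=
      fun hp hpC => (intervalIntegrable_of_bounded hp hpC a r).mul_continuousOn
        (Continuous.continuousOn (Continuous.mul (by fun_prop) (U ν).continuous))
    have h2 : (Real.exp (lam * (r - a)) : ℂ) * W ν r = c₂ * ((Real.exp (lam * (r - a)) : ℂ) * e r) +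
        ((Real.exp (lam * (r - a)) : ℂ) * T₀ (U ν) r +
          ν * ((Real.exp (lam * (r - a)) : ℂ) * T₁ (U ν) r) +
          ν ^ 2 * ((Real.exp (lam * (r - a)) : ℂ) * T₂ (U ν) r)) := by
      rw [h1]; ring
    simp only
    rw [h2, hexp1 r hr, mul_one, hmulT T₀ _ _ r (hT₀eq _ r hr), hmulT T₁ _ _ r (hT₁eq _ r hr),
      hmulT T₂ _ _ r (hT₂eq _ r hr), ← intervalIntegral.integral_const_mul,
      ← intervalIntegral.integral_const_mul,
      ← intervalIntegral.integral_add (iq h₀ hC₀) ((iq h₁ hC₁).const_mul ν),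
      ← intervalIntegral.integral_add ((iq h₀ hC₀).add ((iq h₁ hC₁).const_mul ν))
        ((iq h₂ hC₂).const_mul _)]
    congr 1
    refine intervalIntegral.integral_congr fun s _ => ?_
    ring
  · exact ((happly r).comp_differentiableOn hUd).const_mul _
  · exact ((happly r).comp_differentiableOn hWd).const_mul _

/-- Solutions with fixed initial data, depending holomorphically on the parameter. -/
theorem exists_isIntegralSolution {q₀ q₁ q₂ : ℝ → ℂ} {C : ℝ}
    (h₀ : AEStronglyMeasurable q₀ volume) (h₁ : AEStronglyMeasurable q₁ volume)
    (h₂ : AEStronglyMeasurable q₂ volume) (hC₀ : ∀ s, ‖q₀ s‖ ≤ C) (hC₁ : ∀ s, ‖q₁ s‖ ≤ C)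
    (hC₂ : ∀ s, ‖q₂ s‖ ≤ C) (a : ℝ) (c₁ c₂ : ℂ) :
    ∃ u w : ℂ → ℝ → ℂ,
      (∀ ν, IsIntegralSolution (fun s => q₀ s + ν * q₁ s + ν ^ 2 * q₂ s) a c₁ c₂ (u ν) (w ν)) ∧
      ∀ r, a ≤ r → Differentiable ℂ (fun ν => u ν r) ∧ Differentiable ℂ (fun ν => w ν r) := by
  have hC0 : 0 ≤ C := (norm_nonneg _).trans (hC₀ 0)
  choose u w hs hd using
    exists_isIntegralSolution_of_bounded_parameter h₀ h₁ h₂ hC₀ hC₁ hC₂ a c₁ c₂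
  have hmem : ∀ ν : ℂ, ν ∈ Metric.ball (0 : ℂ) (‖ν‖ + 1) := fun ν => by simp
  have hmeas : ∀ ν : ℂ, AEStronglyMeasurable (fun s => q₀ s + ν * q₁ s + ν ^ 2 * q₂ s) volume :=
    fun ν => (h₀.add (h₁.const_mul ν)).add (h₂.const_mul _)
  have hbd : ∀ (ν : ℂ) s, ‖q₀ s + ν * q₁ s + ν ^ 2 * q₂ s‖ ≤ C + ‖ν‖ * C + ‖ν‖ ^ 2 * C := by
    intro ν s
    refine norm_add₃_le.trans ?_
    rw [norm_mul, norm_mul, norm_pow]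
    gcongr
    exacts [hC₀ s, hC₁ s, hC₂ s]
  -- Uniqueness makes the solutions built on different balls agree, so choosing the radius ‖ν‖ + 1
  -- for each ν yields entire functions.
  have hglue : ∀ ρ : ℝ, ∀ ν ∈ Metric.ball (0 : ℂ) ρ, ∀ r, a ≤ r →
      u (‖ν‖ + 1) ν r = u ρ ν r ∧ w (‖ν‖ + 1) ν r = w ρ ν r := fun ρ ν hν =>
    (hs _ ν (hmem ν)).unique (hmeas ν) (hbd ν) (hs ρ ν hν)
  refine ⟨fun ν => u (‖ν‖ + 1) ν, fun ν => w (‖ν‖ + 1) ν, fun ν => hs _ ν (hmem ν),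
    fun r hr => ⟨fun ν => ?_, fun ν => ?_⟩⟩
  · refine (((hd (‖ν‖ + 1) r hr).1 ν (hmem ν)).differentiableAt
      (Metric.isOpen_ball.mem_nhds (hmem ν))).congr_of_eventuallyEq ?_
    filter_upwards [Metric.isOpen_ball.mem_nhds (hmem ν)] with z hz
    exact (hglue _ z hz r hr).1
  · refine (((hd (‖ν‖ + 1) r hr).2 ν (hmem ν)).differentiableAt
      (Metric.isOpen_ball.mem_nhds (hmem ν))).congr_of_eventuallyEq ?_
    filter_upwards [Metric.isOpen_ball.mem_nhds (hmem ν)] with z hz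
    exact (hglue _ z hz r hr).2

end Volterra

/-! ### Energy estimates for the first-order system. -/

section Energy

open Complex Filter Topology Set ComplexConjugate

/-- Right derivatives suffice for monotonicity of a continuous function, and they are what remains
available where V jumps. -/
theorem le_of_right_deriv_nonneg {f f' : ℝ → ℝ} {a b : ℝ} (hab : a ≤ b)
    (hf : ContinuousOn f (Icc a b)) (hf' : ∀ x ∈ Ico a b, HasDerivWithinAt f (f' x) (Ici x) x)
    (h0 : ∀ x ∈ Ico a b, 0 ≤ f' x) : f a ≤ f b := by
  have := image_le_of_deriv_right_le_deriv_boundary (f := fun x => -f x) (f' := fun x => -f' x)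
    (B := fun _ => -f a) (B' := fun _ => 0) hf.neg (fun x hx => (hf' x hx).neg) le_rfl
    continuousOn_const (fun x _ => hasDerivWithinAt_const _ _ _)
    (fun x hx => by simpa using h0 x hx) (right_mem_Icc.2 hab)
  simpa using this

theorem hasDerivWithinAt_exp_mul_sub (K a x : ℝ) (s : Set ℝ) :
    HasDerivWithinAt (fun x => Real.exp (K * (x - a))) (K * Real.exp (K * (x - a))) s x := by
  have h1 : HasDerivAt (fun x => K * (x - a)) K x := by
    simpa using ((hasDerivAt_id x).sub_const a).const_mul K
  exact (h1.exp.congr_deriv (mul_comm _ _)).hasDerivWithinAt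

theorem le_mul_exp_of_right_deriv_le {f f' : ℝ → ℝ} {a b K : ℝ} (hab : a ≤ b)
    (hf : ContinuousOn f (Icc a b)) (hf' : ∀ x ∈ Ico a b, HasDerivWithinAt f (f' x) (Ici x) x)
    (h0 : ∀ x ∈ Ico a b, f' x ≤ K * f x) : f b ≤ f a * Real.exp (K * (b - a)) := by
  have h1 := le_of_right_deriv_nonneg (f := fun x => -(f x * Real.exp (-K * (x - a))))
    (f' := fun x => -(f' x * Real.exp (-K * (x - a)) +
      f x * (-K * Real.exp (-K * (x - a))))) hab
    (hf.mul (by fun_prop)).neg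
    (fun x hx => ((hf' x hx).mul (hasDerivWithinAt_exp_mul_sub (-K) a x _)).neg)
    (fun x hx => by
      have h2 := Real.exp_pos (-K * (x - a))
      nlinarith [mul_nonneg (sub_nonneg.2 (h0 x hx)) h2.le])
  simp only [sub_self, mul_zero, Real.exp_zero, mul_one, neg_le_neg_iff] at h1
  calc f b = f b * Real.exp (-K * (b - a)) * Real.exp (K * (b - a)) := by
        rw [mul_assoc, ← Real.exp_add, neg_mul, neg_add_cancel, Real.exp_zero, mul_one]
    _ ≤ _ := by gcongr

/-- The integrating factor exp(K(x - a)) removes the linear term; as it is at most exp(K(b - a)), a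
linear function of x compensates the forcing ε. -/
theorem mul_exp_sub_le_of_le_right_deriv {f f' : ℝ → ℝ} {a b K ε : ℝ} (hab : a ≤ b) (hK : 0 ≤ K)
    (hε : 0 ≤ ε) (hf : ContinuousOn f (Icc a b))
    (hf' : ∀ x ∈ Ico a b, HasDerivWithinAt f (f' x) (Ici x) x)
    (h0 : ∀ x ∈ Ico a b, -K * f x - ε ≤ f' x) :
    f a * Real.exp (-K * (b - a)) - ε * (b - a) ≤ f b := by
  have h1 := le_of_right_deriv_nonneg
    (f := fun x => f x * Real.exp (K * (x - a)) + ε * Real.exp (K * (b - a)) * (x - a))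
    (f' := fun x => f' x * Real.exp (K * (x - a)) + f x * (K * Real.exp (K * (x - a))) +
      ε * Real.exp (K * (b - a)) * 1) hab
    ((hf.mul (by fun_prop)).add (by fun_prop))
    (fun x hx => ((hf' x hx).mul (hasDerivWithinAt_exp_mul_sub K a x _)).add
      (((hasDerivWithinAt_id x _).sub_const a).const_mul _))
    (fun x hx => by
      have h2 := Real.exp_pos (K * (x - a))
      have h3 : Real.exp (K * (x - a)) ≤ Real.exp (K * (b - a)) := by
        gcongr; exact hx.2.le
      nlinarith [mul_nonneg (sub_nonneg.2 (h0 x hx)) h2.le, mul_le_mul_of_nonneg_left h3 hε])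
  simp only [sub_self, mul_zero, Real.exp_zero, mul_one, add_zero] at h1
  have h4 := mul_le_mul_of_nonneg_right h1 (Real.exp_nonneg (-K * (b - a)))
  have h5 : Real.exp (K * (b - a)) * Real.exp (-K * (b - a)) = 1 := by
    rw [← Real.exp_add, neg_mul, add_neg_cancel, Real.exp_zero]
  have h6 : (f b * Real.exp (K * (b - a)) + ε * Real.exp (K * (b - a)) * (b - a)) *
      Real.exp (-K * (b - a)) = f b + ε * (b - a) := by
    linear_combination (f b + ε * (b - a)) * h5
  linarith

theorem HasDerivWithinAt.complex_norm_sq {u : ℝ → ℂ} {u' : ℂ} {s : Set ℝ} {r : ℝ}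
    (h : HasDerivWithinAt u u' s r) :
    HasDerivWithinAt (fun r => ‖u r‖ ^ 2) (2 * (conj (u r) * u').re) s r := by
  have := h.norm_sq
  rwa [Complex.inner, mul_comm u'] at this

theorem re_conj_mul_mul_self (p v : ℂ) : (conj v * (p * v)).re = p.re * ‖v‖ ^ 2 := by
  rw [← Complex.normSq_eq_norm_sq]
  simp [Complex.normSq_apply]
  ring

theorem abs_re_conj_mul_le (x y : ℂ) : |(conj x * y).re| ≤ ‖x‖ * ‖y‖ := by
  refine (Complex.abs_re_le_norm _).trans ?_
  rw [norm_mul, Complex.norm_conj]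

/-- `(u, v)` is a solution of `u' = -p u + v`, `v' = p v + q u` on `[a, ∞)`, in the sense of right
derivatives. -/
structure IsRightSolution (p q : ℝ → ℂ) (a : ℝ) (u v : ℝ → ℂ) : Prop where
  cont_u : ContinuousOn u (Ici a)
  cont_v : ContinuousOn v (Ici a)
  deriv_u : ∀ r, a ≤ r → HasDerivWithinAt u (-p r * u r + v r) (Ici r) r
  deriv_v : ∀ r, a ≤ r → HasDerivWithinAt v (p r * v r + q r * u r) (Ici r) r

theorem IsRightSolution.mono {p q : ℝ → ℂ} {a b : ℝ} {u v : ℝ → ℂ}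
    (h : IsRightSolution p q a u v) (hab : a ≤ b) : IsRightSolution p q b u v :=
  ⟨h.cont_u.mono (Ici_subset_Ici.2 hab), h.cont_v.mono (Ici_subset_Ici.2 hab),
    fun r hr => h.deriv_u r (hab.trans hr), fun r hr => h.deriv_v r (hab.trans hr)⟩

/-- The Wronskian of two solutions is constant. -/
theorem IsRightSolution.wronskian_eq {p q : ℝ → ℂ} {a b : ℝ} {u v u' v' : ℝ → ℂ}
    (h : IsRightSolution p q a u v) (h' : IsRightSolution p q a u' v') (hab : a ≤ b) :
    u b * v' b - v b * u' b = u a * v' a - v a * u' a := by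
  have hsub : Icc a b ⊆ Ici a := Icc_subset_Ici_self
  refine constant_of_has_deriv_right_zero (f := fun r => u r * v' r - v r * u' r) (a := a) (b := b)
    ?_ (fun r hr => ?_) b (right_mem_Icc.2 hab)
  · exact (((h.cont_u.mul h'.cont_v).sub (h.cont_v.mul h'.cont_u))).mono hsub
  · have := ((h.deriv_u r hr.1).mul (h'.deriv_v r hr.1)).sub
      ((h.deriv_v r hr.1).mul (h'.deriv_u r hr.1))
    refine this.congr_deriv ?_
    ring

/-- Im p only rotates phases, so the derivative of |u|² + |v|² sees Re p alone. The growth in ν will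
thus be governed by Re ν and be bounded along the imaginary axis. -/
theorem IsRightSolution.norm_sq_le {p q : ℝ → ℂ} {a b P Q : ℝ} {u v : ℝ → ℂ}
    (h : IsRightSolution p q a u v) (hab : a ≤ b) (hp : ∀ r ∈ Ico a b, |(p r).re| ≤ P)
    (hq : ∀ r ∈ Ico a b, ‖q r‖ ≤ Q) :
    ‖u b‖ ^ 2 + ‖v b‖ ^ 2 ≤ (‖u a‖ ^ 2 + ‖v a‖ ^ 2) * Real.exp (2 * (P + 1 + Q) * (b - a)) := by
  have hsub : Icc a b ⊆ Ici a := Icc_subset_Ici_self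
  refine le_mul_exp_of_right_deriv_le (f := fun r => ‖u r‖ ^ 2 + ‖v r‖ ^ 2) hab
    (((h.cont_u.norm.pow 2).add (h.cont_v.norm.pow 2)).mono hsub)
    (fun r hr => (h.deriv_u r hr.1).complex_norm_sq.add (h.deriv_v r hr.1).complex_norm_sq)
    (fun r hr => ?_)
  have h1 := re_conj_mul_mul_self (-p r) (u r)
  have h2 := re_conj_mul_mul_self (p r) (v r)
  have h3 := abs_re_conj_mul_le (u r) (v r)
  have h4 := abs_re_conj_mul_le (v r) (q r * u r)
  rw [norm_mul] at h4
  rw [mul_add, mul_add, add_re, add_re, h1, h2, neg_re]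
  have h5 := hp r hr
  rw [abs_le] at h3 h4 h5
  have h6 : ‖v r‖ * (‖q r‖ * ‖u r‖) ≤ Q * (‖u r‖ * ‖v r‖) := by
    have := mul_le_mul_of_nonneg_right (hq r hr) (mul_nonneg (norm_nonneg (u r)) (norm_nonneg (v r)))
    linarith
  have hQ : 0 ≤ Q := (norm_nonneg _).trans (hq r hr)
  have h7 := two_mul_le_add_sq ‖u r‖ ‖v r‖
  have h8 := mul_le_mul_of_nonneg_left h7 hQ
  have h9 := mul_le_mul_of_nonneg_right h5.2 (sq_nonneg ‖v r‖)
  have h10 := mul_le_mul_of_nonneg_right h5.1 (sq_nonneg ‖u r‖)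
  nlinarith [mul_nonneg hQ (sq_nonneg ‖u r‖), mul_nonneg hQ (sq_nonneg ‖v r‖),
    sq_nonneg ‖u r‖, sq_nonneg ‖v r‖]

theorem IsRightSolution.unique {p q : ℝ → ℂ} {a b P Q : ℝ} {u v u' v' : ℝ → ℂ}
    (h : IsRightSolution p q a u v) (h' : IsRightSolution p q a u' v') (hab : a ≤ b)
    (hp : ∀ r ∈ Ico a b, |(p r).re| ≤ P) (hq : ∀ r ∈ Ico a b, ‖q r‖ ≤ Q)
    (hu : u a = u' a) (hv : v a = v' a) : u b = u' b ∧ v b = v' b := by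
  have hd : IsRightSolution p q a (u - u') (v - v') :=
    ⟨h.cont_u.sub h'.cont_u, h.cont_v.sub h'.cont_v,
      fun r hr => ((h.deriv_u r hr).sub (h'.deriv_u r hr)).congr_deriv (by
        simp only [Pi.sub_apply]; ring),
      fun r hr => ((h.deriv_v r hr).sub (h'.deriv_v r hr)).congr_deriv (by
        simp only [Pi.sub_apply]; ring)⟩
  have h1 := hd.norm_sq_le hab hp hq
  simp only [Pi.sub_apply, hu, hv, sub_self, norm_zero, ne_eq, OfNat.ofNat_ne_zero,
    not_false_eq_true, zero_pow, add_zero, zero_mul] at h1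
  have h2 : ‖u b - u' b‖ ^ 2 = 0 := by nlinarith [sq_nonneg ‖u b - u' b‖, sq_nonneg ‖v b - v' b‖]
  have h3 : ‖v b - v' b‖ ^ 2 = 0 := by nlinarith [sq_nonneg ‖u b - u' b‖, sq_nonneg ‖v b - v' b‖]
  exact ⟨sub_eq_zero.1 (norm_eq_zero.1 (pow_eq_zero_iff two_ne_zero |>.1 h2)),
    sub_eq_zero.1 (norm_eq_zero.1 (pow_eq_zero_iff two_ne_zero |>.1 h3))⟩

/-- When `Re p` is large, `v` dominates `u`. -/
theorem IsRightSolution.mul_norm_sq_le {p q : ℝ → ℂ} {a b K Q : ℝ} {u v : ℝ → ℂ}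
    (h : IsRightSolution p q a u v) (hab : a ≤ b) (hK : 0 < K)
    (hp : ∀ r ∈ Ico a b, Q + K ^ 2 ≤ 2 * K * (p r).re)
    (hq : ∀ r ∈ Ico a b, ‖q r‖ ≤ Q) :
    ‖v a‖ ^ 2 - K ^ 2 * ‖u a‖ ^ 2 ≤ ‖v b‖ ^ 2 - K ^ 2 * ‖u b‖ ^ 2 := by
  have hsub : Icc a b ⊆ Ici a := Icc_subset_Ici_self
  refine le_of_right_deriv_nonneg (f := fun r => ‖v r‖ ^ 2 - K ^ 2 * ‖u r‖ ^ 2) hab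
    (((h.cont_v.norm.pow 2).sub ((h.cont_u.norm.pow 2).const_mul _)).mono hsub)
    (fun r hr => (h.deriv_v r hr.1).complex_norm_sq.sub
      ((h.deriv_u r hr.1).complex_norm_sq.const_mul (K ^ 2)))
    (fun r hr => ?_)
  have h1 := re_conj_mul_mul_self (-p r) (u r)
  have h2 := re_conj_mul_mul_self (p r) (v r)
  have h3 := abs_re_conj_mul_le (u r) (v r)
  have h4 := abs_re_conj_mul_le (v r) (q r * u r)
  rw [norm_mul] at h4
  rw [mul_add, mul_add, add_re, add_re, h1, h2, neg_re]
  have h5 := hp r hr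
  rw [abs_le] at h3 h4
  have h6 : ‖v r‖ * (‖q r‖ * ‖u r‖) ≤ Q * (‖u r‖ * ‖v r‖) := by
    have := mul_le_mul_of_nonneg_right (hq r hr) (mul_nonneg (norm_nonneg (u r)) (norm_nonneg (v r)))
    linarith
  have hQ : 0 ≤ Q := (norm_nonneg _).trans (hq r hr)
  have hpr : 0 ≤ (p r).re := by
    by_contra hneg
    push Not at hneg
    nlinarith [mul_neg_of_pos_of_neg hK hneg]
  -- The diagonal terms contribute 2 Re p (|v|² + K²|u|²), while the cross terms cost at most 2(Q +
  -- K²)|u||v|; this inequality lets the former absorb the latter.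
  have h7 : 2 * K * (‖u r‖ * ‖v r‖) ≤ ‖v r‖ ^ 2 + K ^ 2 * ‖u r‖ ^ 2 := by
    nlinarith [sq_nonneg (‖v r‖ - K * ‖u r‖)]
  have h8 := mul_le_mul_of_nonneg_left h7 hpr
  have h9 := mul_le_mul_of_nonneg_right h5 (mul_nonneg (norm_nonneg (u r)) (norm_nonneg (v r)))
  have h10 := mul_le_mul_of_nonneg_left h3.2 (sq_nonneg K)
  linarith [h4.1]

/-- Two weakly coupled functions with oscillating exponential behaviour: upper bound. -/
theorem weaklyCoupled_norm_sq_le {p p' q q' u v c : ℝ → ℂ} {a b P Q δ : ℝ} (hab : a ≤ b)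
    (hδ : 0 ≤ δ) (hcv : ContinuousOn v (Icc a b)) (hcc : ContinuousOn c (Icc a b))
    (hv : ∀ r ∈ Ico a b, HasDerivWithinAt v (p r * v r + q r * u r) (Ici r) r)
    (hc : ∀ r ∈ Ico a b, HasDerivWithinAt c (p' r * c r + q' r * u r) (Ici r) r)
    (hp : ∀ r ∈ Ico a b, |(p r).re| ≤ P) (hp' : ∀ r ∈ Ico a b, |(p' r).re| ≤ P)
    (hq : ∀ r ∈ Ico a b, ‖q r‖ ≤ Q) (hq' : ∀ r ∈ Ico a b, ‖q' r‖ ≤ Q)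
    (hu : ∀ r ∈ Ico a b, ‖u r‖ ≤ δ * (‖v r‖ + ‖c r‖)) :
    ‖v b‖ ^ 2 + ‖c b‖ ^ 2 ≤
      (‖v a‖ ^ 2 + ‖c a‖ ^ 2) * Real.exp ((2 * P + 4 * Q * δ) * (b - a)) := by
  refine le_mul_exp_of_right_deriv_le (f := fun r => ‖v r‖ ^ 2 + ‖c r‖ ^ 2) hab
    ((hcv.norm.pow 2).add (hcc.norm.pow 2))
    (fun r hr => (hv r hr).complex_norm_sq.add (hc r hr).complex_norm_sq) (fun r hr => ?_)
  have h1 := re_conj_mul_mul_self (p r) (v r)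
  have h2 := re_conj_mul_mul_self (p' r) (c r)
  have h3 := abs_re_conj_mul_le (v r) (q r * u r)
  have h4 := abs_re_conj_mul_le (c r) (q' r * u r)
  rw [norm_mul] at h3 h4
  rw [mul_add, mul_add, add_re, add_re, h1, h2]
  have hQ : 0 ≤ Q := (norm_nonneg _).trans (hq r hr)
  have h5 : ‖q r‖ * ‖u r‖ ≤ Q * (δ * (‖v r‖ + ‖c r‖)) := by
    gcongr; exacts [hq r hr, hu r hr]
  have h6 : ‖q' r‖ * ‖u r‖ ≤ Q * (δ * (‖v r‖ + ‖c r‖)) := by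
    gcongr; exacts [hq' r hr, hu r hr]
  have h7 := mul_le_mul_of_nonneg_left h5 (norm_nonneg (v r))
  have h8 := mul_le_mul_of_nonneg_left h6 (norm_nonneg (c r))
  have h9 := mul_le_mul_of_nonneg_right (abs_le.1 (hp r hr)).2 (sq_nonneg ‖v r‖)
  have h10 := mul_le_mul_of_nonneg_right (abs_le.1 (hp' r hr)).2 (sq_nonneg ‖c r‖)
  have h11 : (‖v r‖ + ‖c r‖) ^ 2 ≤ 2 * (‖v r‖ ^ 2 + ‖c r‖ ^ 2) := by
    nlinarith [sq_nonneg (‖v r‖ - ‖c r‖)]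
  have h12 := mul_le_mul_of_nonneg_left h11 (mul_nonneg hQ hδ)
  nlinarith [(abs_le.1 h3).2, (abs_le.1 h4).2]

/-- Two weakly coupled functions with oscillating exponential behaviour: lower bound. -/
theorem weaklyCoupled_le_norm_sq {p p' q q' u v c : ℝ → ℂ} {a b P Q δ : ℝ} (hab : a ≤ b)
    (hP : 0 ≤ P) (hQ : 0 ≤ Q)
    (hδ : 0 ≤ δ) (hcv : ContinuousOn v (Icc a b)) (hcc : ContinuousOn c (Icc a b))
    (hv : ∀ r ∈ Ico a b, HasDerivWithinAt v (p r * v r + q r * u r) (Ici r) r)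
    (hc : ∀ r ∈ Ico a b, HasDerivWithinAt c (p' r * c r + q' r * u r) (Ici r) r)
    (hp : ∀ r ∈ Ico a b, |(p r).re| ≤ P) (hp' : ∀ r ∈ Ico a b, |(p' r).re| ≤ P)
    (hq : ∀ r ∈ Ico a b, ‖q r‖ ≤ Q) (hq' : ∀ r ∈ Ico a b, ‖q' r‖ ≤ Q)
    (hu : ∀ r ∈ Ico a b, ‖u r‖ ≤ δ * (‖v r‖ + ‖c r‖)) :
    ‖v a‖ ^ 2 * Real.exp (-(2 * P) * (b - a)) - 4 * Q * δ *
      ((‖v a‖ ^ 2 + ‖c a‖ ^ 2) * Real.exp ((2 * P + 4 * Q * δ) * (b - a))) * (b - a) ≤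
        ‖v b‖ ^ 2 := by
  refine mul_exp_sub_le_of_le_right_deriv (f := fun r => ‖v r‖ ^ 2) hab (by positivity)
    (by positivity) (hcv.norm.pow 2) (fun r hr => (hv r hr).complex_norm_sq) (fun r hr => ?_)
  have hM : ‖v r‖ ^ 2 + ‖c r‖ ^ 2 ≤
      (‖v a‖ ^ 2 + ‖c a‖ ^ 2) * Real.exp ((2 * P + 4 * Q * δ) * (b - a)) := by
    have hsub : Ico a r ⊆ Ico a b := Ico_subset_Ico_right hr.2.le
    have hsub' : Icc a r ⊆ Icc a b := Icc_subset_Icc_right hr.2.le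
    refine (weaklyCoupled_norm_sq_le hr.1 hδ (hcv.mono hsub') (hcc.mono hsub')
      (fun x hx => hv x (hsub hx)) (fun x hx => hc x (hsub hx)) (fun x hx => hp x (hsub hx))
      (fun x hx => hp' x (hsub hx)) (fun x hx => hq x (hsub hx)) (fun x hx => hq' x (hsub hx))
      (fun x hx => hu x (hsub hx))).trans ?_
    gcongr
    exact hr.2.le
  have h1 := re_conj_mul_mul_self (p r) (v r)
  have h3 := abs_re_conj_mul_le (v r) (q r * u r)
  rw [norm_mul] at h3
  rw [mul_add, add_re, h1]
  have h5 : ‖q r‖ * ‖u r‖ ≤ Q * (δ * (‖v r‖ + ‖c r‖)) := by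
    gcongr; exacts [hq r hr, hu r hr]
  have h7 := mul_le_mul_of_nonneg_left h5 (norm_nonneg (v r))
  have h9 := mul_le_mul_of_nonneg_right (abs_le.1 (hp r hr)).1 (sq_nonneg ‖v r‖)
  have h11 : ‖v r‖ * (‖v r‖ + ‖c r‖) ≤ 2 * (‖v r‖ ^ 2 + ‖c r‖ ^ 2) := by
    nlinarith [sq_nonneg (‖v r‖ - ‖c r‖), sq_nonneg ‖v r‖, sq_nonneg ‖c r‖]
  have h12 := mul_le_mul_of_nonneg_left (h11.trans
    (mul_le_mul_of_nonneg_left hM zero_le_two)) (mul_nonneg hQ hδ)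
  nlinarith [(abs_le.1 h3).1]

end Energy

/-! ### The radial equation as a first-order system. -/

section RadialField

open Complex Filter Topology Set MeasureTheory

/-- The radial data of a couple of the class `𝒞`: flux function `γ`, magnetic profile `β`,
electric profile `V` with right limits `Vp`, constant beyond `R`. -/
structure RadialField (a R C : ℝ) (γ β V Vp : ℝ → ℝ) : Prop where
  a_pos : 0 < a
  lt : a < R
  hasDerivAt_gamma : ∀ r, HasDerivAt γ (β r * r) r
  gamma_le : ∀ r, a ≤ r → |γ r| ≤ C
  beta_le : ∀ r, |β r| ≤ C
  V_le : ∀ r, |V r| ≤ C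
  Vp_le : ∀ r, |Vp r| ≤ C
  measurable_V : AEStronglyMeasurable V volume
  tendsto_V : ∀ r, Tendsto V (𝓝[>] r) (𝓝 (Vp r))
  Vp_zero : ∀ r, R ≤ r → Vp r = 0
  beta_zero : ∀ r, R ≤ r → β r = 0
  gamma_eq : ∀ r, R ≤ r → γ r = γ R

/-- The radial potential in terms of the flux function. -/
noncomputable def fluxPot (γ V : ℝ → ℝ) (ν : ℂ) (r : ℝ) : ℂ :=
  ((ν - γ r) ^ 2 - 1 / 4) / (r : ℂ) ^ 2 + (V r : ℂ)

/-- The diagonal coefficient of the first-order system. -/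
noncomputable def diagCoeff (γ : ℝ → ℝ) (ν : ℂ) (r : ℝ) : ℂ := (ν - γ r - 1 / 2) / r

/-- The off-diagonal coefficient of the first-order system. -/
noncomputable def offDiagCoeff (β Vp : ℝ → ℝ) (r : ℝ) : ℂ := Vp r - 1 - β r

/-- `u` is a solution on `[a, ∞)` with derivative `w`. -/
structure IsSolutionPair (Q : ℝ → ℂ) (a : ℝ) (u w : ℝ → ℂ) : Prop where
  deriv : ∀ r, a ≤ r → HasDerivWithinAt u (w r) (Ici a) r
  integral : ∀ r, a ≤ r → IntervalIntegrable (fun s => (Q s - 1) * u s) volume a r ∧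
    w r = w a + ∫ s in a..r, (Q s - 1) * u s

theorem isRadialSolution_iff {Q : ℝ → ℂ} {a : ℝ} {u : ℝ → ℂ} :
    IsRadialSolution Q a u ↔ ∃ w, IsSolutionPair Q a u w :=
  ⟨fun ⟨w, h1, h2⟩ => ⟨w, h1, h2⟩, fun ⟨w, h1, h2⟩ => ⟨w, h1, h2⟩⟩

variable {a R C : ℝ} {γ β V Vp : ℝ → ℝ}

theorem RadialField.nonneg (F : RadialField a R C γ β V Vp) : 0 ≤ C :=
  (abs_nonneg _).trans (F.beta_le 0)

theorem RadialField.continuous_gamma (F : RadialField a R C γ β V Vp) : Continuous γ :=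
  continuous_iff_continuousAt.2 fun r => (F.hasDerivAt_gamma r).continuousAt

theorem RadialField.abs_re_diagCoeff_le (F : RadialField a R C γ β V Vp) (ν : ℂ) {r : ℝ}
    (hr : a ≤ r) : |(diagCoeff γ ν r).re| ≤ (|ν.re| + C + 1 / 2) / a := by
  have ha := F.a_pos
  have hre : (diagCoeff γ ν r).re = (ν.re - γ r - 1 / 2) / r := by
    rw [diagCoeff, div_ofReal_re]
    simp
  rw [hre, abs_div, abs_of_pos (ha.trans_le hr)]
  have h1 : |ν.re - γ r - 1 / 2| ≤ |ν.re| + C + 1 / 2 := by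
    have h2 := abs_sub (ν.re - γ r) (1 / 2)
    have h3 := abs_sub ν.re (γ r)
    have h4 := F.gamma_le r hr
    rw [abs_of_pos (by norm_num : (0 : ℝ) < 1 / 2)] at h2
    linarith
  have hC := F.nonneg
  gcongr

theorem RadialField.norm_offDiagCoeff_le (F : RadialField a R C γ β V Vp) (r : ℝ) :
    ‖offDiagCoeff β Vp r‖ ≤ 2 * C + 1 := by
  have h1 : offDiagCoeff β Vp r = ((Vp r - 1 - β r : ℝ) : ℂ) := by
    rw [offDiagCoeff]; push_cast; ring
  rw [h1, norm_real, Real.norm_eq_abs]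
  have h2 := abs_sub (Vp r - 1) (β r)
  have h3 := abs_sub (Vp r) 1
  have h4 := F.Vp_le r
  have h5 := F.beta_le r
  rw [abs_one] at h3
  linarith

theorem RadialField.hasDerivAt_diagCoeff (F : RadialField a R C γ β V Vp) (ν : ℂ) {r : ℝ}
    (hr : a ≤ r) :
    HasDerivAt (diagCoeff γ ν) (-(β r : ℂ) - (ν - γ r - 1 / 2) / (r : ℂ) ^ 2) r := by
  have hr0 : (r : ℂ) ≠ 0 := by exact_mod_cast (F.a_pos.trans_le hr).ne'
  have h1 : HasDerivAt (fun r : ℝ => ν - (γ r : ℂ) - 1 / 2) (-((β r * r : ℝ) : ℂ)) r :=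
    ((F.hasDerivAt_gamma r).ofReal_comp.const_sub ν).sub_const _
  have h2 : HasDerivAt (fun r : ℝ => (r : ℂ)) 1 r := by
    simpa using (hasDerivAt_id r).ofReal_comp
  refine (h1.div h2 hr0).congr_deriv ?_
  push_cast
  field_simp

/-- A solution of the radial equation gives a solution of the first-order system. -/
theorem RadialField.isRightSolution (F : RadialField a R C γ β V Vp) {ν : ℂ} {Q u w : ℝ → ℂ}
    (hQ : ∀ r, a ≤ r → Q r = fluxPot γ V ν r) (h : IsSolutionPair Q a u w) :
    IsRightSolution (diagCoeff γ ν) (offDiagCoeff β Vp) a u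
      (fun r => w r + diagCoeff γ ν r * u r) := by
  have ha := F.a_pos
  have hcu : ContinuousOn u (Ici a) := fun r hr => (h.deriv r hr).continuousWithinAt
  have hcp : ContinuousOn (diagCoeff γ ν) (Ici a) := fun r hr =>
    (F.hasDerivAt_diagCoeff ν hr).continuousAt.continuousWithinAt
  have hcw : ContinuousOn w (Ici a) := by
    intro r hr
    have hr' : a ≤ r := hr
    have h1 : ContinuousOn (fun x => w a + ∫ s in a..x, (Q s - 1) * u s) (uIcc a (r + 1)) :=
      continuousOn_const.add (intervalIntegral.continuousOn_primitive_interval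
        (((intervalIntegrable_iff_integrableOn_Icc_of_le (by linarith)).1
          (h.integral (r + 1) (by linarith)).1).mono_set (by rw [uIcc_of_le (by linarith)])))
    rw [uIcc_of_le (by linarith)] at h1
    have h2 : ContinuousWithinAt w (Icc a (r + 1)) r :=
      ((h1.congr fun x hx => (h.integral x hx.1).2) r ⟨hr', by linarith⟩)
    refine h2.mono_of_mem_nhdsWithin ?_
    exact Filter.mem_of_superset (inter_mem_nhdsWithin _ (Iio_mem_nhds (by linarith : r < r + 1)))
      fun x hx => ⟨hx.1, le_of_lt hx.2⟩
  have hdu : ∀ r, a ≤ r → HasDerivWithinAt u (w r) (Ici r) r := fun r hr =>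
    (h.deriv r hr).mono (Ici_subset_Ici.2 hr)
  -- The right derivative of the integral sees only the right limit of V, hence `Vp` in place of V.
  have hdw : ∀ r, a ≤ r → HasDerivWithinAt w
      ((((ν - γ r) ^ 2 - 1 / 4) / (r : ℂ) ^ 2 + (Vp r : ℂ) - 1) * u r) (Ici r) r := by
    intro r hr
    have hr0 : (r : ℂ) ≠ 0 := by exact_mod_cast (ha.trans_le hr).ne'
    have hIoi : Ioi r ⊆ Ici a := fun x hx => hr.trans (le_of_lt hx)
    have htend : Tendsto (fun s => (Q s - 1) * u s) (𝓝[>] r)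
        (𝓝 ((((ν - γ r) ^ 2 - 1 / 4) / (r : ℂ) ^ 2 + (Vp r : ℂ) - 1) * u r)) := by
      have h1 : Tendsto u (𝓝[>] r) (𝓝 (u r)) := (hcu r hr).mono hIoi
      have h2 : ContinuousAt (fun s : ℝ => ((ν - γ s) ^ 2 - 1 / 4) / (s : ℂ) ^ 2) r := by
        have := F.continuous_gamma
        refine ContinuousAt.div (by fun_prop) (by fun_prop) (pow_ne_zero 2 hr0)
      have h3 := (continuous_ofReal.tendsto (Vp r)).comp (F.tendsto_V r)
      have h4 := (((h2.tendsto.mono_left nhdsWithin_le_nhds).add h3).sub_const 1).mul h1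
      refine h4.congr' ?_
      filter_upwards [self_mem_nhdsWithin] with s hs
      rw [hQ s (hIoi hs)]
      rfl
    have hmeas : StronglyMeasurableAtFilter (fun s => (Q s - 1) * u s) (𝓝[>] r) volume := by
      refine ⟨Ioc r (r + 1), Ioc_mem_nhdsGT (by linarith), ?_⟩
      exact ((h.integral (r + 1) (by linarith)).1.1.aestronglyMeasurable).mono_set
        (Ioc_subset_Ioc_left hr)
    have h1 := intervalIntegral.integral_hasDerivWithinAt_of_tendsto_ae_right
      (s := Ici r) (t := Ioi r) (h.integral r hr).1 hmeas (htend.mono_left inf_le_left)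
    refine (h1.const_add (w a)).congr (fun x hx => ?_) (h.integral r hr).2
    exact (h.integral x (hr.trans hx)).2
  refine ⟨hcu, hcw.add (hcp.mul hcu), fun r hr => (hdu r hr).congr_deriv (by ring), fun r hr => ?_⟩
  -- With n = ν - γ, the identity n² - 1/4 = (n - 1/2)² + (n - 1/2) cancels every 1/r² term and
  -- leaves a coupling free of ν.
  refine ((hdw r hr).add ((F.hasDerivAt_diagCoeff ν hr).hasDerivWithinAt.mul
    (hdu r hr))).congr_deriv ?_
  have hr0 : (r : ℂ) ≠ 0 := by exact_mod_cast (ha.trans_le hr).ne'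
  rw [diagCoeff, offDiagCoeff]
  field_simp
  ring

/-- Solutions of the radial equation with given initial data, holomorphic in `ν`. -/
theorem RadialField.exists_isSolutionPair (F : RadialField a R C γ β V Vp) (c₁ c₂ : ℂ) :
    ∃ u w : ℂ → ℝ → ℂ, (∀ ν, IsSolutionPair (fluxPot γ V ν) a (u ν) (w ν) ∧ u ν a = c₁ ∧
      w ν a = c₂) ∧
      ∀ r, a ≤ r → Differentiable ℂ (fun ν => u ν r) ∧ Differentiable ℂ (fun ν => w ν r) := by
  have ha := F.a_pos
  have hC := F.nonneg
  have hg := F.continuous_gamma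
  -- Cutting off at a keeps the three coefficients of the expansion in powers of ν bounded on the
  -- whole line, without changing them on [a, ∞).
  set t : ℝ → ℝ := fun s => max s a with ht
  have htc : Continuous t := by fun_prop
  have hta : ∀ s, a ≤ t s := fun s => le_max_right _ _
  have htpos : ∀ s, 0 < t s := fun s => ha.trans_le (hta s)
  have hinv : ∀ s, ((t s) ^ 2)⁻¹ ≤ (a ^ 2)⁻¹ := fun s => by
    have := hta s
    gcongr
  set q₀ : ℝ → ℂ := fun s => (((γ (t s) ^ 2 - 1 / 4) * (t s ^ 2)⁻¹ : ℝ) : ℂ) +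
    (V s : ℂ) - 1 with hq₀
  set q₁ : ℝ → ℂ := fun s => ((-2 * γ (t s) * (t s ^ 2)⁻¹ : ℝ) : ℂ) with hq₁
  set q₂ : ℝ → ℂ := fun s => (((t s ^ 2)⁻¹ : ℝ) : ℂ) with hq₂
  have htinv : Continuous fun s => (t s ^ 2)⁻¹ :=
    (htc.pow 2).inv₀ fun s => (pow_pos (htpos s) 2).ne'
  have m₀ : AEStronglyMeasurable q₀ volume := by
    refine (AEStronglyMeasurable.add ?_ ?_).sub aestronglyMeasurable_const
    · exact Continuous.aestronglyMeasurable (by fun_prop)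
    · exact continuous_ofReal.comp_aestronglyMeasurable F.measurable_V
  have m₁ : AEStronglyMeasurable q₁ volume := Continuous.aestronglyMeasurable (by fun_prop)
  have m₂ : AEStronglyMeasurable q₂ volume := Continuous.aestronglyMeasurable (by fun_prop)
  set D : ℝ := (a ^ 2)⁻¹ with hD
  have hD0 : 0 ≤ D := by positivity
  set K : ℝ := (C ^ 2 + 2 * C + 1) * D + C + 1 with hK
  have b₀ : ∀ s, ‖q₀ s‖ ≤ K := by
    intro s
    have h1 : ‖(((γ (t s) ^ 2 - 1 / 4) * (t s ^ 2)⁻¹ : ℝ) : ℂ)‖ ≤ (C ^ 2 + 1) * D := by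
      rw [norm_real, norm_mul, Real.norm_of_nonneg (inv_nonneg.2 (sq_nonneg _))]
      have h2 : ‖γ (t s) ^ 2 - 1 / 4‖ ≤ C ^ 2 + 1 := by
        rw [Real.norm_eq_abs, abs_le]
        have h3 : γ (t s) ^ 2 ≤ C ^ 2 := sq_le_sq.2 (by
          rw [abs_of_nonneg hC]; exact F.gamma_le _ (hta s))
        constructor <;> nlinarith [sq_nonneg (γ (t s))]
      exact mul_le_mul h2 (hinv s) (inv_nonneg.2 (sq_nonneg _)) (by positivity)
    have h2 : ‖(V s : ℂ)‖ ≤ C := by rw [norm_real]; exact F.V_le s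
    calc ‖q₀ s‖ ≤ (C ^ 2 + 1) * D + C + 1 := by
          refine (norm_sub_le _ _).trans ?_
          rw [norm_one]
          gcongr
          exact (norm_add_le _ _).trans (add_le_add h1 h2)
      _ ≤ K := by rw [hK]; nlinarith
  have b₁ : ∀ s, ‖q₁ s‖ ≤ K := by
    intro s
    rw [hq₁, norm_real, norm_mul, Real.norm_of_nonneg (inv_nonneg.2 (sq_nonneg _)), norm_mul]
    calc ‖(-2 : ℝ)‖ * ‖γ (t s)‖ * (t s ^ 2)⁻¹ ≤ 2 * C * D := by
          have h1 := F.gamma_le _ (hta s)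
          have h2 := hinv s
          rw [norm_neg, Real.norm_ofNat]
          exact mul_le_mul (mul_le_mul_of_nonneg_left h1 (by norm_num)) h2
            (inv_nonneg.2 (sq_nonneg _)) (by positivity)
      _ ≤ K := by rw [hK]; nlinarith [mul_nonneg (sq_nonneg C) hD0]
  have b₂ : ∀ s, ‖q₂ s‖ ≤ K := by
    intro s
    rw [hq₂, norm_real, Real.norm_of_nonneg (inv_nonneg.2 (sq_nonneg _))]
    refine (hinv s).trans ?_
    rw [hK]
    nlinarith [mul_nonneg (sq_nonneg C) hD0, mul_nonneg hC hD0]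
  obtain ⟨u, w, hs, hd⟩ := exists_isIntegralSolution m₀ m₁ m₂ b₀ b₁ b₂ a c₁ c₂
  refine ⟨u, w, fun ν => ⟨⟨fun r hr => ?_, fun r hr => ?_⟩, ?_, ?_⟩, hd⟩
  · have hcw := (hs ν).cont_w
    have h1 : HasDerivWithinAt (fun x => ∫ s in a..x, w ν (max s a)) (w ν r) (Ici a) r := by
      have hc : Continuous fun s => w ν (max s a) :=
        hcw.comp_continuous (by fun_prop) fun s => mem_Ici.2 (le_max_right _ _)
      have := (hc.integral_hasStrictDerivAt a r).hasDerivAt.hasDerivWithinAt (s := Ici a)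
      simpa only [max_eq_left hr] using this
    have h2 : ∀ x, a ≤ x → u ν x = c₁ + ∫ s in a..x, w ν (max s a) := by
      intro x hx
      rw [(hs ν).eq_u x hx]
      congr 1
      refine intervalIntegral.integral_congr fun s hs => ?_
      rw [uIcc_of_le hx] at hs
      simp only [max_eq_left hs.1]
    exact (h1.const_add c₁).congr (fun x hx => h2 x hx) (h2 r hr)
  · have hcu : ContinuousOn (u ν) (uIcc a r) :=
      (hs ν).cont_u.mono (by rw [uIcc_of_le hr]; exact Icc_subset_Ici_self)
    have hi : IntervalIntegrable (fun s => (q₀ s + ν * q₁ s + ν ^ 2 * q₂ s) * u ν s) volume a r :=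
      (((intervalIntegrable_of_bounded m₀ b₀ a r).add
        ((intervalIntegrable_of_bounded m₁ b₁ a r).const_mul ν)).add
        ((intervalIntegrable_of_bounded m₂ b₂ a r).const_mul _)).mul_continuousOn hcu
    have heq : ∀ s, a ≤ s → (q₀ s + ν * q₁ s + ν ^ 2 * q₂ s) * u ν s =
        (fluxPot γ V ν s - 1) * u ν s := by
      intro s hs
      have hts : t s = s := max_eq_left hs
      have hs0 : (s : ℂ) ≠ 0 := by exact_mod_cast (ha.trans_le hs).ne'
      simp only [hq₀, hq₁, hq₂, hts, fluxPot]
      push_cast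
      field_simp
      ring
    refine ⟨hi.congr fun s hs => ?_, ?_⟩
    · rw [uIoc_of_le hr] at hs
      exact heq s hs.1.le
    · have h0 : w ν a = c₂ := by simpa using (hs ν).eq_w a le_rfl
      rw [(hs ν).eq_w r hr, h0]
      congr 1
      refine intervalIntegral.integral_congr fun s hs => ?_
      rw [uIcc_of_le hr] at hs
      exact heq s hs.1
  · simpa using (hs ν).eq_u a le_rfl
  · simpa using (hs ν).eq_w a le_rfl

end RadialField

/-! ### The solution vanishing at the inner radius: growth, dominance, imaginary axis. -/

section RegularSolution

open Complex Filter Topology Set MeasureTheory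

variable {a R C : ℝ} {γ β V Vp : ℝ → ℝ}

/-- The solutions that vanish at `a`, holomorphic in `ν`. -/
theorem RadialField.exists_regular (F : RadialField a R C γ β V Vp) :
    ∃ φ ψ : ℂ → ℝ → ℂ, (∀ ν, IsRightSolution (diagCoeff γ ν) (offDiagCoeff β Vp) a (φ ν) (ψ ν) ∧
      φ ν a = 0 ∧ ψ ν a = 1) ∧ Differentiable ℂ (fun ν => φ ν R) ∧
      Differentiable ℂ (fun ν => ψ ν R) := by
  obtain ⟨u, w, hs, hd⟩ := F.exists_isSolutionPair 0 1
  have hd' := hd R F.lt.le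
  refine ⟨u, fun ν r => w ν r + diagCoeff γ ν r * u ν r, fun ν => ⟨?_, (hs ν).2.1, ?_⟩, hd'.1, ?_⟩
  · exact F.isRightSolution (fun _ _ => rfl) (hs ν).1
  · simp only
    rw [(hs ν).2.1, (hs ν).2.2, mul_zero, add_zero]
  · refine hd'.2.add (Differentiable.mul ?_ hd'.1)
    unfold diagCoeff
    fun_prop

theorem RadialField.norm_le_exp (F : RadialField a R C γ β V Vp) {ν : ℂ} {u v : ℝ → ℂ}
    (h : IsRightSolution (diagCoeff γ ν) (offDiagCoeff β Vp) a u v) (hu : u a = 0) (hv : v a = 1) :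
    ‖u R‖ ≤ Real.exp (((|ν.re| + C + 1 / 2) / a + 1 + (2 * C + 1)) * (R - a)) ∧
      ‖v R‖ ≤ Real.exp (((|ν.re| + C + 1 / 2) / a + 1 + (2 * C + 1)) * (R - a)) := by
  have h1 := h.norm_sq_le F.lt.le (fun r hr => F.abs_re_diagCoeff_le ν hr.1)
    (fun r _ => F.norm_offDiagCoeff_le r)
  set x := ((|ν.re| + C + 1 / 2) / a + 1 + (2 * C + 1)) * (R - a) with hx
  have h2 : Real.exp (2 * ((|ν.re| + C + 1 / 2) / a + 1 + (2 * C + 1)) * (R - a)) =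
      Real.exp x ^ 2 := by
    rw [← Real.exp_nat_mul, hx]
    congr 1
    push_cast
    ring
  rw [hu, hv, norm_zero, norm_one, h2] at h1
  constructor
  · refine abs_le_of_sq_le_sq' ?_ (Real.exp_nonneg _) |>.2
    nlinarith [sq_nonneg ‖v R‖]
  · refine abs_le_of_sq_le_sq' ?_ (Real.exp_nonneg _) |>.2
    nlinarith [sq_nonneg ‖u R‖]

/-- |v|² - K²|u|² starts at 1 and is nondecreasing as soon as Re p is large on [a, R). The threshold
N is read off from Re p = (Re ν - γ - 1/2)/r with r < R and γ ≤ C. -/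
theorem RadialField.eventually_mul_norm_le (F : RadialField a R C γ β V Vp) {K : ℝ} (hK : 0 < K) :
    ∃ N : ℝ, ∀ ν : ℂ, N ≤ ν.re → ∀ u v : ℝ → ℂ,
      IsRightSolution (diagCoeff γ ν) (offDiagCoeff β Vp) a u v → u a = 0 → v a = 1 →
        K * ‖u R‖ ≤ ‖v R‖ ∧ v R ≠ 0 := by
  have ha := F.a_pos
  have hR : 0 < R := ha.trans F.lt
  refine ⟨(2 * C + 1 + K ^ 2) / (2 * K) * R + C + 1 / 2, fun ν hν u v h hu hv => ?_⟩
  have hC := F.nonneg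
  have h1 := h.mul_norm_sq_le (Q := 2 * C + 1) F.lt.le hK (fun r hr => ?_)
    (fun r _ => F.norm_offDiagCoeff_le r)
  · rw [hu, hv] at h1
    simp only [norm_one, one_pow, norm_zero, ne_eq, OfNat.ofNat_ne_zero, not_false_eq_true,
      zero_pow, mul_zero, sub_zero] at h1
    constructor
    · refine abs_le_of_sq_le_sq' ?_ (norm_nonneg _) |>.2
      nlinarith
    · intro h0
      rw [h0, norm_zero] at h1
      nlinarith [sq_nonneg (K * ‖u R‖)]
  · have hr0 : 0 < r := ha.trans_le hr.1
    have hre : (diagCoeff γ ν r).re = (ν.re - γ r - 1 / 2) / r := by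
      rw [diagCoeff, div_ofReal_re]
      simp
    have h2 : (2 * C + 1 + K ^ 2) / (2 * K) ≤ (diagCoeff γ ν r).re := by
      rw [hre, le_div_iff₀ hr0]
      have h3 : (2 * C + 1 + K ^ 2) / (2 * K) * r ≤ (2 * C + 1 + K ^ 2) / (2 * K) * R := by
        gcongr; exact hr.2.le
      have h4 := (abs_le.1 (F.gamma_le r hr.1)).2
      linarith
    rw [div_le_iff₀ (by positivity)] at h2
    linarith

/-- Behaviour of the regular solution along the imaginary axis: both WKB amplitudes stay bounded
above and below. -/
theorem RadialField.exists_bounds_imaginary (F : RadialField a R C γ β V Vp) :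
    ∃ κ B Y : ℝ, 0 < κ ∧ 1 ≤ Y ∧ ∀ y : ℝ, Y ≤ y → ∀ u v : ℝ → ℂ,
      IsRightSolution (diagCoeff γ (y * I)) (offDiagCoeff β Vp) a u v → u a = 0 → v a = 1 →
        κ ≤ ‖v R‖ ∧ ‖v R‖ ≤ B ∧ κ ≤ ‖v R - 2 * (y * I - γ R) / R * u R‖ ∧
          ‖v R - 2 * (y * I - γ R) / R * u R‖ ≤ B := by
  have ha := F.a_pos
  have hR : 0 < R := ha.trans F.lt
  have hC := F.nonneg
  have hRa : 0 < R - a := sub_pos.2 F.lt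
  set P : ℝ := (C + 1 / 2) / a with hP
  have hP0 : 0 ≤ P := by positivity
  set Q : ℝ := 2 * C + 1 with hQ
  have hQ0 : 0 ≤ Q := by positivity
  set M : ℝ := 2 * Real.exp ((2 * P + 4 * Q) * (R - a)) with hM
  have hM0 : 0 < M := by positivity
  set e : ℝ := Real.exp (-(2 * P) * (R - a)) with he
  have he0 : 0 < e := Real.exp_pos _
  -- Chosen so that δ = R/(2y) ≤ 1 and the coupling can consume at most half of the lower bound e.
  set Y : ℝ := 1 + R + 4 * Q * R * M * (R - a) / e with hY
  have hYpos : 0 ≤ 4 * Q * R * M * (R - a) / e := by positivity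
  refine ⟨Real.sqrt (e / 2), Real.sqrt M, Y, by positivity, by linarith, fun y hy u v h hu hv => ?_⟩
  have hy0 : 0 < y := by linarith
  set n : ℝ → ℂ := fun r => y * I - γ r with hn
  have hnorm : ∀ r, y ≤ ‖n r‖ := by
    intro r
    refine (le_abs_self y).trans ((le_of_eq ?_).trans (Complex.abs_im_le_norm (n r)))
    simp [hn]
  have hn0 : ∀ r, n r ≠ 0 := fun r => norm_pos_iff.1 (hy0.trans_le (hnorm r))
  -- The second WKB amplitude, whose diagonal coefficient is -(n + 1/2)/r. Since u = r (v - c)/(2n)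
  -- is O(1/y) relative to v and c, the two amplitudes nearly decouple, and their diagonal
  -- coefficients have bounded real part.
  set c : ℝ → ℂ := fun r => v r - 2 * n r / r * u r with hc
  set δ : ℝ := R / (2 * y) with hδ
  have hδ0 : 0 ≤ δ := by positivity
  have hδ1 : δ ≤ 1 := by rw [hδ, div_le_one (by positivity)]; linarith
  have hsub : Icc a R ⊆ Ici a := Icc_subset_Ici_self
  have hr0 : ∀ r ∈ Ico a R, (r : ℂ) ≠ 0 := fun r hr => by
    exact_mod_cast (ha.trans_le hr.1).ne'
  have hcn : Continuous n := by
    have := F.continuous_gamma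
    fun_prop
  have hcc : ContinuousOn c (Icc a R) := by
    refine (h.cont_v.mono hsub).sub (ContinuousOn.mul ?_ (h.cont_u.mono hsub))
    refine ContinuousOn.div (by fun_prop) (by fun_prop) fun r hr => ?_
    exact_mod_cast (ha.trans_le hr.1).ne'
  have hcv : ContinuousOn v (Icc a R) := h.cont_v.mono hsub
  have hdc : ∀ r ∈ Ico a R, HasDerivWithinAt c
      (-((n r + 1 / 2) / r) * c r + ((Vp r : ℂ) - 1 + β r) * u r) (Ici r) r := by
    intro r hr
    have hr' := hr0 r hr
    have h1 : HasDerivAt (fun r : ℝ => 2 * n r) (2 * (-((β r * r : ℝ) : ℂ))) r :=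
      ((F.hasDerivAt_gamma r).ofReal_comp.const_sub (y * I)).const_mul 2
    have h2 : HasDerivAt (fun r : ℝ => (r : ℂ)) 1 r := by
      simpa using (hasDerivAt_id r).ofReal_comp
    have h3 := ((h1.div h2 hr').hasDerivWithinAt (s := Ici r)).mul (h.deriv_u r hr.1)
    refine ((h.deriv_v r hr.1).sub h3).congr_deriv ?_
    have hd : diagCoeff γ (y * I) r = (n r - 1 / 2) / r := rfl
    rw [hd, offDiagCoeff]
    simp only [hc, Pi.div_apply]
    push_cast
    field_simp
    ring
  have hp : ∀ r ∈ Ico a R, |(diagCoeff γ (y * I) r).re| ≤ P := fun r hr => by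
    have := F.abs_re_diagCoeff_le (y * I) hr.1
    simpa [hP] using this
  have hp' : ∀ r ∈ Ico a R, |(-((n r + 1 / 2) / r)).re| ≤ P := fun r hr => by
    have hre : (-((n r + 1 / 2) / r)).re = (γ r - 1 / 2) / r := by
      rw [neg_re, div_ofReal_re]
      simp [hn]
      ring
    rw [hre, abs_div, abs_of_pos (ha.trans_le hr.1), hP]
    have h2 := abs_sub (γ r) (1 / 2)
    have h4 := F.gamma_le r hr.1
    have h5 := hr.1
    rw [abs_of_pos (by norm_num : (0 : ℝ) < 1 / 2)] at h2
    gcongr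
    linarith
  have hq : ∀ r ∈ Ico a R, ‖offDiagCoeff β Vp r‖ ≤ Q := fun r _ => F.norm_offDiagCoeff_le r
  have hq' : ∀ r ∈ Ico a R, ‖(Vp r : ℂ) - 1 + β r‖ ≤ Q := fun r _ => by
    have h1 : (Vp r : ℂ) - 1 + β r = ((Vp r - 1 + β r : ℝ) : ℂ) := by push_cast; ring
    rw [h1, norm_real, Real.norm_eq_abs]
    have h2 := abs_add_le (Vp r - 1) (β r)
    have h3 := abs_sub (Vp r) 1
    have h4 := F.Vp_le r
    have h5 := F.beta_le r
    rw [abs_one] at h3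
    linarith
  have hub : ∀ r ∈ Ico a R, ‖u r‖ ≤ δ * (‖v r‖ + ‖c r‖) := by
    intro r hr
    have hr' := hr0 r hr
    have h1 : u r = r / (2 * n r) * (v r - c r) := by
      simp only [hc]
      have := hn0 r
      field_simp
      ring
    have h2 : ‖(r : ℂ) / (2 * n r)‖ ≤ δ := by
      rw [norm_div, norm_mul, norm_real, Complex.norm_ofNat,
        Real.norm_of_nonneg (ha.trans_le hr.1).le, hδ]
      have := hnorm r
      have := hr.2.le
      gcongr
    rw [h1, norm_mul]
    gcongr
    exact norm_sub_le _ _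
  have hv1 : ‖v a‖ = 1 := by rw [hv, norm_one]
  have hc1 : ‖c a‖ = 1 := by
    have : c a = 1 := by simp [hc, hu, hv]
    rw [this, norm_one]
  have hexp : (1 + 1) * Real.exp ((2 * P + 4 * Q * δ) * (R - a)) ≤ M := by
    have : 4 * Q * δ ≤ 4 * Q := mul_le_of_le_one_right (by positivity) hδ1
    rw [hM, one_add_one_eq_two]
    gcongr
  have hup := weaklyCoupled_norm_sq_le F.lt.le hδ0 hcv hcc (fun r hr => h.deriv_v r hr.1) hdc hp hp'
    hq hq' hub
  rw [hv1, hc1, one_pow] at hup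
  have hlow : e / 2 ≤ e - 4 * Q * δ *
      ((1 + 1) * Real.exp ((2 * P + 4 * Q * δ) * (R - a))) * (R - a) := by
    have h1 : 4 * Q * δ * ((1 + 1) * Real.exp ((2 * P + 4 * Q * δ) * (R - a))) * (R - a) ≤
        4 * Q * δ * M * (R - a) := by gcongr
    have h2 : 4 * Q * δ * M * (R - a) ≤ e / 2 := by
      have h3 : 4 * Q * R * M * (R - a) / e ≤ y := by linarith
      rw [div_le_iff₀ he0] at h3
      have h4 : 4 * Q * δ * M * (R - a) = 4 * Q * R * M * (R - a) / (2 * y) := by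
        rw [hδ]; ring
      rw [h4, div_le_iff₀ (by positivity)]
      linarith
    linarith
  have hlow1 := weaklyCoupled_le_norm_sq F.lt.le hP0 hQ0 hδ0 hcv hcc
    (fun r hr => h.deriv_v r hr.1) hdc hp hp' hq hq' hub
  have hlow2 := weaklyCoupled_le_norm_sq F.lt.le hP0 hQ0 hδ0 hcc hcv hdc
    (fun r hr => h.deriv_v r hr.1) hp' hp hq' hq
    (fun r hr => by rw [add_comm]; exact hub r hr)
  rw [hv1, hc1, one_pow, one_mul] at hlow1 hlow2
  refine ⟨?_, ?_, ?_, ?_⟩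
  · exact Real.sqrt_le_iff.2 ⟨norm_nonneg _, hlow.trans hlow1⟩
  · exact Real.le_sqrt_of_sq_le (by nlinarith [sq_nonneg ‖c R‖])
  · exact Real.sqrt_le_iff.2 ⟨norm_nonneg _, hlow.trans hlow2⟩
  · refine Real.le_sqrt_of_sq_le ?_
    change ‖c R‖ ^ 2 ≤ M
    nlinarith [sq_nonneg ‖v R‖]

end RegularSolution

/-! ### Jost solutions as Wronskians with free Jost pairs. -/

section Jost

open Complex Filter Topology Set MeasureTheory ComplexConjugate

theorem IsRightSolution.conj {p q : ℝ → ℂ} {a : ℝ} {u v : ℝ → ℂ} (h : IsRightSolution p q a u v) :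
    IsRightSolution (fun r => conj (p r)) (fun r => conj (q r)) a (fun r => conj (u r))
      (fun r => conj (v r)) := by
  have hd : ∀ {f : ℝ → ℂ} {f' : ℂ} {s : Set ℝ} {r : ℝ}, HasDerivWithinAt f f' s r →
      HasDerivWithinAt (fun r => conj (f r)) (conj f') s r := fun hf =>
    (conjCLE.toContinuousLinearMap.hasFDerivAt.comp_hasDerivWithinAt _ hf)
  refine ⟨continuous_conj.comp_continuousOn h.cont_u, continuous_conj.comp_continuousOn h.cont_v,
    fun r hr => (hd (h.deriv_u r hr)).congr_deriv ?_,
    fun r hr => (hd (h.deriv_v r hr)).congr_deriv ?_⟩ <;> simp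

theorem IsRightSolution.congr_coeff {p q p' q' : ℝ → ℂ} {a : ℝ} {u v : ℝ → ℂ}
    (h : IsRightSolution p q a u v) (hp : ∀ r, a ≤ r → p r = p' r) (hq : ∀ r, a ≤ r → q r = q' r) :
    IsRightSolution p' q' a u v :=
  ⟨h.cont_u, h.cont_v, fun r hr => hp r hr ▸ h.deriv_u r hr,
    fun r hr => by rw [← hp r hr, ← hq r hr]; exact h.deriv_v r hr⟩

/-- A pair solving the free first-order system on `[R, ∞)` and asymptotic to
`(e^{ε i r}, ε i e^{ε i r})`. -/
structure IsFreeJostPair (m R : ℝ) (ε : ℂ) (f g : ℝ → ℂ) : Prop where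
  sol : IsRightSolution (fun r => (m : ℂ) / r) (fun _ => -1) R f g
  tendsto_f : Tendsto (fun r : ℝ => f r - exp (ε * I * r)) atTop (𝓝 0)
  tendsto_g : Tendsto (fun r : ℝ => g r - ε * I * exp (ε * I * r)) atTop (𝓝 0)

theorem isFreeJostPair_one {m R : ℝ} (hm : 2 ≤ m) (hR : 0 < R) :
    IsFreeJostPair m R 1 (freeJost m) (fun r => I * freeJost (m - 1) r) := by
  have hd1 : ∀ r, R ≤ r → _ := fun r hr =>
    hasDerivAt_freeJost (m := m) (by linarith) (hR.trans_le hr)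
  have hd2 : ∀ r, R ≤ r → _ := fun r hr =>
    (hasDerivAt_freeJost_sub_one (m := m) hm (hR.trans_le hr)).const_mul I
  refine ⟨⟨fun r hr => (hd1 r hr).continuousAt.continuousWithinAt,
    fun r hr => (hd2 r hr).continuousAt.continuousWithinAt,
    fun r hr => (hd1 r hr).hasDerivWithinAt.congr_deriv (by ring),
    fun r hr => (hd2 r hr).hasDerivWithinAt.congr_deriv ?_⟩, ?_, ?_⟩
  · linear_combination freeJost m r * I_mul_I
  · simpa using tendsto_freeJost (m := m) (by linarith)
  · have := (tendsto_freeJost (m := m - 1) (by linarith)).const_mul I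
    rw [mul_zero] at this
    refine this.congr fun r => ?_
    rw [one_mul]
    ring

/-- For real m the system has real coefficients; conjugating the outgoing pair yields the incoming
one. -/
theorem IsFreeJostPair.conj {m R : ℝ} {ε : ℂ} {f g : ℝ → ℂ} (h : IsFreeJostPair m R ε f g) :
    IsFreeJostPair m R (-conj ε) (fun r => conj (f r)) (fun r => conj (g r)) := by
  refine ⟨h.sol.conj.congr_coeff (fun r _ => by simp) (fun r _ => by simp), ?_, ?_⟩
  · refine squeeze_zero_norm (fun r => le_of_eq ?_) (tendsto_norm_zero.comp h.tendsto_f)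
    have h1 : exp (-conj ε * I * r) = conj (exp (ε * I * r)) := by
      rw [← exp_conj]; simp
    rw [h1, ← map_sub, Complex.norm_conj]
    rfl
  · refine squeeze_zero_norm (fun r => le_of_eq ?_) (tendsto_norm_zero.comp h.tendsto_g)
    have h1 : -conj ε * I * exp (-conj ε * I * r) = conj (ε * I * exp (ε * I * r)) := by
      rw [map_mul, ← exp_conj]; simp
    rw [h1, ← map_sub, Complex.norm_conj]
    rfl

theorem norm_exp_mul_I_mul_ofReal (r : ℝ) :
    ‖exp (1 * I * r)‖ = 1 ∧ ‖exp (-1 * I * r)‖ = 1 := by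
  constructor <;> simp [norm_exp]

/-- The Wronskian is constant, so its value is read off at infinity from the asymptotics. -/
theorem IsFreeJostPair.wronskian {m R : ℝ} {f g f' g' : ℝ → ℂ} (h : IsFreeJostPair m R 1 f g)
    (h' : IsFreeJostPair m R (-1) f' g') {r : ℝ} (hr : R ≤ r) : f r * g' r - g r * f' r = -2 * I := by
  have hconst : ∀ s, R ≤ s → f s * g' s - g s * f' s = f R * g' R - g R * f' R := fun s hs =>
    h.sol.wronskian_eq h'.sol hs
  rw [hconst r hr]
  have hlim : Tendsto (fun s => f s * g' s - g s * f' s) atTop (𝓝 (f R * g' R - g R * f' R)) :=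
    tendsto_const_nhds.congr' ((eventually_ge_atTop R).mono fun s hs => (hconst s hs).symm)
  refine tendsto_nhds_unique hlim (tendsto_sub_nhds_zero_iff.1 ?_)
  have t1 := h.tendsto_f.norm
  have t2 := h.tendsto_g.norm
  have t3 := h'.tendsto_f.norm
  have t4 := h'.tendsto_g.norm
  have t := (((t4.add t1).add (t1.mul t4)).add t3).add (t2.add (t2.mul t3))
  simp only [norm_zero, mul_zero, add_zero] at t
  refine squeeze_zero_norm (fun s => ?_) t
  set E := exp (1 * I * s) with hE
  set E' := exp (-1 * I * s) with hE'
  have hEE : E * E' = 1 := by rw [hE, hE', ← exp_add]; simp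
  have n1 : ‖E‖ = 1 := (norm_exp_mul_I_mul_ofReal s).1
  have n2 : ‖E'‖ = 1 := (norm_exp_mul_I_mul_ofReal s).2
  have key : f s * g' s - g s * f' s - -2 * I = E * (g' s - -1 * I * E') +
      (f s - E) * (-1 * I * E') + (f s - E) * (g' s - -1 * I * E') -
      1 * I * E * (f' s - E') - ((g s - 1 * I * E) * E' + (g s - 1 * I * E) * (f' s - E')) := by
    linear_combination (-2 * I) * hEE
  rw [key]
  refine (norm_sub_le _ _).trans (add_le_add ((norm_sub_le _ _).trans (add_le_add
    ((norm_add_le _ _).trans (add_le_add ((norm_add_le _ _).trans (add_le_add ?_ ?_)) ?_)) ?_))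
    ((norm_add_le _ _).trans (add_le_add ?_ ?_))) <;>
  simp [n1, n2]

/-- Sampling at r ≡ 0 and r ≡ π/2 modulo 2π gives two independent linear equations for a and b. -/
theorem eq_zero_of_tendsto_exp {a b : ℂ}
    (h : Tendsto (fun r : ℝ => a * exp (1 * I * r) + b * exp (-1 * I * r)) atTop (𝓝 0)) :
    a = 0 ∧ b = 0 := by
  have hn : Tendsto (fun n : ℕ => (n : ℝ) * (2 * Real.pi)) atTop atTop :=
    tendsto_natCast_atTop_atTop.atTop_mul_const (by positivity)
  have hn' : Tendsto (fun n : ℕ => (n : ℝ) * (2 * Real.pi) + Real.pi / 2) atTop atTop :=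
    tendsto_atTop_add_const_right _ _ hn
  have e1 : ∀ n : ℕ, exp (1 * I * ((n : ℝ) * (2 * Real.pi) : ℝ)) = 1 := fun n => by
    have h : 1 * I * ((n : ℝ) * (2 * Real.pi) : ℝ) = n * (2 * Real.pi * I) := by push_cast; ring
    rw [h]
    exact exp_nat_mul_two_pi_mul_I n
  have e2 : ∀ n : ℕ, exp (-1 * I * ((n : ℝ) * (2 * Real.pi) : ℝ)) = 1 := fun n => by
    have : -1 * I * ((n : ℝ) * (2 * Real.pi) : ℝ) = -(1 * I * ((n : ℝ) * (2 * Real.pi) : ℝ)) := by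
      ring
    rw [this, exp_neg, e1, inv_one]
  have e3 : exp (1 * I * (Real.pi / 2 : ℝ)) = I := by
    have : 1 * I * (Real.pi / 2 : ℝ) = Real.pi / 2 * I := by push_cast; ring
    rw [this, exp_pi_div_two_mul_I]
  have e4 : exp (-1 * I * (Real.pi / 2 : ℝ)) = -I := by
    have : -1 * I * (Real.pi / 2 : ℝ) = -(1 * I * (Real.pi / 2 : ℝ)) := by ring
    rw [this, exp_neg, e3, inv_I]
  have h1 : a + b = 0 := by
    have := h.comp hn
    refine tendsto_nhds_unique (tendsto_const_nhds.congr fun n => ?_) this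
    simp only [Function.comp_apply]
    rw [e1, e2]
    ring
  have h2 : a * I + b * (-I) = 0 := by
    have := h.comp hn'
    refine tendsto_nhds_unique (tendsto_const_nhds.congr fun n => ?_) this
    simp only [Function.comp_apply]
    rw [ofReal_add, mul_add, mul_add, exp_add, exp_add, e1, e2, e3, e4]
    ring
  have h3 : a - b = 0 := by
    linear_combination (-I) * h2 + (a - b) * I_mul_I
  constructor
  · linear_combination (1 / 2 : ℂ) * (h1 + h3)
  · linear_combination (1 / 2 : ℂ) * (h1 - h3)

/-- A solution on `[R, ∞)` is determined by its asymptotics. -/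
theorem IsFreeJostPair.eq_of_tendsto {m R : ℝ} {f g f' g' u v : ℝ → ℂ} {a b : ℂ}
    (h : IsFreeJostPair m R 1 f g) (h' : IsFreeJostPair m R (-1) f' g')
    (hs : IsRightSolution (fun r => (m : ℂ) / r) (fun _ => -1) R u v)
    (ht : Tendsto (fun r : ℝ => u r - (a * exp (1 * I * r) + b * exp (-1 * I * r))) atTop (𝓝 0)) :
    u R = a * f R + b * f' R ∧ v R = a * g R + b * g' R := by
  have w1 : ∀ r, R ≤ r → _ := fun r hr => hs.wronskian_eq h.sol hr
  have w2 : ∀ r, R ≤ r → _ := fun r hr => hs.wronskian_eq h'.sol hr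
  -- A and B are the coordinates of (u, v) in the basis of the two free pairs; Wronskians express
  -- them, and the asymptotics identify them with a and b.
  set A := (u R * g' R - v R * f' R) / (-2 * I) with hA
  set B := (u R * g R - v R * f R) / (2 * I) with hB
  have hI : (2 * I : ℂ) ≠ 0 := by simp
  have hu : ∀ r, R ≤ r → u r = A * f r + B * f' r := by
    intro r hr
    have hw := h.wronskian h' hr
    rw [hA, hB, ← w1 r hr, ← w2 r hr]
    field_simp
    linear_combination u r * hw
  have hv : ∀ r, R ≤ r → v r = A * g r + B * g' r := by
    intro r hr
    have hw := h.wronskian h' hr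
    rw [hA, hB, ← w1 r hr, ← w2 r hr]
    field_simp
    linear_combination v r * hw
  have hlim : Tendsto (fun r : ℝ => (A - a) * exp (1 * I * r) + (B - b) * exp (-1 * I * r)) atTop
      (𝓝 0) := by
    have t := (ht.sub (h.tendsto_f.const_mul A)).sub (h'.tendsto_f.const_mul B)
    rw [mul_zero, mul_zero, sub_zero, sub_zero] at t
    refine t.congr' ?_
    filter_upwards [eventually_ge_atTop R] with r hr
    rw [hu r hr]
    ring
  obtain ⟨h1, h2⟩ := eq_zero_of_tendsto_exp hlim
  rw [sub_eq_zero] at h1 h2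
  exact ⟨by rw [hu R le_rfl, h1, h2], by rw [hv R le_rfl, h1, h2]⟩

theorem isEquivalent_exp_iff {u e : ℝ → ℂ} (he : ∀ r, ‖e r‖ = 1) :
    Asymptotics.IsEquivalent atTop u e ↔ Tendsto (fun r => u r - e r) atTop (𝓝 0) := by
  have h1 : e =O[atTop] fun _ : ℝ => (1 : ℝ) :=
    Asymptotics.IsBigO.of_bound 1 (Eventually.of_forall fun r => by simp [he r])
  have h2 : (fun _ : ℝ => (1 : ℝ)) =O[atTop] e :=
    Asymptotics.IsBigO.of_bound 1 (Eventually.of_forall fun r => by simp [he r])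
  rw [← Asymptotics.isLittleO_one_iff ℝ]
  exact ⟨fun h => h.isLittleO.trans_isBigO h1, fun h => h.trans_isBigO h2⟩

variable {a R C : ℝ} {γ β V Vp : ℝ → ℝ}

theorem RadialField.isRightSolution_free (F : RadialField a R C γ β V Vp) {ν m : ℝ}
    (hm : m = ν - γ R - 1 / 2) {u v : ℝ → ℂ}
    (h : IsRightSolution (diagCoeff γ ν) (offDiagCoeff β Vp) a u v) :
    IsRightSolution (fun r => (m : ℂ) / r) (fun _ => -1) R u v := by
  refine (h.mono F.lt.le).congr_coeff (fun r hr => ?_) (fun r hr => ?_)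
  · rw [diagCoeff, F.gamma_eq r hr, hm]
    push_cast
    rfl
  · simp [offDiagCoeff, F.Vp_zero r hr, F.beta_zero r hr]

/-- Existence of solutions with the asymptotics of a given free Jost pair. -/
theorem RadialField.exists_jost (F : RadialField a R C γ β V Vp) {ν m : ℝ}
    (hm : m = ν - γ R - 1 / 2) {ε : ℂ} {f g : ℝ → ℂ} (hf : IsFreeJostPair m R ε f g) {Q : ℝ → ℂ}
    (hQ : ∀ r, a ≤ r → Q r = fluxPot γ V ν r) :
    ∃ u, IsRadialSolution Q a u ∧
      Tendsto (fun r : ℝ => u r - exp (ε * I * r)) atTop (𝓝 0) := by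
  have ha := F.a_pos
  have hsol : ∀ c₁ c₂ : ℂ, ∃ u v : ℝ → ℂ, IsRadialSolution (fluxPot γ V ν) a u ∧
      IsRightSolution (diagCoeff γ ν) (offDiagCoeff β Vp) a u v ∧ u a = c₁ ∧ v a = c₂ := by
    intro c₁ c₂
    obtain ⟨u, w, hs, -⟩ := F.exists_isSolutionPair c₁ (c₂ - diagCoeff γ ν a * c₁)
    refine ⟨u ν, _, isRadialSolution_iff.2 ⟨_, (hs ν).1⟩,
      F.isRightSolution (fun _ _ => rfl) (hs ν).1, (hs ν).2.1, ?_⟩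
    rw [(hs ν).2.1, (hs ν).2.2]
    ring
  obtain ⟨φ, ψ, -, h1, hφ, hψ⟩ := hsol 0 1
  obtain ⟨χ, θ, -, h2, hχ, hθ⟩ := hsol 1 0
  -- The initial data at a come from Cramer's rule, so that Wronskian conservation transports them
  -- to (f R, g R) at R.
  obtain ⟨u, v, hu, h3, hua, hva⟩ :=
    hsol (f R * ψ R - g R * φ R) (-(f R * θ R - g R * χ R))
  have e1 := h3.wronskian_eq h1 F.lt.le
  have e2 := h3.wronskian_eq h2 F.lt.le
  have e3 := h2.wronskian_eq h1 F.lt.le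
  rw [hua, hva, hφ, hψ] at e1
  rw [hua, hva, hχ, hθ] at e2
  rw [hχ, hθ, hφ, hψ] at e3
  have huR : u R = f R := by
    linear_combination (f R - u R) * e3 + χ R * e1 - φ R * e2
  have hvR : v R = g R := by
    linear_combination (g R - v R) * e3 + θ R * e1 - ψ R * e2
  have hfree := F.isRightSolution_free hm h3
  have heq : ∀ r, R ≤ r → u r = f r := fun r hr =>
    (hfree.unique hf.sol hr (P := |m| / R) (Q := 1) (fun s hs => by
      have hR : 0 < R := ha.trans F.lt
      have hs0 : 0 < s := hR.trans_le hs.1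
      have h4 : ((m : ℂ) / s).re = m / s := by rw [← ofReal_div, ofReal_re]
      rw [h4, abs_div, abs_of_pos hs0]
      have := hs.1
      gcongr) (fun s _ => by simp) huR hvR).1
  refine ⟨u, ?_, hf.tendsto_f.congr' ((eventually_ge_atTop R).mono fun r hr => sub_left_inj.2 (heq r hr).symm)⟩
  obtain ⟨w, hw⟩ := isRadialSolution_iff.1 hu
  refine isRadialSolution_iff.2 ⟨w, hw.deriv, fun r hr => ⟨(hw.integral r hr).1.congr ?_, ?_⟩⟩
  · intro s hs
    rw [uIoc_of_le hr] at hs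
    beta_reduce
    rw [hQ s hs.1.le]
  · rw [(hw.integral r hr).2]
    congr 1
    refine intervalIntegral.integral_congr fun s hs => ?_
    rw [uIcc_of_le hr] at hs
    rw [hQ s hs.1]

/-- The value at `a` of a Jost solution is the Wronskian at `R` of the free Jost pair with the
solution that vanishes at `a`. -/
theorem RadialField.jost_apply (F : RadialField a R C γ β V Vp) {ν m : ℝ}
    (hm : m = ν - γ R - 1 / 2) {f g f' g' : ℝ → ℂ} (h : IsFreeJostPair m R 1 f g)
    (h' : IsFreeJostPair m R (-1) f' g') {Q : ℝ → ℂ}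
    (hQ : ∀ r, a ≤ r → Q r = fluxPot γ V ν r) {φ ψ : ℝ → ℂ}
    (hφ : IsRightSolution (diagCoeff γ ν) (offDiagCoeff β Vp) a φ ψ) (hφa : φ a = 0)
    (hψa : ψ a = 1) {u : ℝ → ℂ} (hu : IsRadialSolution Q a u) {c d : ℂ}
    (ht : Tendsto (fun r : ℝ => u r - (c * exp (1 * I * r) + d * exp (-1 * I * r))) atTop (𝓝 0)) :
    u a = (c * f R + d * f' R) * ψ R - (c * g R + d * g' R) * φ R := by
  obtain ⟨w, hw⟩ := isRadialSolution_iff.1 hu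
  have h1 := F.isRightSolution hQ hw
  obtain ⟨e1, e2⟩ := h.eq_of_tendsto h' (F.isRightSolution_free hm h1) ht
  have e3 := h1.wronskian_eq hφ F.lt.le
  rw [hφa, hψa] at e3
  linear_combination -e3 + ψ R * e1 - φ R * e2

end Jost

/-! ### Three-term recurrence between Bessel orders, and the imaginary axis. -/

section Ladder

open Complex Filter Topology Set ComplexConjugate

/-- The sequence with initial values `x`, `y` satisfying the three-term recurrence of the
Bessel functions of orders `μ, μ - 1, μ - 2, …` at `R`. -/
noncomputable def besselLadder (R : ℝ) (μ x y : ℂ) : ℕ → ℂ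
  | 0 => x
  | 1 => y
  | j + 2 => 2 * (μ - j - 1) / R * besselLadder R μ x y (j + 1) - besselLadder R μ x y j

theorem besselLadder_add_two (R : ℝ) (μ x y : ℂ) (j : ℕ) : besselLadder R μ x y (j + 2) =
    2 * (μ - j - 1) / R * besselLadder R μ x y (j + 1) - besselLadder R μ x y j := by
  rw [besselLadder]

/-- One step of the recurrence acts on consecutive pairs by a matrix of determinant 1. -/
theorem besselLadder_wronskian (R : ℝ) (μ x y x' y' : ℂ) (j : ℕ) :
    besselLadder R μ x y j * besselLadder R μ x' y' (j + 1) -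
      besselLadder R μ x y (j + 1) * besselLadder R μ x' y' j = x * y' - y * x' := by
  induction j with
  | zero => simp [besselLadder]
  | succ j ih =>
    rw [besselLadder_add_two, besselLadder_add_two, ← ih]
    ring

theorem besselLadder_conj (R μ : ℝ) (x y : ℂ) (j : ℕ) :
    besselLadder R μ (conj x) (conj y) j = conj (besselLadder R μ x y j) := by
  induction j using Nat.twoStepInduction with
  | zero => simp [besselLadder]
  | one => simp [besselLadder]
  | more j h1 h2 =>
    rw [besselLadder_add_two, besselLadder_add_two, h1, h2]
    simp [Complex.conj_ofNat]

theorem differentiable_besselLadder (R : ℝ) {μ x y : ℂ → ℂ} (hμ : Differentiable ℂ μ)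
    (hx : Differentiable ℂ x) (hy : Differentiable ℂ y) (j : ℕ) :
    Differentiable ℂ (fun ν => besselLadder R (μ ν) (x ν) (y ν) j) := by
  induction j using Nat.twoStepInduction with
  | zero => simpa [besselLadder] using hx
  | one => simpa [besselLadder] using hy
  | more j h1 h2 =>
    simp only [besselLadder_add_two]
    fun_prop

/-- Each step costs at most one factor 1 + ‖μ‖, so the ladder adds only polynomial growth to the
exponential bound on its data. -/
theorem exists_norm_besselLadder_le {R : ℝ} (hR : 0 < R) (j : ℕ) :
    ∃ D : ℝ, 0 ≤ D ∧ ∀ μ x y : ℂ, ∀ E : ℝ, ‖x‖ ≤ E → ‖y‖ ≤ E →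
      ‖besselLadder R μ x y j‖ ≤ D * (1 + ‖μ‖) ^ j * E := by
  induction j using Nat.twoStepInduction with
  | zero => exact ⟨1, zero_le_one, fun μ x y E hx _ => by simpa [besselLadder] using hx⟩
  | one =>
    refine ⟨1, zero_le_one, fun μ x y E hx hy => ?_⟩
    have hE : 0 ≤ E := (norm_nonneg _).trans hx
    have := norm_nonneg μ
    simp only [besselLadder, pow_one, one_mul]
    nlinarith
  | more j h1 h2 =>
    obtain ⟨D₁, hD₁, h1⟩ := h1
    obtain ⟨D₂, hD₂, h2⟩ := h2
    refine ⟨2 * (j + 1) / R * D₂ + D₁, by positivity, fun μ x y E hx hy => ?_⟩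
    have hE : 0 ≤ E := (norm_nonneg _).trans hx
    have hμ := norm_nonneg μ
    have e1 : ‖2 * (μ - j - 1) / R‖ ≤ 2 * (j + 1) / R * (1 + ‖μ‖) := by
      rw [norm_div, norm_mul, norm_real, Real.norm_of_nonneg hR.le, Complex.norm_ofNat,
        div_mul_eq_mul_div, mul_assoc]
      have e2 : ‖μ - j - 1‖ ≤ ‖μ‖ + j + 1 := by
        refine (norm_sub_le _ _).trans ?_
        have := norm_sub_le μ (j : ℂ)
        rw [Complex.norm_natCast] at this
        rw [norm_one]
        linarith
      have hj : (0 : ℝ) ≤ j := j.cast_nonneg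
      gcongr
      nlinarith
    have e3 : (1 + ‖μ‖) ^ j ≤ (1 + ‖μ‖) ^ (j + 2) :=
      pow_le_pow_right₀ (by linarith) (by omega)
    rw [besselLadder_add_two]
    calc _ ≤ ‖2 * (μ - j - 1) / R‖ * ‖besselLadder R μ x y (j + 1)‖ + ‖besselLadder R μ x y j‖ := by
          rw [← norm_mul]
          exact norm_sub_le _ _
      _ ≤ 2 * (j + 1) / R * (1 + ‖μ‖) * (D₂ * (1 + ‖μ‖) ^ (j + 1) * E) +
          D₁ * (1 + ‖μ‖) ^ (j + 2) * E := by
          gcongr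
          · exact h2 μ x y E hx hy
          · exact (h1 μ x y E hx hy).trans (by gcongr)
      _ = _ := by ring

/-- The raising and lowering formulas give two values for the derivative of `freeJost (m - 1)`. -/
theorem freeJost_recurrence {m r : ℝ} (hm : 2 ≤ m) (hr : 0 < r) :
    freeJost (m - 2) r = -(I * ((2 * m - 1) / r) * freeJost (m - 1) r) + freeJost m r := by
  have h1 := hasDerivAt_freeJost (m := m - 1) (by linarith) hr
  have h2 := (hasDerivAt_freeJost_sub_one hm hr).unique h1
  rw [show m - 1 - 1 = m - 2 by ring] at h2
  push_cast at h2
  linear_combination I * h2 + (freeJost (m - 2) r - freeJost m r) * I_mul_I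

/-- The factor I^j absorbs the imaginary coefficient in the recurrence of `freeJost`. The ladder
thus lowers the free Jost order from m to m - j. -/
theorem besselLadder_freeJost {m R : ℝ} (hR : 0 < R) (j : ℕ) (hj : (j : ℝ) ≤ m) :
    besselLadder R ((m + 1 / 2 : ℝ) : ℂ) (freeJost m R) (I * freeJost (m - 1) R) j =
      I ^ j * freeJost (m - j) R := by
  induction j using Nat.twoStepInduction with
  | zero => simp [besselLadder]
  | one => simp [besselLadder]
  | more j h1 h2 =>
    have hj' : (j : ℝ) + 2 ≤ m := by exact_mod_cast hj
    rw [besselLadder_add_two, h1 (by linarith), h2 (by push_cast; linarith)]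
    have h3 := freeJost_recurrence (m := m - j) (r := R) (by linarith) hR
    push_cast at h3 ⊢
    rw [show m - ((j : ℝ) + 1) = m - j - 1 by ring, show m - ((j : ℝ) + 2) = m - j - 2 by ring, h3]
    rw [pow_succ, pow_succ]
    linear_combination (-I ^ j * (freeJost (m - j) R) +
      I ^ j * (I * ((2 * (m - j) - 1) / R) * freeJost (m - j - 1) R)) * I_mul_I

/-- The ladder does not vanish and grows, when the order is large compared with `R`. -/
theorem besselLadder_monotone {R : ℝ} (hR : 0 < R) {μ x y : ℂ} (hμ : R ≤ |μ.im|)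
    (hxy : ‖x‖ ≤ ‖y‖) (hy : y ≠ 0) (j : ℕ) :
    ‖besselLadder R μ x y j‖ ≤ ‖besselLadder R μ x y (j + 1)‖ ∧
      besselLadder R μ x y (j + 1) ≠ 0 := by
  induction j with
  | zero => exact ⟨by simpa [besselLadder] using hxy, by simpa [besselLadder] using hy⟩
  | succ j ih =>
    have h1 : 2 ≤ ‖2 * (μ - j - 1) / R‖ := by
      rw [norm_div, norm_mul, norm_real, Real.norm_of_nonneg hR.le, Complex.norm_ofNat,
        le_div_iff₀ hR]
      have h2 := abs_im_le_norm (μ - j - 1)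
      have h3 : (μ - j - 1).im = μ.im := by simp
      rw [h3] at h2
      linarith
    have h4 : ‖besselLadder R μ x y (j + 1)‖ ≤ ‖besselLadder R μ x y (j + 1 + 1)‖ := by
      rw [besselLadder_add_two]
      have h5 := norm_sub_norm_le (2 * (μ - j - 1) / R * besselLadder R μ x y (j + 1))
        (besselLadder R μ x y j)
      rw [norm_mul] at h5
      nlinarith [ih.1, norm_nonneg (besselLadder R μ x y (j + 1))]
    exact ⟨h4, norm_pos_iff.1 ((norm_pos_iff.2 ih.2).trans_le h4)⟩

/-- Discarding finitely many terms keeps divergence; small l must be dropped because the free Jost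
formulas need a large order. -/
theorem not_summable_inter_Ici {L : Set ℕ} {f : ℕ → ℝ} (h : ¬ Summable fun l : L => f l) (n : ℕ) :
    ¬ Summable fun l : (L ∩ Ici n : Set ℕ) => f l := by
  contrapose! h
  have h1 := summable_subtype_iff_indicator.1 h
  refine summable_subtype_iff_indicator.2 ((summable_congr_cofinite ?_).1 h1)
  rw [Nat.cofinite_eq_atTop]
  filter_upwards [eventually_ge_atTop n] with l hl
  by_cases hlL : l ∈ L
  · rw [indicator_of_mem hlL, indicator_of_mem (show l ∈ L ∩ Ici n from ⟨hlL, hl⟩)]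
  · rw [indicator_of_notMem hlL, indicator_of_notMem fun h => hlL h.1]

variable {a R C C' : ℝ} {γ β V Vp γ' β' V' Vp' : ℝ → ℝ}

theorem RadialField.exists_norm_le_exp (F : RadialField a R C γ β V Vp) :
    ∃ A c : ℝ, 0 ≤ A ∧ ∀ ν : ℂ, 0 ≤ ν.re → ∀ u v : ℝ → ℂ,
      IsRightSolution (diagCoeff γ ν) (offDiagCoeff β Vp) a u v → u a = 0 → v a = 1 →
      ‖u R‖ ≤ A * Real.exp (c * ν.re) ∧ ‖v R‖ ≤ A * Real.exp (c * ν.re) := by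
  refine ⟨Real.exp (((C + 1 / 2) / a + 1 + (2 * C + 1)) * (R - a)), (R - a) / a,
    (Real.exp_pos _).le, fun ν hν u v h hu hv => ?_⟩
  have h1 := F.norm_le_exp h hu hv
  have ha := F.a_pos.ne'
  have h2 : ((|ν.re| + C + 1 / 2) / a + 1 + (2 * C + 1)) * (R - a) =
      ((C + 1 / 2) / a + 1 + (2 * C + 1)) * (R - a) + (R - a) / a * ν.re := by
    rw [abs_of_nonneg hν]
    field_simp
    ring
  rwa [h2, Real.exp_add] at h1

/-- Along the positive imaginary axis, regular solutions of two fields whose fluxes differ by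
a positive integer are not related by the ladder. -/
theorem RadialField.exists_ladder_wronskian_ne_zero (F : RadialField a R C γ β V Vp)
    (F' : RadialField a R C' γ' β' V' Vp') {n : ℕ} (h : γ' R = γ R + (n + 1)) {φ ψ φ' ψ' : ℂ → ℝ → ℂ}
    (hφ : ∀ ν, IsRightSolution (diagCoeff γ ν) (offDiagCoeff β Vp) a (φ ν) (ψ ν) ∧
      φ ν a = 0 ∧ ψ ν a = 1)
    (hφ' : ∀ ν, IsRightSolution (diagCoeff γ' ν) (offDiagCoeff β' Vp') a (φ' ν) (ψ' ν) ∧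
      φ' ν a = 0 ∧ ψ' ν a = 1) :
    ∃ ν : ℂ, φ' ν R * besselLadder R (ν - γ R) (φ ν R) (ψ ν R) (n + 2) -
      ψ' ν R * besselLadder R (ν - γ R) (φ ν R) (ψ ν R) (n + 1) ≠ 0 := by
  have hR : 0 < R := F.a_pos.trans F.lt
  -- u equals R/(2(iy - g)) times the difference of the two amplitudes, hence |u| ≤ BR/y < κ.
  have hsmall : ∀ (g κ B y : ℝ) (u v : ℂ), 0 < y → 0 < κ → B * R / κ < y →
      ‖v‖ ≤ B → ‖v - 2 * (y * I - g) / R * u‖ ≤ B → ‖u‖ < κ := by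
    intro g κ B y u v hy hκ hyB hv hc
    have h1 : ‖2 * (y * I - g) / R * u‖ ≤ 2 * B := by
      calc ‖2 * (y * I - g) / R * u‖ = ‖v - (v - 2 * (y * I - g) / R * u)‖ := by congr 1; ring
        _ ≤ ‖v‖ + ‖v - 2 * (y * I - g) / R * u‖ := norm_sub_le _ _
        _ ≤ _ := by linarith
    have h2 : y ≤ ‖(y * I - g : ℂ)‖ := by
      have := abs_im_le_norm (y * I - g : ℂ)
      simp only [sub_im, mul_im, ofReal_re, I_im, mul_one, ofReal_im, I_re, mul_zero, add_zero,
        sub_zero] at this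
      exact (le_abs_self y).trans this
    rw [norm_mul, norm_div, norm_mul, norm_real, Real.norm_of_nonneg hR.le, Complex.norm_ofNat,
      div_mul_eq_mul_div, div_le_iff₀ hR] at h1
    rw [div_lt_iff₀ hκ] at hyB
    have h3 : y * ‖u‖ < y * κ := by nlinarith [norm_nonneg u]
    exact lt_of_mul_lt_mul_left h3 hy.le
  obtain ⟨κ, B, Y, hκ, hY, hb⟩ := F.exists_bounds_imaginary
  obtain ⟨κ', B', Y', hκ', hY', hb'⟩ := F'.exists_bounds_imaginary
  obtain ⟨y, hy⟩ : ∃ y : ℝ, Y ≤ y ∧ Y' ≤ y ∧ R ≤ y ∧ B * R / κ < y ∧ B' * R / κ' < y :=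
    (((eventually_ge_atTop Y).and ((eventually_ge_atTop Y').and ((eventually_ge_atTop R).and
      ((eventually_gt_atTop (B * R / κ)).and (eventually_gt_atTop (B' * R / κ')))))).exists)
  obtain ⟨hyY, hyY', hyR, hyB, hyB'⟩ := hy
  have hy0 : 0 < y := by linarith
  obtain ⟨hs, hs0, hs1⟩ := hφ (y * I)
  obtain ⟨hs', hs0', hs1'⟩ := hφ' (y * I)
  obtain ⟨b1, b2, b3, b4⟩ := hb y hyY _ _ hs hs0 hs1
  obtain ⟨b1', b2', b3', b4'⟩ := hb' y hyY' _ _ hs' hs0' hs1'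
  have s := hsmall _ _ _ _ _ _ hy0 hκ hyB b2 b4
  have s' := hsmall _ _ _ _ _ _ hy0 hκ' hyB' b2' b4'
  refine ⟨y * I, fun h0 => ?_⟩
  set x := φ (y * I) R
  set z := ψ (y * I) R
  set x' := φ' (y * I) R
  set z' := ψ' (y * I) R
  obtain ⟨m1, m2⟩ := besselLadder_monotone hR (μ := y * I - γ R) (x := x) (y := z)
    (by simpa using hyR.trans (le_abs_self y)) (s.le.trans b1)
    (norm_pos_iff.1 (hκ.trans_le b1)) n
  have hγ : ((γ' R : ℝ) : ℂ) = γ R + (n + 1) := by rw [h]; push_cast; ring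
  rw [besselLadder_add_two] at h0
  -- As γ' R = γ R + (n + 1), the last recurrence coefficient is exactly the one in the second
  -- amplitude of `F'`. That amplitude is at least κ', whereas |x'| < κ'.
  have h1 : (z' - 2 * (y * I - γ' R) / R * x') * besselLadder R (y * I - γ R) x z (n + 1) =
      -(x' * besselLadder R (y * I - γ R) x z n) := by
    rw [hγ]
    linear_combination -h0
  have h2 := congrArg norm h1
  rw [norm_neg, norm_mul, norm_mul] at h2
  have h3 := norm_pos_iff.2 m2
  have h4 : κ' * ‖besselLadder R (y * I - γ R) x z (n + 1)‖ <
      κ' * ‖besselLadder R (y * I - γ R) x z (n + 1)‖ := by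
    calc _ ≤ ‖x'‖ * ‖besselLadder R (y * I - γ R) x z n‖ := by rw [← h2]; gcongr
      _ ≤ ‖x'‖ * ‖besselLadder R (y * I - γ R) x z (n + 1)‖ := by gcongr
      _ < _ := by gcongr
  exact lt_irrefl _ h4

/-- The ladder Wronskian of two families of regular solutions cannot vanish on a Müntz set, if
the fluxes differ by a positive integer. -/
theorem RadialField.not_ladder_wronskian_eq_zero (F : RadialField a R C γ β V Vp)
    (F' : RadialField a R C' γ' β' V' Vp') {n : ℕ} (h : γ' R = γ R + (n + 1)) {φ ψ φ' ψ' : ℂ → ℝ → ℂ}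
    (hφ : ∀ ν, IsRightSolution (diagCoeff γ ν) (offDiagCoeff β Vp) a (φ ν) (ψ ν) ∧
      φ ν a = 0 ∧ ψ ν a = 1)
    (hφ' : ∀ ν, IsRightSolution (diagCoeff γ' ν) (offDiagCoeff β' Vp') a (φ' ν) (ψ' ν) ∧
      φ' ν a = 0 ∧ ψ' ν a = 1)
    (hdφ : Differentiable ℂ fun ν => φ ν R) (hdψ : Differentiable ℂ fun ν => ψ ν R)
    (hdφ' : Differentiable ℂ fun ν => φ' ν R) (hdψ' : Differentiable ℂ fun ν => ψ' ν R)
    {L : Set ℕ} (hLpos : ∀ l ∈ L, 0 < l) (hL : ¬ Summable (fun l : L => 1 / ((l : ℕ) : ℝ)))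
    (hz : ∀ l ∈ L, φ' l R * besselLadder R (l - γ R) (φ l R) (ψ l R) (n + 2) -
      ψ' l R * besselLadder R (l - γ R) (φ l R) (ψ l R) (n + 1) = 0) : False := by
  have hR : 0 < R := F.a_pos.trans F.lt
  obtain ⟨ν₀, hν₀⟩ := F.exists_ladder_wronskian_ne_zero F' h hφ hφ'
  have hμ : Differentiable ℂ fun ν : ℂ => ν - γ R := differentiable_id.sub_const _
  obtain ⟨A, c, hA, hE⟩ := F.exists_norm_le_exp
  obtain ⟨A', c', hA', hE'⟩ := F'.exists_norm_le_exp
  obtain ⟨D₁, hD₁, hl₁⟩ := exists_norm_besselLadder_le hR (n + 1)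
  obtain ⟨D₂, hD₂, hl₂⟩ := exists_norm_besselLadder_le hR (n + 2)
  refine hν₀ (eq_zero_of_muntz_zeros (N := n + 2)
    (C := A' * A * ((D₁ + D₂) * (1 + |γ R|) ^ (n + 2))) (c := c + c')
    ((hdφ'.mul (differentiable_besselLadder R hμ hdφ hdψ _)).sub
      (hdψ'.mul (differentiable_besselLadder R hμ hdφ hdψ _))) (fun ν hν => ?_) L hLpos hL hz ν₀)
  obtain ⟨e1, e2⟩ := hE ν hν _ _ (hφ ν).1 (hφ ν).2.1 (hφ ν).2.2
  obtain ⟨e1', e2'⟩ := hE' ν hν _ _ (hφ' ν).1 (hφ' ν).2.1 (hφ' ν).2.2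
  have b1 := hl₁ (ν - γ R) _ _ _ e1 e2
  have b2 := hl₂ (ν - γ R) _ _ _ e1 e2
  set M : ℝ := 1 + ‖ν - γ R‖ with hM
  have hM1 : 1 ≤ M := by have := norm_nonneg (ν - γ R); linarith
  have hMle : M ≤ (1 + |γ R|) * (1 + ‖ν‖) := by
    have := norm_sub_le ν (γ R)
    rw [norm_real, Real.norm_eq_abs] at this
    have h3 := mul_nonneg (abs_nonneg (γ R)) (norm_nonneg ν)
    rw [hM]
    linarith
  have hMpow : M ^ (n + 1) ≤ M ^ (n + 2) := pow_le_pow_right₀ hM1 (by omega)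
  have hMpow' : M ^ (n + 2) ≤ (1 + |γ R|) ^ (n + 2) * (1 + ‖ν‖) ^ (n + 2) := by
    rw [← mul_pow]
    gcongr
  simp only [Pi.sub_apply, Pi.mul_apply]
  refine (norm_sub_le _ _).trans ?_
  rw [norm_mul, norm_mul]
  calc _ ≤ (A' * Real.exp (c' * ν.re)) * (D₂ * M ^ (n + 2) * (A * Real.exp (c * ν.re))) +
        (A' * Real.exp (c' * ν.re)) * (D₁ * M ^ (n + 2) * (A * Real.exp (c * ν.re))) := by
        gcongr
        exact b1.trans (by gcongr)
    _ = A' * A * (D₁ + D₂) * (Real.exp (c * ν.re) * Real.exp (c' * ν.re)) * M ^ (n + 2) := by ring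
    _ ≤ A' * A * (D₁ + D₂) * (Real.exp (c * ν.re) * Real.exp (c' * ν.re)) *
        ((1 + |γ R|) ^ (n + 2) * (1 + ‖ν‖) ^ (n + 2)) := by gcongr
    _ = _ := by
        rw [add_mul c c', Real.exp_add]
        ring

end Ladder

/-! ### The Regge function: its limit and the consequence of coincidences. -/

section Regge

open Complex Filter Topology Set ComplexConjugate

variable {r₀ R₀ R C C' : ℝ} {β Vp β' Vp' : ℝ → ℝ} {V b V' b' : Plane → ℝ}

/-- The dependence on R cancels, which frees the matching radius from the radius in the definition.
-/
theorem radialPot_eq_fluxPot (V b : Plane → ℝ) (R : ℝ) (ν : ℂ) :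
    radialPot V b R ν = fluxPot (gammaFun b) (profile V) ν := by
  funext r
  simp only [radialPot, qPot, fluxPot]
  ring

/-- Values at `r₀` of the Jost solutions. -/
theorem RadialField.jostSolution_apply
    (F : RadialField r₀ R C (gammaFun b) β (profile V) Vp) {ν m : ℝ}
    (hm : m = ν - gammaFun b R - 1 / 2) {f g f' g' : ℝ → ℂ} (h : IsFreeJostPair m R 1 f g)
    (h' : IsFreeJostPair m R (-1) f' g') {φ ψ : ℝ → ℂ}
    (hφ : IsRightSolution (diagCoeff (gammaFun b) ν) (offDiagCoeff β Vp) r₀ φ ψ)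
    (hφa : φ r₀ = 0) (hψa : ψ r₀ = 1) :
    jostSolution V b r₀ R₀ 1 ν r₀ = f R * ψ R - g R * φ R ∧
      jostSolution V b r₀ R₀ (-1) ν r₀ = f' R * ψ R - g' R * φ R := by
  have hQ : ∀ r, r₀ ≤ r → radialPot V b R₀ ν r = fluxPot (gammaFun b) (profile V) ν r :=
    fun r _ => by rw [radialPot_eq_fluxPot]
  constructor
  · obtain ⟨u, hu, hut⟩ := F.exists_jost hm h hQ
    -- Existence makes the epsilon choice a genuine Jost solution; its value at r₀ then follows from
    -- the asymptotics alone.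
    have hJ : IsJostSolution V b r₀ R₀ 1 ν (jostSolution V b r₀ R₀ 1 ν) :=
      Classical.epsilon_spec ⟨u, hu,
        (isEquivalent_exp_iff fun r => (norm_exp_mul_I_mul_ofReal r).1).2 hut⟩
    have ht := (isEquivalent_exp_iff fun r => (norm_exp_mul_I_mul_ofReal r).1).1 hJ.2
    have := F.jost_apply hm h h' hQ hφ hφa hψa hJ.1 (c := 1) (d := 0) (by simpa using ht)
    simpa using this
  · obtain ⟨u, hu, hut⟩ := F.exists_jost hm h' hQ
    have hJ : IsJostSolution V b r₀ R₀ (-1) ν (jostSolution V b r₀ R₀ (-1) ν) :=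
      Classical.epsilon_spec ⟨u, hu,
        (isEquivalent_exp_iff fun r => (norm_exp_mul_I_mul_ofReal r).2).2 hut⟩
    have ht := (isEquivalent_exp_iff fun r => (norm_exp_mul_I_mul_ofReal r).2).1 hJ.2
    have := F.jost_apply hm h h' hQ hφ hφa hψa hJ.1 (c := 0) (d := 1) (by simpa using ht)
    simpa using this

theorem isFreeJostPair_neg_one {m R : ℝ} (hm : 2 ≤ m) (hR : 0 < R) :
    IsFreeJostPair m R (-1) (fun r => conj (freeJost m r))
      (fun r => conj (I * freeJost (m - 1) r)) := by
  simpa using (isFreeJostPair_one hm hR).conj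

theorem regge_eq (V b : Plane → ℝ) (r₀ R : ℝ) (ν : ℂ) : regge V b r₀ R ν =
    -exp (I * Real.pi * (ν + 1 / 2)) *
      (jostSolution V b r₀ R (-1) ν r₀ / jostSolution V b r₀ R 1 ν r₀) := by
  rw [regge, jostAlpha, jostBeta, neg_mul, div_neg, mul_div_mul_left _ _ I_ne_zero]
  ring

theorem norm_one_add_conj_div_sub_one_le {η η' : ℂ} {d : ℝ} (hd : d ≤ 1 / 2) (h : ‖η‖ ≤ d)
    (h' : ‖η'‖ ≤ d) : ‖(1 + conj η') / (1 + η) - 1‖ ≤ 4 * d := by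
  have h1 : 1 / 2 ≤ ‖1 + η‖ := by
    have := norm_sub_norm_le 1 (-η)
    rw [norm_one, norm_neg, sub_neg_eq_add] at this
    linarith
  have h2 : 1 + η ≠ 0 := norm_pos_iff.1 (by linarith)
  have h3 : ‖conj η' - η‖ ≤ 2 * d := by
    have := norm_sub_le (conj η') η
    rw [Complex.norm_conj] at this
    linarith
  rw [div_sub_one h2, add_sub_add_left_eq_sub, norm_div, div_le_iff₀ (by linarith)]
  nlinarith [norm_nonneg η]

/-- The Regge interpolation function recovers the flux at infinity. -/
theorem RadialField.tendsto_regge (F : RadialField r₀ R C (gammaFun b) β (profile V) Vp) (R₀ : ℝ) :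
    Tendsto (fun l : ℕ => regge V b r₀ R₀ ((l : ℝ) : ℂ)) atTop
      (𝓝 (exp (I * Real.pi * gammaFun b R))) := by
  have hR : 0 < R := F.a_pos.trans F.lt
  obtain ⟨φ, ψ, hφ, -, -⟩ := F.exists_regular
  rw [Metric.tendsto_atTop']
  intro ε hε
  set d : ℝ := min (ε / 8) (1 / 2) with hd
  have hd0 : 0 < d := by positivity
  have hd1 : d ≤ 1 / 2 := min_le_right _ _
  have hd2 : 4 * d < ε := by
    have := min_le_left (ε / 8) (1 / 2)
    rw [← hd] at this
    linarith
  -- The admissible ratio |φ|/|ψ| at R: it makes the second part of the error in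
  -- `freeJost_wronskian_eq` at most d/2, and M below handles the first part.
  set e : ℝ := d / (2 * (R * (1 + R * Real.exp (R + 1)))) with he
  have he0 : 0 < e := by positivity
  obtain ⟨N, hN⟩ := F.eventually_mul_norm_le (inv_pos.2 he0)
  have ht : Tendsto (fun m : ℝ => R * Real.exp (R + 1) * (2 : ℝ) ^ (-m)) atTop (𝓝 0) := by
    have h1 : Tendsto (fun m : ℝ => (1 / 2 : ℝ) ^ m) atTop (𝓝 0) :=
      tendsto_rpow_atTop_of_base_lt_one _ (by norm_num) (by norm_num)
    have h2 := h1.const_mul (R * Real.exp (R + 1))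
    rw [mul_zero] at h2
    refine h2.congr fun m => ?_
    rw [one_div, Real.inv_rpow (by norm_num), Real.rpow_neg (by norm_num)]
  obtain ⟨M, hM⟩ := eventually_atTop.1 (ht.eventually (gt_mem_nhds (half_pos hd0)))
  obtain ⟨n, hn⟩ := exists_nat_ge (max N (max 2 M + gammaFun b R + 1 / 2))
  refine ⟨n, fun l hl => ?_⟩
  have hln : (n : ℝ) ≤ l := by exact_mod_cast hl.le
  have hlN : N ≤ (l : ℝ) := (le_max_left _ _).trans (hn.trans hln)
  have hlM : max 2 M + gammaFun b R + 1 / 2 ≤ (l : ℝ) := (le_max_right _ _).trans (hn.trans hln)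
  obtain ⟨m, hm⟩ : ∃ m : ℝ, m = l - gammaFun b R - 1 / 2 := ⟨_, rfl⟩
  have hm2 : 2 ≤ m := by have := le_max_left 2 M; linarith
  have hmM : M ≤ m := by have := le_max_right 2 M; linarith
  obtain ⟨hs, hs0, hs1⟩ := hφ (l : ℝ)
  obtain ⟨hK, hψ⟩ := hN (l : ℝ) (by simpa using hlN) _ _ hs hs0 hs1
  obtain ⟨hj1, hj2⟩ := F.jostSolution_apply (R₀ := R₀) hm (isFreeJostPair_one hm2 hR)
    (isFreeJostPair_neg_one hm2 hR) hs hs0 hs1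
  rw [inv_mul_le_iff₀ he0] at hK
  obtain ⟨κ, hκ, hW⟩ := freeJost_wronskian_eq hm2 hR he0.le
  obtain ⟨η, hη, hη'⟩ := hW _ _ hK
  -- F⁻ is the conjugate of the outgoing Wronskian with conjugate data, so the same estimate gives
  -- it the opposite phase.
  obtain ⟨η₁, hη₁, hη₁'⟩ := hW (conj (φ (l : ℝ) R)) (conj (ψ (l : ℝ) R))
    (by simpa only [Complex.norm_conj] using hK)
  have hbound : R * Real.exp (R + 1) * 2 ^ (-m) +
      R * (1 + R * Real.exp (R + 1) * 2 ^ (1 - m)) * e ≤ d := by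
    have h1 := hM m hmM
    have h2 : (2 : ℝ) ^ (1 - m) ≤ 1 := Real.rpow_le_one_of_one_le_of_nonpos (by norm_num) (by linarith)
    have h3 : R * (1 + R * Real.exp (R + 1) * 2 ^ (1 - m)) * e ≤ d / 2 := by
      calc _ ≤ R * (1 + R * Real.exp (R + 1) * 1) * e := by gcongr
        _ = d / 2 := by rw [he]; field_simp
    linarith
  have hquot := norm_one_add_conj_div_sub_one_le hd1 (hη.trans hbound) (hη₁.trans hbound)
  set γ := gammaFun b R with hγ
  have hj1' : jostSolution V b r₀ R₀ 1 (l : ℝ) r₀ =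
      κ * exp (I * (Real.pi * m / 2)) * (ψ (l : ℝ) R * (1 + η)) := by rw [hj1, hη']
  have hj2' : jostSolution V b r₀ R₀ (-1) (l : ℝ) r₀ =
      κ * exp (-(I * (Real.pi * m / 2))) * (ψ (l : ℝ) R * (1 + conj η₁)) := by
    rw [hj2]
    have := congrArg conj hη₁'
    simp only [map_sub, map_mul, map_add, map_one, conj_conj, conj_ofReal] at this
    rw [map_mul, this, ← exp_conj]
    congr 3
    simp [Complex.conj_ofNat]
  have hσ : regge V b r₀ R₀ (l : ℝ) = exp (I * Real.pi * γ) * ((1 + conj η₁) / (1 + η)) := by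
    have hκ' : (κ : ℂ) ≠ 0 := by exact_mod_cast hκ.ne'
    -- Because l + 1/2 = m + γ + 1, the prefactor cancels the phase exp(-iπm) of F⁻/F⁺ and leaves
    -- exp(iπγ); the sign cancels the one in `regge_eq`.
    have h1 : exp (I * Real.pi * ((l : ℝ) + 1 / 2)) = -(exp (I * Real.pi * γ) *
        (exp (I * (Real.pi * m / 2)) * exp (I * (Real.pi * m / 2)))) := by
      rw [← exp_add, ← exp_add, ← neg_one_mul, ← exp_pi_mul_I, ← exp_add, hm]
      congr 1
      push_cast
      ring
    have h2 := exp_ne_zero (I * (Real.pi * m / 2))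
    rw [regge_eq, hj1', hj2', h1, exp_neg]
    by_cases h3 : 1 + η = 0
    · simp [h3]
    · field_simp
  rw [hσ, dist_eq_norm]
  have hn : ‖exp (I * Real.pi * γ)‖ = 1 := by
    rw [mul_assoc, mul_comm, ← ofReal_mul, norm_exp_ofReal_mul_I]
  calc _ = ‖exp (I * Real.pi * γ) * ((1 + conj η₁) / (1 + η) - 1)‖ := by congr 1; ring
    _ = ‖(1 + conj η₁) / (1 + η) - 1‖ := by rw [norm_mul, hn, one_mul]
    _ ≤ 4 * d := hquot
    _ < ε := hd2

/-- Nonvanishing of σ rules out the convention x/0 = 0, so both denominators can be cleared. -/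
theorem jost_mul_eq_of_regge_eq {ν : ℂ} (h : regge V b r₀ R₀ ν = regge V' b' r₀ R₀ ν)
    (h0 : regge V b r₀ R₀ ν ≠ 0) :
    jostSolution V b r₀ R₀ (-1) ν r₀ * jostSolution V' b' r₀ R₀ 1 ν r₀ =
      jostSolution V' b' r₀ R₀ (-1) ν r₀ * jostSolution V b r₀ R₀ 1 ν r₀ := by
  have h0' := h ▸ h0
  rw [regge_eq] at h0 h0'
  rw [regge_eq, regge_eq] at h
  have h1 := (div_ne_zero_iff.1 (right_ne_zero_of_mul h0)).2
  have h2 := (div_ne_zero_iff.1 (right_ne_zero_of_mul h0')).2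
  have h3 := mul_left_cancel₀ (left_ne_zero_of_mul h0) h
  rwa [div_eq_div_iff h1 h2] at h3

/-- Equality of the Regge functions at a large angular momentum, when the fluxes differ by an
even integer. -/
theorem RadialField.ladder_wronskian_eq_zero
    (F : RadialField r₀ R C (gammaFun b) β (profile V) Vp)
    (F' : RadialField r₀ R C' (gammaFun b') β' (profile V') Vp') {k : ℕ}
    (h : gammaFun b' R = gammaFun b R + 2 * k) {ν : ℝ} (hν : gammaFun b' R + 5 / 2 ≤ ν)
    {φ ψ φ' ψ' : ℝ → ℂ}
    (hφ : IsRightSolution (diagCoeff (gammaFun b) ν) (offDiagCoeff β Vp) r₀ φ ψ)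
    (hφa : φ r₀ = 0) (hψa : ψ r₀ = 1)
    (hφ' : IsRightSolution (diagCoeff (gammaFun b') ν) (offDiagCoeff β' Vp') r₀ φ' ψ')
    (hφa' : φ' r₀ = 0) (hψa' : ψ' r₀ = 1)
    (hσ : regge V b r₀ R₀ ν = regge V' b' r₀ R₀ ν) (hσ0 : regge V b r₀ R₀ ν ≠ 0) :
    φ' R * besselLadder R (ν - gammaFun b R) (φ R) (ψ R) (2 * k + 1) -
      ψ' R * besselLadder R (ν - gammaFun b R) (φ R) (ψ R) (2 * k) = 0 := by
  have hR : 0 < R := F.a_pos.trans F.lt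
  have hk : (0 : ℝ) ≤ k := k.cast_nonneg
  obtain ⟨m, hm⟩ : ∃ m : ℝ, m = ν - gammaFun b R - 1 / 2 := ⟨_, rfl⟩
  obtain ⟨m', hm'⟩ : ∃ m' : ℝ, m' = ν - gammaFun b' R - 1 / 2 := ⟨_, rfl⟩
  have hmm : m - 2 * k = m' := by linarith
  -- The 5/2 in the hypothesis on ν is 2 + 1/2, exactly what the smaller free order m' requires.
  have hm2' : 2 ≤ m' := by linarith
  have hm2 : 2 ≤ m := by linarith
  have hJ := jost_mul_eq_of_regge_eq hσ hσ0
  obtain ⟨a1, a2⟩ := F.jostSolution_apply (R₀ := R₀) hm (isFreeJostPair_one hm2 hR)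
    (isFreeJostPair_neg_one hm2 hR) hφ hφa hψa
  obtain ⟨a1', a2'⟩ := F'.jostSolution_apply (R₀ := R₀) hm' (isFreeJostPair_one hm2' hR)
    (isFreeJostPair_neg_one hm2' hR) hφ' hφa' hψa'
  have hw := (isFreeJostPair_one hm2' hR).wronskian (isFreeJostPair_neg_one hm2' hR) le_rfl
  have hμ : (ν : ℂ) - gammaFun b R = ((m + 1 / 2 : ℝ) : ℂ) := by rw [hm]; push_cast; ring
  have w1 := besselLadder_wronskian R (m + 1 / 2 : ℝ) (freeJost m R) (I * freeJost (m - 1) R)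
    (φ R) (ψ R) (2 * k)
  have w2 := besselLadder_wronskian R (m + 1 / 2 : ℝ) (conj (freeJost m R))
    (conj (I * freeJost (m - 1) R)) (φ R) (ψ R) (2 * k)
  have l1 := besselLadder_freeJost (m := m) hR (2 * k) (by push_cast; linarith)
  have l2 := besselLadder_freeJost (m := m) hR (2 * k + 1) (by push_cast; linarith)
  push_cast only [Nat.cast_mul, Nat.cast_add, Nat.cast_one, Nat.cast_ofNat] at l1 l2
  rw [hmm] at l1
  rw [show m - (2 * (k : ℝ) + 1) = m' - 1 by rw [← hmm]; ring, pow_succ] at l2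
  rw [besselLadder_conj, besselLadder_conj] at w2
  rw [l1, l2] at w1 w2
  -- Here evenness of the flux difference is used: the ladder factor is real, so it is the same for
  -- outgoing and incoming pairs.
  have hI : conj (I ^ (2 * k)) = I ^ (2 * k) := by
    rw [pow_mul, I_sq, map_pow, map_neg, map_one]
  have hI0 : I ^ (2 * k) ≠ 0 := pow_ne_zero _ I_ne_zero
  simp only [map_mul, conj_I] at w2 hw
  rw [hI] at w2
  rw [hμ]
  rw [← w1] at a1
  simp only [map_mul, conj_I] at a2 a2'
  rw [← w2] at a2
  rw [a1, a1', a2, a2'] at hJ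
  have h2 : (2 * I : ℂ) ≠ 0 := by simp
  refine (mul_eq_zero.1 ?_).resolve_left (mul_ne_zero hI0 h2)
  set u := besselLadder R (m + 1 / 2 : ℝ) (φ R) (ψ R) (2 * k)
  set v := besselLadder R (m + 1 / 2 : ℝ) (φ R) (ψ R) (2 * k + 1)
  -- Plücker relation: both Regge ratios now pair the same free basis of order m' with (u, v) and
  -- with (φ', ψ'). Their equality is the Wronskian of those two vectors times the free Wronskian
  -- -2i.
  linear_combination -hJ + I ^ (2 * k) * (φ' R * v - ψ' R * u) * hw

end Regge

/-! ### From the class 𝒞 to radial data. -/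

section ClassC

open Filter Topology Set MeasureTheory

theorem norm_plane_axis (r : ℝ) : ‖(!₂[r, 0] : Plane)‖ = |r| := by
  rw [EuclideanSpace.norm_eq, Fin.sum_univ_two]
  simp [Real.sqrt_sq_eq_abs]

theorem profile_eq_zero {f : Plane → ℝ} {R : ℝ} (h : Function.support f ⊆ Metric.closedBall 0 R)
    {r : ℝ} (hr : R < |r|) : profile f r = 0 := by
  by_contra h0
  have h1 := mem_closedBall_zero_iff.1 (h (Function.mem_support.2 h0))
  rw [norm_plane_axis] at h1
  linarith

theorem continuous_profile {f : Plane → ℝ} (h : Continuous f) : Continuous (profile f) := by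
  refine h.comp ((PiLp.continuous_toLp 2 _).comp (continuous_pi fun i => ?_))
  fin_cases i
  · exact continuous_id
  · exact continuous_const

theorem MagneticScattering.IsPiecewiseContinuous.exists_tendsto_gt {f : ℝ → ℝ} (h : IsPiecewiseContinuous f) (r : ℝ) :
    ∃ c, Tendsto f (𝓝[>] r) (𝓝 c) := by
  obtain ⟨S, -, hc, hl⟩ := h
  by_cases hr : r ∈ S
  · exact (hl r hr).2
  · exact ⟨f r, (hc r hr).tendsto.mono_left nhdsWithin_le_nhds⟩

theorem MagneticScattering.IsPiecewiseContinuous.exists_tendsto_lt {f : ℝ → ℝ} (h : IsPiecewiseContinuous f) (r : ℝ) :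
    ∃ c, Tendsto f (𝓝[<] r) (𝓝 c) := by
  obtain ⟨S, -, hc, hl⟩ := h
  by_cases hr : r ∈ S
  · exact (hl r hr).1
  · exact ⟨f r, (hc r hr).tendsto.mono_left nhdsWithin_le_nhds⟩

theorem MagneticScattering.IsPiecewiseContinuous.of_continuous {f : ℝ → ℝ} (h : Continuous f) :
    IsPiecewiseContinuous f :=
  ⟨∅, finite_empty, fun _ _ => h.continuousAt, fun _ hr => hr.elim⟩

theorem MagneticScattering.IsPiecewiseContinuous.aestronglyMeasurable {f : ℝ → ℝ} (h : IsPiecewiseContinuous f) :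
    AEStronglyMeasurable f volume := by
  obtain ⟨S, hS, hc, -⟩ := h
  have h1 : AEStronglyMeasurable f (volume.restrict Sᶜ) :=
    ContinuousOn.aestronglyMeasurable (fun r hr => (hc r hr).continuousWithinAt)
      hS.measurableSet.compl
  have h2 : ∀ᵐ r ∂volume, r ∈ Sᶜ := compl_mem_ae_iff.2 (hS.measure_zero volume)
  rwa [Measure.restrict_eq_self_of_ae_mem h2] at h1

/-- Finite one-sided limits and the value at the point bound f near each point; compactness of [-R,
R] does the rest. -/
theorem MagneticScattering.IsPiecewiseContinuous.exists_bound {f : ℝ → ℝ} (h : IsPiecewiseContinuous f) {R : ℝ}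
    (h0 : ∀ r, R < |r| → f r = 0) : ∃ M, ∀ r, |f r| ≤ M := by
  have hloc : ∀ r, ∃ M, ∀ᶠ s in 𝓝 r, |f s| ≤ M := by
    intro r
    obtain ⟨c, hc⟩ := h.exists_tendsto_gt r
    obtain ⟨d, hd⟩ := h.exists_tendsto_lt r
    have h1 := hc.abs.eventually (eventually_le_nhds (lt_add_one |c|))
    have h2 := hd.abs.eventually (eventually_le_nhds (lt_add_one |d|))
    refine ⟨max (|f r|) (max (|c| + 1) (|d| + 1)), ?_⟩
    have h3 : ∀ᶠ s in 𝓝[≠] r, |f s| ≤ max (|c| + 1) (|d| + 1) := by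
      rw [← nhdsLT_sup_nhdsGT, eventually_sup]
      exact ⟨h2.mono fun s hs => hs.trans (le_max_right _ _),
        h1.mono fun s hs => hs.trans (le_max_left _ _)⟩
    filter_upwards [eventually_nhdsWithin_iff.1 h3] with s hs
    rcases eq_or_ne s r with rfl | hsr
    · exact le_max_left _ _
    · exact (hs hsr).trans (le_max_right _ _)
  obtain ⟨M, hM⟩ := (isCompact_Icc (a := -R) (b := R)).induction_on
    (p := fun s => ∃ M, ∀ r ∈ s, |f r| ≤ M) ⟨0, fun _ h => h.elim⟩
    (fun s t hst ⟨M, hM⟩ => ⟨M, fun r hr => hM r (hst hr)⟩)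
    (fun s t ⟨M, hM⟩ ⟨M', hM'⟩ => ⟨max M M', fun r hr => hr.elim
      (fun h => (hM r h).trans (le_max_left _ _)) fun h => (hM' r h).trans (le_max_right _ _)⟩)
    (fun r _ => by
      obtain ⟨M, hM⟩ := hloc r
      exact ⟨{s | |f s| ≤ M}, mem_nhdsWithin_of_mem_nhds hM, M, fun s hs => hs⟩)
  refine ⟨max M 0, fun r => ?_⟩
  rcases le_or_gt |r| R with hr | hr
  · exact (hM r (abs_le.1 hr)).trans (le_max_left _ _)
  · rw [h0 r hr, abs_zero]
    exact le_max_right _ _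

variable {V b : Plane → ℝ} {r₀ R R₁ : ℝ}

theorem gammaFun_eq (hb : Function.support b ⊆ Metric.closedBall 0 R)
    (hc : Continuous (profile b)) {r : ℝ} (hr : R ≤ r) : gammaFun b r = gammaFun b R := by
  have hi : ∀ x y : ℝ, IntervalIntegrable (fun τ => profile b τ * τ) volume x y := fun x y =>
    (hc.mul continuous_id).intervalIntegrable x y
  rw [gammaFun, ← intervalIntegral.integral_add_adjacent_intervals (hi 0 R) (hi R r), gammaFun,
    add_eq_left]
  refine (intervalIntegral.integral_congr_ae (g := fun _ => 0) (ae_of_all _ fun τ hτ => ?_)).trans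
    (by simp)
  rw [uIoc_of_le hr] at hτ
  rw [profile_eq_zero hb (hτ.1.trans_le (le_abs_self τ)), zero_mul]

/-- A couple of the class `𝒞` provides radial data. -/
theorem MagneticScattering.IsClassC.exists_radialField (h : IsClassC V b)
    (hV : Function.support V ⊆ Metric.closedBall 0 R)
    (hb : Function.support b ⊆ Metric.closedBall 0 R) (hr₀ : 0 < r₀) (hR : 0 < R) (hR₁ : R < R₁)
    (hr₁ : r₀ < R₁) :
    ∃ (C : ℝ) (Vp : ℝ → ℝ), RadialField r₀ R₁ C (gammaFun b) (profile b) (profile V) Vp := by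
  have hc := continuous_profile h.smooth_b.continuous
  obtain ⟨M₁, hM₁⟩ := h.piecewise_V.exists_bound fun r => profile_eq_zero hV
  obtain ⟨M₂, hM₂⟩ := (IsPiecewiseContinuous.of_continuous hc).exists_bound fun r =>
    profile_eq_zero hb
  choose Vp hVp using h.piecewise_V.exists_tendsto_gt
  have hct : Continuous fun τ => profile b τ * τ := hc.mul continuous_id
  have hd : ∀ r, HasDerivAt (gammaFun b) (profile b r * r) r := fun r =>
    intervalIntegral.integral_hasDerivAt_right (hct.intervalIntegrable _ _)
      (hct.stronglyMeasurableAtFilter _ _) hct.continuousAt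
  have hcγ : Continuous (gammaFun b) := continuous_iff_continuousAt.2 fun r => (hd r).continuousAt
  obtain ⟨M₃, hM₃⟩ := (isCompact_Icc (a := r₀) (b := R₁)).exists_bound_of_continuousOn
    hcγ.continuousOn
  have hγ : ∀ r, R₁ ≤ r → gammaFun b r = gammaFun b R₁ := fun r hr => by
    rw [gammaFun_eq hb hc (hR₁.le.trans hr), gammaFun_eq hb hc hR₁.le]
  refine ⟨max M₁ (max M₂ M₃), Vp, hr₀, hr₁, hd, fun r hr => ?_, fun r => ?_, fun r => ?_,
    fun r => ?_, h.piecewise_V.aestronglyMeasurable, hVp, fun r hr => ?_, fun r hr => ?_, hγ⟩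
  · refine le_trans ?_ ((le_max_right _ _).trans (le_max_right _ _))
    rcases le_total r R₁ with h1 | h1
    · exact hM₃ r ⟨hr, h1⟩
    · rw [hγ r h1]
      exact hM₃ R₁ ⟨hr₁.le, le_rfl⟩
  · exact (hM₂ r).trans ((le_max_left _ _).trans (le_max_right _ _))
  · exact (hM₁ r).trans (le_max_left _ _)
  · exact (le_of_tendsto (hVp r).abs (Eventually.of_forall hM₁)).trans (le_max_left _ _)
  · refine tendsto_nhds_unique (hVp r) (tendsto_const_nhds.congr' ?_)
    filter_upwards [self_mem_nhdsWithin] with s hs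
    have hs' : r < s := hs
    exact (profile_eq_zero hV (by rw [abs_of_pos] <;> linarith)).symm
  · exact profile_eq_zero hb (by rw [abs_of_pos] <;> linarith)

end ClassC

/-! ### Conclusion: the even integer is zero. -/

section Main

open Filter

variable {V b V' b' : Plane → ℝ} {r₀ R₀ R C C' : ℝ} {β Vp β' Vp' : ℝ → ℝ}

/-- Equality of the Regge functions on a Müntz set is incompatible with fluxes that differ by a
positive even integer. -/
theorem RadialField.flux_ne_add_two_mul (F : RadialField r₀ R C (gammaFun b) β (profile V) Vp)
    (F' : RadialField r₀ R C' (gammaFun b') β' (profile V') Vp') {L : Set ℕ}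
    (hLpos : ∀ l ∈ L, 0 < l) (hL : ¬ Summable (fun l : L => 1 / ((l : ℕ) : ℝ)))
    (hσ : ∀ l ∈ L, regge V b r₀ R₀ ((l : ℝ) : ℂ) = regge V' b' r₀ R₀ ((l : ℝ) : ℂ))
    (hσ0 : ∀ l ∈ L, regge V b r₀ R₀ ((l : ℝ) : ℂ) ≠ 0) {k : ℕ} (hk : 0 < k) :
    gammaFun b' R ≠ gammaFun b R + 2 * k := by
  intro h
  obtain ⟨φ, ψ, hφ, hdφ, hdψ⟩ := F.exists_regular
  obtain ⟨φ', ψ', hφ', hdφ', hdψ'⟩ := F'.exists_regular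
  obtain ⟨n, hn⟩ := exists_nat_ge (gammaFun b' R + 5 / 2)
  obtain ⟨j, rfl⟩ : ∃ j, k = j + 1 := ⟨k - 1, by omega⟩
  -- With k = j + 1, the choice n = 2j + 1 gives flux difference n + 1 = 2k and ladder indices 2k
  -- and 2k + 1.
  refine F.not_ladder_wronskian_eq_zero F' (n := 2 * j + 1) (by rw [h]; push_cast; ring) hφ hφ'
    hdφ hdψ hdφ' hdψ' (fun l hl => hLpos l hl.1)
    (not_summable_inter_Ici (f := fun l => 1 / (l : ℝ)) hL n) fun l hl => ?_
  have hnl : (n : ℝ) ≤ l := by exact_mod_cast hl.2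
  have := F.ladder_wronskian_eq_zero F' h (hn.trans hnl) (hφ (l : ℝ)).1 (hφ (l : ℝ)).2.1
    (hφ (l : ℝ)).2.2 (hφ' (l : ℝ)).1 (hφ' (l : ℝ)).2.1 (hφ' (l : ℝ)).2.2 (hσ l hl.1) (hσ0 l hl.1)
  rw [Complex.ofReal_natCast] at this
  exact this

theorem mainTheorem3 (r₀ R : ℝ) (hr₀ : 0 < r₀) (hR : 0 < R)
    (V b V' b' : Plane → ℝ) (hC : IsClassC V b) (hC' : IsClassC V' b')
    (hV : Function.support V ⊆ Metric.closedBall 0 R)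
    (hb : Function.support b ⊆ Metric.closedBall 0 R)
    (hV' : Function.support V' ⊆ Metric.closedBall 0 R)
    (hb' : Function.support b' ⊆ Metric.closedBall 0 R)
    (δ δ' : ℝ → ℝ) (hδ : IsPhaseShift V b r₀ R δ) (hδ' : IsPhaseShift V' b' r₀ R δ')
    (L : Set ℕ) (hLpos : ∀ l ∈ L, 0 < l)
    (hMuntz : ¬ Summable (fun l : L => 1 / ((l : ℕ) : ℝ)))
    (hL : ∀ l ∈ L, δ (l : ℝ) = δ' (l : ℝ)) :
    gammaFun b R = gammaFun b' R := by
  -- The matching radius must exceed both R and r₀, since r₀ may lie outside the supports; γ keeps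
  -- its value γ(R) there.
  have h1 : R < max R r₀ + 1 := (le_max_left _ _).trans_lt (lt_add_one _)
  have h2 : r₀ < max R r₀ + 1 := (le_max_right _ _).trans_lt (lt_add_one _)
  obtain ⟨C, Vp, F⟩ := hC.exists_radialField hV hb hr₀ hR h1 h2
  obtain ⟨C', Vp', F'⟩ := hC'.exists_radialField hV' hb' hr₀ hR h1 h2
  rw [← gammaFun_eq hb (continuous_profile hC.smooth_b.continuous) h1.le,
    ← gammaFun_eq hb' (continuous_profile hC'.smooth_b.continuous) h1.le]
  have hσ : ∀ l ∈ L, regge V b r₀ R ((l : ℝ) : ℂ) = regge V' b' r₀ R ((l : ℝ) : ℂ) :=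
    fun l hl => by rw [hδ.2, hδ'.2, hL l hl]
  have hσ0 : ∀ l ∈ L, regge V b r₀ R ((l : ℝ) : ℂ) ≠ 0 := fun l _ => by
    rw [hδ.2]
    exact Complex.exp_ne_zero _
  have hinf : L.Infinite := by
    intro hfin
    have := hfin.to_subtype
    exact hMuntz (Summable.of_finite)
  -- The two sequences agree for infinitely many l, which suffices to identify their limits.
  have hexp := tendsto_nhds_unique_of_frequently_eq (F.tendsto_regge R) (F'.tendsto_regge R)
    ((Nat.frequently_atTop_iff_infinite.2 hinf).mono hσ)
  obtain ⟨n, hn⟩ := Complex.exp_eq_exp_iff_exists_int.1 hexp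
  have hflux : gammaFun b (max R r₀ + 1) = gammaFun b' (max R r₀ + 1) + 2 * n := by
    have h3 : (Complex.I * Real.pi : ℂ) ≠ 0 := by simp [Real.pi_ne_zero]
    have h4 : (gammaFun b (max R r₀ + 1) : ℂ) = gammaFun b' (max R r₀ + 1) + 2 * n :=
      mul_left_cancel₀ h3 (by linear_combination hn)
    exact_mod_cast h4
  -- The sign of n decides which field has the larger flux and so plays the second role in
  -- `RadialField.flux_ne_add_two_mul`.
  rcases lt_trichotomy n 0 with hn0 | rfl | hn0
  · obtain ⟨k, hk⟩ := Int.eq_ofNat_of_zero_le (neg_nonneg.2 hn0.le)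
    refine absurd ?_ (F.flux_ne_add_two_mul F' hLpos hMuntz hσ hσ0 (k := k) (by omega))
    have : (n : ℝ) = -k := by rw [← neg_eq_iff_eq_neg]; exact_mod_cast hk
    rw [hflux, this]
    ring
  · simpa using hflux
  · obtain ⟨k, rfl⟩ := Int.eq_ofNat_of_zero_le hn0.le
    refine absurd ?_ (F'.flux_ne_add_two_mul F hLpos hMuntz (fun l hl => (hσ l hl).symm)
      (fun l hl => hσ l hl ▸ hσ0 l hl) (k := k) (by omega))
    simpa using hflux

end Main
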